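/- Let $M$ be a smooth $4$-manifold with an oriented atlas (all coordinate changes preserve orientation) and a smooth Lorentzian metric $g$ of signature $(+,-,-,-)$. Put $o_{jk}=\operatorname{diag}(1,-1,-1,-1)$ and $\epsilon^{ab}=\begin{pmatrix}0&1\\-1&0\end{pmatrix}$. Let $\sigma_{\alpha a\dot b}$ be a smooth field of Pauli matrices on $M$: a covector field with values in Hermitian $2\times2$ matrices such that $\sigma_{\alpha a\dot b}\sigma_\beta{}^{c\dot b}+\sigma_{\beta a\dot b}\sigma_\alpha{}^{c\dot b}=2g_{\alpha\beta}\delta_a{}^c$, where $\sigma_\alpha{}^{a\dot b}=\epsilon^{ac}\sigma_{\alpha c\dot d}\epsilon^{\dot b\dot d}$, and such that the second order Pauli matrices $\sigma_{\alpha\beta ac}=\frac12(\sigma_{\alpha a\dot b}\epsilon^{\dot b\dot d}\sigma_{\beta c\dot d}-\sigma_{\beta a\dot b}\epsilon^{\dot b\dot d}\sigma_{\alpha c\dot d})$ satisfy $*\sigma=+i\sigma$, where $(*Q)_{\alpha\beta}=\frac12\sqrt{|\det g|}\,Q^{\gamma\delta}\varepsilon_{\gamma\delta\alpha\beta}$,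 $\varepsilon_{0123}=+1$. For an affine connection $\Gamma$ and a spinor field $\xi^a$ put $\nabla_\alpha\xi^a=\partial_\alpha\xi^a+\frac14\sigma_\beta{}^{a\dot c}(\partial_\alpha\sigma^\beta{}_{b\dot c}+\Gamma^\beta{}_{\alpha\gamma}\sigma^\gamma{}_{b\dot c})\xi^b$ and $\nabla_\alpha\bar\xi^{\dot a}=\overline{\nabla_\alpha\xi^a}$. Write $\{\nabla\}$ for this derivative with the Levi-Civita connection of $g$. The Weyl equation is $i\sigma^\alpha{}_{a\dot b}\{\nabla\}_\alpha\xi^a=0$, and the Weyl Lagrangian is $$L_{\mathrm{Weyl}}(\xi)=\tfrac i2\bigl(\bar\xi^{\dot b}\sigma^\alpha{}_{a\dot b}\{\nabla\}_\alpha\xi^a-\xi^a\sigma^\alpha{}_{a\dot b}\{\nabla\}_\alpha\bar\xi^{\dot b}\bigr)*1,\qquad *1=\sqrt{|\det g|}\,dx^0\wedge dx^1\wedge dx^2\wedge dx^3 .$$ Let $\vartheta^j$, $j=0,1,2,3$, be a smooth coframe, i.e. real covector fields with $g=o_{jk}\vartheta^j\otimes\vartheta^k$, and let $l_j$ be real constants,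 not all zero, with $o^{jk}l_jl_k=0$, where $o^{jk}=o_{jk}$. Write $|\nabla|$ for the covariant derivative of the Weitzenböck connection, which is given by $\partial_\alpha\vartheta^j_\beta-|\Gamma|^\gamma{}_{\alpha\beta}\vartheta^j_\gamma=0$. On an open set $V\subseteq M$, a smooth spinor field $\xi$ is called associated with the coframe, with sign $s\in\{1,-1\}$, if $|\nabla|\xi=0$ and $\sigma_{\alpha a\dot b}\xi^a\bar\xi^{\dot b}=s\,l_j\vartheta^j_\alpha$ on $V$. Consider the Lagrangian $L(\vartheta^j,l_j)=l_i\,o_{jk}\,\vartheta^i\wedge\vartheta^j\wedge d\vartheta^k$. The coframe satisfies the field equation $\partial S/\partial\vartheta^j=0$ on $V$ if in every coordinate patch the derivative at $t=0$ of the action $S=\int L$ vanishes along every smooth one-parameter family $\vartheta_t^j$ of coframes of the fixed metric $g$ on the part of $V$ in the patch with $\vartheta_0^j=\vartheta^j$ and $\vartheta_t^j=\vartheta^j$ outside a compact subset of that part. Then: 1. Every point of $M$ has a connected open neighbourhood on which an associated spinor field exists. On a connected open set any two associated spinor fields differ by a constant complex factor of modulus $1$. 2. If $\xi$ is associated with the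 coframe, with sign $s$, on an open set $V$, then on $V$ $$L(\vartheta^j,l_j)=4s\,L_{\mathrm{Weyl}}(\xi),$$ and the coframe satisfies the field equation on $V$ if and only if $\xi$ satisfies the Weyl equation on $V$. -/

import Mathlib

open scoped Manifold ContDiff

noncomputable section

namespace Teleparallel

/-- The coordinate space `ℝ⁴`. -/
abbrev E4 := EuclideanSpace ℝ (Fin 4)

/-- The Minkowski matrix `o = diag(1,-1,-1,-1)`. -/
def mink : Matrix (Fin 4) (Fin 4) ℝ := Matrix.diagonal ![1, -1, -1, -1]

/-- The Levi-Civita symbol `ε_{αβγδ}`, with `ε_{0123} = +1`. -/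
def leviCivita (α β γ δ : Fin 4) : ℝ :=
  Matrix.det (Matrix.of fun i j : Fin 4 => if ![α, β, γ, δ] i = j then (1 : ℝ) else 0)

/-- The spinor metric `ε^{ab}`. -/
def spinorEps : Matrix (Fin 2) (Fin 2) ℂ := !![0, 1; -1, 0]

/-- Raising both spinor indices: `A^{aḃ} = ε^{ac} A_{cḋ} ε^{ḃḋ}`. -/
def spinorRaise (A : Matrix (Fin 2) (Fin 2) ℂ) : Matrix (Fin 2) (Fin 2) ℂ :=
  spinorEps * A * spinorEps.transpose

/-! ### Calculus in one coordinate patch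

`G y α β = g_{αβ}(y)`, `T y j α = ϑ^j_α(y)`, `S y α a b = σ_{αaḃ}(y)` and `X y a = ξ^a(y)`
are the components of the metric, the coframe, the Pauli matrices and the spinor field. -/

/-- The partial derivative `∂_α f`. -/
def pd {F : Type*} [NormedAddCommGroup F] [NormedSpace ℝ F]
    (α : Fin 4) (f : E4 → F) (y : E4) : F :=
  fderiv ℝ f y (EuclideanSpace.single α 1)

/-- The Christoffel symbols `{Γ}^β_{αγ}` of the metric, written `christoffel G y β α γ`. -/
def christoffel (G : E4 → Matrix (Fin 4) (Fin 4) ℝ) (y : E4) (β α γ : Fin 4) : ℝ :=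
  (1 / 2) * ∑ δ, (G y)⁻¹ β δ *
    (pd α (fun z => G z γ δ) y + pd γ (fun z => G z α δ) y - pd δ (fun z => G z α γ) y)

/-- The teleparallel (Weitzenböck) connection coefficients `|Γ|^γ_{αβ}`, written
`weitzenbock T y γ α β`; see `weitzenbock_spec`. -/
def weitzenbock (T : E4 → Matrix (Fin 4) (Fin 4) ℝ) (y : E4) (γ α β : Fin 4) : ℝ :=
  ∑ j, (T y)⁻¹ γ j * pd α (fun z => T z j β) y

/-- The coefficients solve the defining system `∂_α ϑ^j_β - |Γ|^γ_{αβ} ϑ^j_γ = 0`, whose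
solution is unique because the matrix `ϑ^j_γ` is invertible. -/
theorem weitzenbock_spec (T : E4 → Matrix (Fin 4) (Fin 4) ℝ) (y : E4)
    (hT : IsUnit (T y).det) (Γ : Fin 4 → Fin 4 → Fin 4 → ℝ) :
    (∀ j α β, pd α (fun z => T z j β) y - ∑ γ, Γ γ α β * T y j γ = 0) ↔
      Γ = weitzenbock T y := by
  have key : ∀ α β, (∀ j, pd α (fun z => T z j β) y - ∑ γ, Γ γ α β * T y j γ = 0) ↔
      (fun γ => Γ γ α β) = fun γ => weitzenbock T y γ α β := by
    intro α β
    have h1 : (fun γ => weitzenbock T y γ α β) =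
        Matrix.mulVec (T y)⁻¹ (fun j => pd α (fun z => T z j β) y) := by
      funext γ; rfl
    have h2 : (∀ j, pd α (fun z => T z j β) y - ∑ γ, Γ γ α β * T y j γ = 0) ↔
        (fun j => pd α (fun z => T z j β) y) = Matrix.mulVec (T y) (fun γ => Γ γ α β) := by
      rw [funext_iff]
      refine forall_congr' fun j => ?_
      rw [sub_eq_zero]
      simp only [Matrix.mulVec, dotProduct, mul_comm]
    rw [h1, h2]
    constructor
    · intro h
      rw [h, Matrix.mulVec_mulVec, Matrix.nonsing_inv_mul _ hT, Matrix.one_mulVec]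
    · intro h
      rw [h, Matrix.mulVec_mulVec, Matrix.mul_nonsing_inv _ hT, Matrix.one_mulVec]
  constructor
  · intro h
    funext γ α β
    exact congrFun ((key α β).1 fun j => h j α β) γ
  · intro h j α β
    exact (key α β).2 (by rw [h]) j

/-- `σ^β_{aḃ} = g^{βγ} σ_{γaḃ}`. -/
def sigmaUp (G : E4 → Matrix (Fin 4) (Fin 4) ℝ)
    (S : E4 → Fin 4 → Matrix (Fin 2) (Fin 2) ℂ) (y : E4) (β : Fin 4) (a b : Fin 2) : ℂ :=
  ∑ γ, ((G y)⁻¹ β γ : ℂ) * S y γ a b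

/-- The covariant derivative of a spinor field for the affine connection `Γ`:
`∇_α ξ^a = ∂_α ξ^a + ¼ σ_β^{aċ} (∂_α σ^β_{bċ} + Γ^β_{αγ} σ^γ_{bċ}) ξ^b`. -/
def spinorCovDeriv (G : E4 → Matrix (Fin 4) (Fin 4) ℝ)
    (S : E4 → Fin 4 → Matrix (Fin 2) (Fin 2) ℂ) (Γ : E4 → Fin 4 → Fin 4 → Fin 4 → ℝ)
    (X : E4 → Fin 2 → ℂ) (y : E4) (α : Fin 4) (a : Fin 2) : ℂ :=
  pd α (fun z => X z a) y +
    (1 / 4) * ∑ b, (∑ β, ∑ c, spinorRaise (S y β) a c *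
      (pd α (fun z => sigmaUp G S z β b c) y +
        ∑ γ, (Γ y β α γ : ℂ) * sigmaUp G S y γ b c)) * X y b

/-- The left-hand side `i σ^α_{aḃ} {∇}_α ξ^a` of the Weyl equation. -/
def weylOperator (G : E4 → Matrix (Fin 4) (Fin 4) ℝ)
    (S : E4 → Fin 4 → Matrix (Fin 2) (Fin 2) ℂ) (X : E4 → Fin 2 → ℂ)
    (y : E4) (b : Fin 2) : ℂ :=
  Complex.I * ∑ α, ∑ a, sigmaUp G S y α a b * spinorCovDeriv G S (christoffel G) X y α a

/-- The coefficient of `dx⁰∧dx¹∧dx²∧dx³` in the Weyl Lagrangian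
`(i/2) (ξ̄^ḃ σ^α_{aḃ} {∇}_α ξ^a - ξ^a σ^α_{aḃ} {∇}_α ξ̄^ḃ) *1`,
where `*1 = √|det g| dx⁰∧dx¹∧dx²∧dx³`. -/
def weylDensity (G : E4 → Matrix (Fin 4) (Fin 4) ℝ)
    (S : E4 → Fin 4 → Matrix (Fin 2) (Fin 2) ℂ) (X : E4 → Fin 2 → ℂ) (y : E4) : ℂ :=
  (Complex.I / 2) *
    (∑ α, ∑ a, ∑ b,
      (star (X y b) * sigmaUp G S y α a b * spinorCovDeriv G S (christoffel G) X y α a -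
        X y a * sigmaUp G S y α a b * star (spinorCovDeriv G S (christoffel G) X y α b))) *
    (Real.sqrt |(G y).det| : ℂ)

/-- The coefficient of `dx⁰∧dx¹∧dx²∧dx³` in the 4-form `l_i o_{jk} ϑ^i ∧ ϑ^j ∧ dϑ^k`, where
`ϑ^i = ϑ^i_α dx^α` and `dϑ^k = ∂_γ ϑ^k_δ dx^γ ∧ dx^δ`. -/
def teleparallelDensity (l : Fin 4 → ℝ) (T : E4 → Matrix (Fin 4) (Fin 4) ℝ) (y : E4) : ℝ :=
  ∑ i, ∑ j, ∑ k, l i * mink j k *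
    ∑ α, ∑ β, ∑ γ, ∑ δ, leviCivita α β γ δ * T y i α * T y j β * pd γ (fun z => T z k δ) y

/-- The coframe with components `T` is a stationary point on the open set `U` of the action
`∫ l_i o_{jk} ϑ^i ∧ ϑ^j ∧ dϑ^k` under variation of the coframe subject to the constraint
`g = o_{jk} ϑ^j ⊗ ϑ^k` (the metric is not varied): along every smooth one-parameter family `Θ` of
coframes of `g` on `U` that starts at `T` and agrees with `T` outside a compact set `K ⊆ U`, the
derivative at `0` of the action vanishes. -/
def IsStationary (U : Set E4) (G : E4 → Matrix (Fin 4) (Fin 4) ℝ) (l : Fin 4 → ℝ)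
    (T : E4 → Matrix (Fin 4) (Fin 4) ℝ) : Prop :=
  ∀ (Θ : ℝ → E4 → Matrix (Fin 4) (Fin 4) ℝ) (K : Set E4), IsCompact K → K ⊆ U →
    (∀ j α, ContDiffOn ℝ ∞ (fun p : ℝ × E4 => Θ p.1 p.2 j α) (Set.univ ×ˢ U)) →
    (∀ t, ∀ y ∈ U, ∀ α β, G y α β = ∑ j, ∑ k, mink j k * Θ t y j α * Θ t y k β) →
    (∀ y ∈ U, Θ 0 y = T y) →
    (∀ t, ∀ y ∈ U \ K, Θ t y = T y) →
    HasDerivAt (fun t : ℝ => ∫ y in K, teleparallelDensity l (Θ t) y) 0 0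

/-! ### Fields on a manifold -/

variable {M : Type*} [TopologicalSpace M] [ChartedSpace E4 M]

variable (M) in
/-- All coordinate changes of the atlas preserve orientation. -/
def IsOrientedAtlas : Prop :=
  ∀ e ∈ atlas E4 M, ∀ e' ∈ atlas E4 M, ∀ y ∈ (e.symm.trans e').source,
    0 < (fderiv ℝ (fun z => e' (e.symm z)) y).det

variable (M) in
/-- Fields of bilinear forms on the tangent spaces. -/
abbrev BilinField := (x : M) → LinearMap.BilinForm ℝ (TangentSpace (𝓡 4) x)

variable (M) in
/-- Real covector fields. -/
abbrev CovectorField := (x : M) → TangentSpace (𝓡 4) x →ₗ[ℝ] ℝ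

variable (M) in
/-- Covector fields with values in complex `2 × 2` matrices. -/
abbrev MatrixCovectorField :=
  (x : M) → TangentSpace (𝓡 4) x →ₗ[ℝ] Matrix (Fin 2) (Fin 2) ℂ

/-- The coordinate vector `∂_α` of the chart `e` at the point with coordinates `y`. -/
def coordVec (e : OpenPartialHomeomorph M E4) (y : E4) (α : Fin 4) :
    TangentSpace (𝓡 4) (e.symm y) :=
  mfderiv (𝓡 4) (𝓡 4) e.symm y (EuclideanSpace.single α (1 : ℝ) : E4)

/-- The components `g_{αβ}` in the chart `e`. -/
def metricIn (e : OpenPartialHomeomorph M E4) (g : BilinField M) (y : E4) :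
    Matrix (Fin 4) (Fin 4) ℝ :=
  Matrix.of fun α β => g (e.symm y) (coordVec e y α) (coordVec e y β)

/-- The components `ϑ^j_α` in the chart `e`. -/
def coframeIn (e : OpenPartialHomeomorph M E4) (ϑ : Fin 4 → CovectorField M) (y : E4) :
    Matrix (Fin 4) (Fin 4) ℝ :=
  Matrix.of fun j α => ϑ j (e.symm y) (coordVec e y α)

/-- The components `σ_{αaḃ}` in the chart `e`. -/
def pauliIn (e : OpenPartialHomeomorph M E4) (σ : MatrixCovectorField M) (y : E4)
    (α : Fin 4) : Matrix (Fin 2) (Fin 2) ℂ :=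
  σ (e.symm y) (coordVec e y α)

/-- The components `ξ^a` as functions of the coordinates of the chart `e`. -/
def spinorIn (e : OpenPartialHomeomorph M E4) (ξ : M → Fin 2 → ℂ) (y : E4) : Fin 2 → ℂ :=
  ξ (e.symm y)

/-- The part of the set `V` that is covered by the chart `e`, in coordinates. -/
def domIn (e : OpenPartialHomeomorph M E4) (V : Set M) : Set E4 :=
  e.target ∩ e.symm ⁻¹' V

/-- `g` is a smooth Lorentzian metric of signature `(+,-,-,-)`. -/
structure IsLorentzMetric (g : BilinField M) : Prop where
  symm : ∀ x v w, g x v w = g x w v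
  signature : ∀ x, ∃ b : Module.Basis (Fin 4) ℝ (TangentSpace (𝓡 4) x),
    ∀ i j, g x (b i) (b j) = mink i j
  smooth : ∀ e ∈ atlas E4 M, ∀ α β, ContDiffOn ℝ ∞ (fun y => metricIn e g y α β) e.target

/-- `ϑ` is a smooth coframe for `g`: `g = o_{jk} ϑ^j ⊗ ϑ^k`. -/
structure IsCoframe (g : BilinField M) (ϑ : Fin 4 → CovectorField M) : Prop where
  metric_eq : ∀ x v w, g x v w = ∑ j, ∑ k, mink j k * ϑ j x v * ϑ k x w
  smooth : ∀ e ∈ atlas E4 M, ∀ j α, ContDiffOn ℝ ∞ (fun y => coframeIn e ϑ y j α) e.target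

/-- The second order Pauli matrices
`σ_{αβac} = ½ (σ_{αaḃ} ε^{ḃḋ} σ_{βcḋ} - σ_{βaḃ} ε^{ḃḋ} σ_{αcḋ})`. -/
def sigmaTwo (S : E4 → Fin 4 → Matrix (Fin 2) (Fin 2) ℂ) (y : E4) (α β : Fin 4) :
    Matrix (Fin 2) (Fin 2) ℂ :=
  (1 / 2 : ℂ) • (S y α * spinorEps * (S y β).transpose - S y β * spinorEps * (S y α).transpose)

/-- `σ` is a smooth field of Pauli matrices for `g`: Hermitian matrices with
`σ_{αaḃ} σ_β^{cḃ} + σ_{βaḃ} σ_α^{cḃ} = 2 g_{αβ} δ_a^c` and polarization `*σ = +iσ` of the second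
order Pauli matrices, where `(*Q)_{αβ} = ½ √|det g| Q^{γδ} ε_{γδαβ}`. -/
structure IsPauli (g : BilinField M) (σ : MatrixCovectorField M) : Prop where
  hermitian : ∀ x v, (σ x v).IsHermitian
  clifford : ∀ x v w,
    σ x v * (spinorRaise (σ x w)).transpose + σ x w * (spinorRaise (σ x v)).transpose =
      ((2 * g x v w : ℝ) : ℂ) • (1 : Matrix (Fin 2) (Fin 2) ℂ)
  polarized : ∀ e ∈ atlas E4 M, ∀ y ∈ e.target, ∀ α β a c,
    (1 / 2) * (Real.sqrt |(metricIn e g y).det| : ℂ) *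
      (∑ γ, ∑ δ, ∑ μ, ∑ ν, ((metricIn e g y)⁻¹ γ μ : ℂ) * ((metricIn e g y)⁻¹ δ ν : ℂ) *
        sigmaTwo (pauliIn e σ) y μ ν a c * (leviCivita γ δ α β : ℂ)) =
      Complex.I * sigmaTwo (pauliIn e σ) y α β a c
  smooth : ∀ e ∈ atlas E4 M, ∀ α a b, ContDiffOn ℝ ∞ (fun y => pauliIn e σ y α a b) e.target

/-- `ξ` is a spinor field on `V` associated with the coframe `ϑ` and the constants `l_j`:
a smooth solution of `|∇|ξ = 0`, `σ_{αaḃ} ξ^a ξ̄^ḃ = s l_j ϑ^j_α`, where `s = ±1`. (The left-hand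
side of the second equation lies on the forward light cone by definition of the latter, so that
the equation fixes the sign `s`.) -/
structure IsAssociated (g : BilinField M) (σ : MatrixCovectorField M)
    (ϑ : Fin 4 → CovectorField M) (l : Fin 4 → ℝ) (V : Set M) (s : ℝ) (ξ : M → Fin 2 → ℂ) :
    Prop where
  sign : s = 1 ∨ s = -1
  smooth : ∀ e ∈ atlas E4 M, ∀ a, ContDiffOn ℝ ∞ (fun y => spinorIn e ξ y a) (domIn e V)
  parallel : ∀ e ∈ atlas E4 M, ∀ y ∈ domIn e V, ∀ α a,
    spinorCovDeriv (metricIn e g) (pauliIn e σ) (weitzenbock (coframeIn e ϑ))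
      (spinorIn e ξ) y α a = 0
  current : ∀ x ∈ V, ∀ v,
    ∑ a, ∑ b, σ x v a b * ξ x a * star (ξ x b) = ((s * ∑ j, l j * ϑ j x v : ℝ) : ℂ)

/-- The field equation `∂S/∂ϑ^j = 0` on `V`: the coframe is a stationary point of the action in
every coordinate patch. -/
def FieldEquation (g : BilinField M) (ϑ : Fin 4 → CovectorField M) (l : Fin 4 → ℝ)
    (V : Set M) : Prop :=
  ∀ e ∈ atlas E4 M, IsStationary (domIn e V) (metricIn e g) l (coframeIn e ϑ)

/-- The Weyl equation `i σ^α_{aḃ} {∇}_α ξ^a = 0` on `V`. -/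
def WeylEquation (g : BilinField M) (σ : MatrixCovectorField M) (V : Set M)
    (ξ : M → Fin 2 → ℂ) : Prop :=
  ∀ e ∈ atlas E4 M, ∀ y ∈ domIn e V, ∀ b,
    weylOperator (metricIn e g) (pauliIn e σ) (spinorIn e ξ) y b = 0

/-- The equality of 4-forms `L(ϑ^j, l_j) = 4 s L_Weyl(ξ)` on `V`. -/
def LagrangiansAgree (g : BilinField M) (σ : MatrixCovectorField M)
    (ϑ : Fin 4 → CovectorField M) (l : Fin 4 → ℝ) (V : Set M) (s : ℝ) (ξ : M → Fin 2 → ℂ) :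
    Prop :=
  ∀ e ∈ atlas E4 M, ∀ y ∈ domIn e V,
    (teleparallelDensity l (coframeIn e ϑ) y : ℂ) =
      (s : ℂ) * 4 * weylDensity (metricIn e g) (pauliIn e σ) (spinorIn e ξ) y

end Teleparallel

end

open scoped Manifold ContDiff

noncomputable section

namespace Teleparallel

/-! ### The Levi-Civita symbol -/

/-! Everything except existence and uniqueness of the spinor reduces to algebra at one point.
Hermiticity and the Clifford relations say that the coefficients of the given Pauli matrices in the
standard ones form an orthonormal coframe `E` (`exists_isPauliFrame`), and the polarization says `0
< det E` (`IsPauliFrame.det_pos`). The Weitzenböck and Levi-Civita connections both preserve the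
metric, so their difference, the contortion `K`, is antisymmetric in the frame
(`exists_contortion`). The Levi-Civita connection is torsion free, so `dϑ` is an antisymmetrization
of `K`; and since `ξ` is parallel for the Weitzenböck connection, its Levi-Civita derivative is
linear in `K` and in `ξ`. Both Lagrangians thus become polynomials in `K` and `ξ`, and they agree by
`altSum_current_eq`.

For the field equation, a variation of the coframe at fixed metric is an infinitesimal Lorentz
rotation `B` at each point. After integration by parts the first variation is the integral of
`eulerLagrange` (`hasDerivAt_action`), and the fundamental lemma of the calculus of variations makes
stationarity pointwise (`IsPatch.isStationary_iff`). In the frame this expression is a nonzero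
multiple of the real part of the pairing of the rotated spinor `Bξ` with the Weyl operator
(`eulerLagrange_frame`). Since `ξ ≠ 0` and the infinitesimal Lorentz group carries `ξ` to every
vector of `ℂ²`, its vanishing for all `B` is the Weyl equation (`eq_zero_of_forall_spinorRotation`).

For existence, let `R x j` be the component of `σ` along `ϑ^j`. Near a point `p` these Hermitian
matrices are `c* R(p) c` for a smooth `c` of determinant `1`, obtained by normalizing the explicit
intertwiner `1 + ∑ bₖ aₖ` of two representations of the Pauli algebra (`IsPauliBasis.conj_eq`). In
these terms the Weitzenböck connection form is `adj(c) dc`, so `adj(c) κ` is parallel for every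
constant `κ`; a null `l` corresponds to a Hermitian matrix of rank one, which supplies a `κ` with
the right current. For uniqueness, the current determines the spinor up to a phase, the derivative
of the phase vanishes because both spinors are parallel, and connectedness does the rest. -/

theorem leviCivita_eq (α β γ δ : Fin 4) : leviCivita α β γ δ =
    (((β : ℕ) - (α : ℕ) : ℝ) * ((γ : ℕ) - (α : ℕ)) * ((δ : ℕ) - (α : ℕ)) * ((γ : ℕ) - (β : ℕ)) *
      ((δ : ℕ) - (β : ℕ)) * ((δ : ℕ) - (γ : ℕ))) / 12 := by
  -- The symbol is the Vandermonde product of its four indices, normalized by the value `12 =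
  -- 1!·2!·3!` at `(0, 1, 2, 3)`. Over the integers this is a finite check.
  have key : ∀ α β γ δ : Fin 4,
      12 * Matrix.det (Matrix.of fun i j : Fin 4 => if ![α, β, γ, δ] i = j then (1 : ℤ) else 0) =
      (((β : ℕ) - (α : ℕ) : ℤ) * ((γ : ℕ) - (α : ℕ)) * ((δ : ℕ) - (α : ℕ)) *
        ((γ : ℕ) - (β : ℕ)) * ((δ : ℕ) - (β : ℕ)) * ((δ : ℕ) - (γ : ℕ))) := by
    decide +kernel
  have h := congrArg (Int.cast : ℤ → ℝ) (key α β γ δ)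
  rw [eq_div_iff (by norm_num), leviCivita, mul_comm]
  push_cast at h
  rw [← h]
  congr 2
  ext i j
  simp only [Matrix.of_apply, Matrix.map_apply]
  split <;> simp

/-- Contraction of a covariant 4-tensor with the Levi-Civita symbol. -/
def altSum (X : Fin 4 → Fin 4 → Fin 4 → Fin 4 → ℝ) : ℝ :=
  ∑ α, ∑ β, ∑ γ, ∑ δ, leviCivita α β γ δ * X α β γ δ

/-- The expansion into 24 signed terms turns the tensor identities below into polynomial identities
accessible to `ring`. -/
theorem altSum_eq (X : Fin 4 → Fin 4 → Fin 4 → Fin 4 → ℝ) : altSum X =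
    X 0 1 2 3 - X 0 1 3 2 - X 0 2 1 3 + X 0 2 3 1 + X 0 3 1 2 - X 0 3 2 1
    - X 1 0 2 3 + X 1 0 3 2 + X 1 2 0 3 - X 1 2 3 0 - X 1 3 0 2 + X 1 3 2 0
    + X 2 0 1 3 - X 2 0 3 1 - X 2 1 0 3 + X 2 1 3 0 + X 2 3 0 1 - X 2 3 1 0
    - X 3 0 1 2 + X 3 0 2 1 + X 3 1 0 2 - X 3 1 2 0 - X 3 2 0 1 + X 3 2 1 0 := by
  simp only [altSum, leviCivita_eq, Fin.sum_univ_four, Fin.val_zero, Fin.val_one, Fin.val_two,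
    show ((3 : Fin 4) : ℕ) = 3 from rfl]
  norm_num
  ring

theorem det_eq_altSum (A : Matrix (Fin 4) (Fin 4) ℝ) :
    A.det = altSum fun α β γ δ => A 0 α * A 1 β * A 2 γ * A 3 δ := by
  rw [altSum_eq]
  simp [Matrix.det_succ_row_zero, Fin.sum_univ_succ, Fin.succAbove]
  ring

/-- Left multiplication by the 0-1 matrix that defines the symbol selects the rows `a, b, c, d` of
`E`; the claim is then multiplicativity of the determinant. -/
theorem altSum_rows (E : Matrix (Fin 4) (Fin 4) ℝ) (a b c d : Fin 4) :
    (altSum fun α β γ δ => E a α * E b β * E c γ * E d δ) = E.det * leviCivita a b c d := by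
  have h := det_eq_altSum
    ((Matrix.of fun i j : Fin 4 => if ![a, b, c, d] i = j then (1 : ℝ) else 0) * E)
  rw [Matrix.det_mul, mul_comm] at h
  have hrow : ∀ i α, ((Matrix.of fun i j : Fin 4 =>
      if ![a, b, c, d] i = j then (1 : ℝ) else 0) * E) i α = E (![a, b, c, d] i) α := by
    intro i α
    rw [Matrix.mul_apply, Finset.sum_eq_single (![a, b, c, d] i)]
    · simp only [Matrix.of_apply, if_true, one_mul]
    · intro j _ hj
      simp only [Matrix.of_apply, if_neg (Ne.symm hj), zero_mul]
    · simp
  rw [leviCivita, h]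
  simp only [hrow]
  rfl

theorem altSum_pullback (E : Matrix (Fin 4) (Fin 4) ℝ) (X : Fin 4 → Fin 4 → Fin 4 → Fin 4 → ℝ) :
    (altSum fun α β γ δ => ∑ a, ∑ b, ∑ c, ∑ d, E a α * E b β * E c γ * E d δ * X a b c d) =
      E.det * altSum X := by
  have h : ∀ a b c d, E.det * leviCivita a b c d * X a b c d =
      ∑ α, ∑ β, ∑ γ, ∑ δ,
        leviCivita α β γ δ * (E a α * E b β * E c γ * E d δ * X a b c d) := by
    intro a b c d
    rw [← altSum_rows, altSum]
    simp only [Finset.sum_mul]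
    simp only [mul_assoc]
  have h2 : E.det * altSum X = ∑ a, ∑ b, ∑ c, ∑ d, E.det * leviCivita a b c d * X a b c d := by
    simp only [altSum, Finset.mul_sum, mul_assoc]
  rw [h2]
  simp only [h, altSum, Finset.mul_sum]
  have h3 := Finset.sum_comm (s := Finset.univ) (t := Finset.univ)
    (f := fun p q : Fin 4 × Fin 4 × Fin 4 × Fin 4 =>
      leviCivita p.1 p.2.1 p.2.2.1 p.2.2.2 * (E q.1 p.1 * E q.2.1 p.2.1 * E q.2.2.1 p.2.2.1 *
        E q.2.2.2 p.2.2.2 * X q.1 q.2.1 q.2.2.1 q.2.2.2))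
  simpa only [Fintype.sum_prod_type] using h3

theorem altSum_add (X Y : Fin 4 → Fin 4 → Fin 4 → Fin 4 → ℝ) :
    (altSum fun α β γ δ => X α β γ δ + Y α β γ δ) = altSum X + altSum Y := by
  simp only [altSum, mul_add, Finset.sum_add_distrib]

theorem altSum_sub (X Y : Fin 4 → Fin 4 → Fin 4 → Fin 4 → ℝ) :
    (altSum fun α β γ δ => X α β γ δ - Y α β γ δ) = altSum X - altSum Y := by
  simp only [altSum, mul_sub, Finset.sum_sub_distrib]

/-! ### Pauli matrices in an orthonormal frame -/

/-- The diagonal of the Minkowski matrix. -/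
def eta : Fin 4 → ℝ := ![1, -1, -1, -1]

theorem mink_apply (j k : Fin 4) : mink j k = if j = k then eta j else 0 := rfl

theorem sum_mink (f : Fin 4 → Fin 4 → ℝ) : ∑ j, ∑ k, mink j k * f j k = ∑ j, eta j * f j j := by
  simp [mink_apply]

theorem eta_mul_eta (j : Fin 4) : eta j * eta j = 1 := by
  fin_cases j <;> simp [eta]

/-- The standard Pauli matrices. -/
def pauli : Fin 4 → Matrix (Fin 2) (Fin 2) ℂ :=
  ![!![1, 0; 0, 1], !![0, 1; 1, 0], !![0, -Complex.I; Complex.I, 0], !![1, 0; 0, -1]]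

/-- The difference of two spinor derivatives in an orthonormal frame, in terms of the
contortion `K`. -/
def contortionDeriv (K : Fin 4 → Fin 4 → Fin 4 → ℝ) (ξ : Fin 2 → ℂ) (c : Fin 4) (a : Fin 2) : ℂ :=
  -(1 / 4) * ∑ b, (∑ m, ∑ d, ((eta m * eta d * K m c d : ℝ) : ℂ) *
    ∑ e, spinorRaise (pauli m) a e * pauli d b e) * ξ b

/-- The Weyl operator in an orthonormal frame, in terms of the contortion. -/
def frameWeyl (K : Fin 4 → Fin 4 → Fin 4 → ℝ) (ξ : Fin 2 → ℂ) (b : Fin 2) : ℂ :=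
  Complex.I * ∑ c, ∑ a, (eta c : ℂ) * pauli c a b * contortionDeriv K ξ c a

/-- The current of a spinor. -/
def current (ξ : Fin 2 → ℂ) : Fin 4 → ℝ :=
  ![‖ξ 0‖ ^ 2 + ‖ξ 1‖ ^ 2, 2 * (ξ 0 * star (ξ 1)).re, 2 * (ξ 0 * star (ξ 1)).im,
    ‖ξ 0‖ ^ 2 - ‖ξ 1‖ ^ 2]

theorem current_eq (ξ : Fin 2 → ℂ) (j : Fin 4) :
    ∑ a, ∑ b, pauli j a b * ξ a * star (ξ b) = (current ξ j : ℂ) := by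
  fin_cases j <;> apply Complex.ext <;>
    simp [pauli, current, Fin.sum_univ_two, ← Complex.normSq_eq_norm_sq, Complex.normSq_apply] <;>
    ring

theorem spinorRaise_eq (A : Matrix (Fin 2) (Fin 2) ℂ) :
    spinorRaise A = !![A 1 1, -A 1 0; -A 0 1, A 0 0] := by
  ext i j
  fin_cases i <;> fin_cases j <;> simp [spinorRaise, spinorEps, Matrix.mul_apply, Fin.sum_univ_two, Matrix.vecMul, dotProduct]

/-- Contortion is antisymmetric in its outer indices. -/
def IsContortion (K : Fin 4 → Fin 4 → Fin 4 → ℝ) : Prop := ∀ b c d, K b c d = -K d c b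

theorem IsContortion.diag {K : Fin 4 → Fin 4 → Fin 4 → ℝ} (h : IsContortion K) (b c : Fin 4) :
    K b c b = 0 := by
  have := h b c b
  linarith

/-- For a fixed middle index the contortion is an element of the Lorentz algebra, acting on spinors
as a traceless complex matrix whose coefficients combine boosts `K 0 c i` with rotations `K i c j`.
This is its first row, and `contortionDeriv_one` its second. -/
theorem contortionDeriv_zero {K : Fin 4 → Fin 4 → Fin 4 → ℝ} (hK : IsContortion K)
    (ξ : Fin 2 → ℂ) (c : Fin 4) : contortionDeriv K ξ c 0 =
      1 / 2 * ((K 0 c 3 - Complex.I * K 1 c 2) * ξ 0 +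
        (K 0 c 1 + Complex.I * K 0 c 2 - Complex.I * K 2 c 3 - K 1 c 3) * ξ 1) := by
  simp [contortionDeriv, Fin.sum_univ_two, Fin.sum_univ_four, eta, pauli, spinorRaise_eq,
    hK.diag, hK 1 c 0, hK 2 c 0, hK 3 c 0, hK 2 c 1, hK 3 c 1, hK 3 c 2]
  ring

theorem contortionDeriv_one {K : Fin 4 → Fin 4 → Fin 4 → ℝ} (hK : IsContortion K)
    (ξ : Fin 2 → ℂ) (c : Fin 4) : contortionDeriv K ξ c 1 =
      1 / 2 * ((-K 0 c 3 + Complex.I * K 1 c 2) * ξ 1 +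
        (K 0 c 1 - Complex.I * K 0 c 2 - Complex.I * K 2 c 3 + K 1 c 3) * ξ 0) := by
  simp [contortionDeriv, Fin.sum_univ_two, Fin.sum_univ_four, eta, pauli, spinorRaise_eq,
    hK.diag, hK 1 c 0, hK 2 c 0, hK 3 c 0, hK 2 c 1, hK 3 c 1, hK 3 c 2]
  ring

set_option maxHeartbeats 2000000 in
-- The algebraic core of the equality of Lagrangians, and the source of its factor `4`. The left
-- side is the teleparallel density with `l` replaced by the current, up to the sign `s` and a
-- determinant.
theorem altSum_current_eq {K : Fin 4 → Fin 4 → Fin 4 → ℝ} (hK : IsContortion K) (ξ : Fin 2 → ℂ) :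
    ((altSum fun a b c d => current ξ a * K b c d : ℝ) : ℂ) =
      4 * ((Complex.I / 2) * ∑ c, ∑ a, ∑ b,
        (star (ξ b) * (eta c * pauli c a b) * contortionDeriv K ξ c a -
          ξ a * (eta c * pauli c a b) * star (contortionDeriv K ξ c b))) := by
  rw [altSum_eq]
  apply Complex.ext <;>
  · simp only [Fin.sum_univ_two, Fin.sum_univ_four, contortionDeriv_zero hK, contortionDeriv_one hK]
    simp [current, eta, pauli, ← Complex.normSq_eq_norm_sq, Complex.normSq_apply,
      hK 1 _ 0, hK 2 _ 0, hK 3 _ 0, hK 2 _ 1, hK 3 _ 1, hK 3 _ 2]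
    ring

/-- The infinitesimal action of the Lorentz group on spinors. -/
def spinorRotation (B : Fin 4 → Fin 4 → ℝ) (ξ : Fin 2 → ℂ) (a : Fin 2) : ℂ :=
  -contortionDeriv (fun m _ d => B m d) ξ 0 a

/-- The linearization of the teleparallel density, up to a divergence, in the direction `Q`. -/
def eulerLagrange (l : Fin 4 → ℝ) (T : Matrix (Fin 4) (Fin 4) ℝ) (P : Fin 4 → Fin 4 → Fin 4 → ℝ)
    (Q : Matrix (Fin 4) (Fin 4) ℝ) : ℝ :=
  altSum fun α β γ δ =>
    ((∑ j, l j * Q j α) * ∑ j, eta j * T j β * P γ j δ) +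
    ((∑ j, l j * T j α) * ∑ j, eta j * Q j β * P γ j δ) -
    ((∑ j, l j * P γ j α) * ∑ j, eta j * T j β * Q j δ) -
    ((∑ j, l j * T j α) * ∑ j, eta j * P γ j β * Q j δ)

set_option maxHeartbeats 4000000 in
-- The algebraic core of the field equation: the left side is `eulerLagrange` read in an orthonormal
-- frame, with `B` the infinitesimal rotation of the coframe. Rotating the coframe amounts to
-- rotating the spinor, so the variation pairs the rotated spinor with the Weyl operator.
theorem eulerLagrange_frame {K : Fin 4 → Fin 4 → Fin 4 → ℝ} (hK : IsContortion K)
    {B : Fin 4 → Fin 4 → ℝ} (hB : ∀ a b, B a b = -B b a) (ξ : Fin 2 → ℂ) :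
    (altSum fun a b c d =>
      (∑ j, eta j * current ξ j * B j a) * K b c d +
      current ξ a * (∑ j, eta j * B j b * K j c d) -
      (∑ j, eta j * current ξ j * K j c a) * B b d -
      current ξ a * (∑ j, eta j * K j c b * B j d)) =
      -8 * (∑ b, star (spinorRotation B ξ b) * frameWeyl K ξ b).re := by
  have hB0 : ∀ a, B a a = 0 := fun a => by linarith [hB a a]
  have hB' : IsContortion fun m _ d => B m d := fun b _ d => hB b d
  rw [altSum_eq]
  simp only [spinorRotation, frameWeyl, Fin.sum_univ_two, Fin.sum_univ_four,
    contortionDeriv_zero hK, contortionDeriv_one hK, contortionDeriv_zero hB',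
    contortionDeriv_one hB']
  simp [current, eta, pauli, ← Complex.normSq_eq_norm_sq, Complex.normSq_apply,
      hK.diag, hK 1 _ 0, hK 2 _ 0, hK 3 _ 0, hK 2 _ 1, hK 3 _ 1, hK 3 _ 2,
      hB0, hB 1 0, hB 2 0, hB 3 0, hB 2 1, hB 3 1, hB 3 2]
  ring

/-- The matrices `B` act on spinors through all traceless complex matrices, and these carry a
nonzero `ξ` onto every vector of `ℂ²`. -/
theorem eq_zero_of_forall_spinorRotation {ξ W : Fin 2 → ℂ} (hξ : ξ ≠ 0)
    (h : ∀ B : Fin 4 → Fin 4 → ℝ, (∀ a b, B a b = -B b a) →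
      (∑ b, star (spinorRotation B ξ b) * W b).re = 0) : W = 0 := by
  have key : ∀ p q r s t u : ℝ,
      (star ((r - Complex.I * s) * ξ 0 + (p + Complex.I * q - Complex.I * u - t) * ξ 1) * W 0 +
        star ((-r + Complex.I * s) * ξ 1 + (p - Complex.I * q - Complex.I * u + t) * ξ 0) *
          W 1).re = 0 := by
    intro p q r s t u
    let B : Fin 4 → Fin 4 → ℝ := ![![0, p, q, r], ![-p, 0, s, t], ![-q, -s, 0, u], ![-r, -t, -u, 0]]
    have hB : ∀ a b, B a b = -B b a := by
      intro a b
      fin_cases a <;> fin_cases b <;> simp [B]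
    have h1 := h B hB
    simp only [Fin.sum_univ_two, spinorRotation,
      contortionDeriv_zero (K := fun m _ d => B m d) (fun b _ d => hB b d),
      contortionDeriv_one (K := fun m _ d => B m d) (fun b _ d => hB b d)] at h1
    simp [B] at h1 ⊢
    linarith
  have hre : ∀ z : ℂ, (∀ p q : ℝ, ((p + Complex.I * q) * z).re = 0) → z = 0 := by
    intro z hz
    have h1 := hz 1 0
    have h2 := hz 0 1
    apply Complex.ext <;> simp at h1 h2 ⊢ <;> assumption
  -- The parameters are chosen so that the matrix has `p - iq` in the lower left corner and zeros
  -- elsewhere. The choices for `e2` and `e3` likewise isolate the upper right corner and the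
  -- diagonal.
  have e1 : star (ξ 0) * W 1 = 0 := hre _ fun p q => by
    have := key (p / 2) (q / 2) 0 0 (p / 2) (q / 2)
    simp at this ⊢
    linarith
  have e2 : star (ξ 1) * W 0 = 0 := hre _ fun p q => by
    have := key (p / 2) (-q / 2) 0 0 (-p / 2) (q / 2)
    simp at this ⊢
    linarith
  have e3 : star (ξ 0) * W 0 - star (ξ 1) * W 1 = 0 := hre _ fun p q => by
    have := key 0 0 p q 0 0
    simp at this ⊢
    linarith
  have hs : ∀ z : ℂ, star z = 0 → z = 0 := fun z hz => by simpa using hz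
  by_cases h0 : ξ 0 = 0
  · have h1 : ξ 1 ≠ 0 := by
      intro h1
      apply hξ
      ext i
      fin_cases i <;> simp [h0, h1]
    have w0 : W 0 = 0 := (mul_eq_zero.1 e2).resolve_left fun hh => h1 (hs _ hh)
    have w1 : W 1 = 0 := by
      rw [w0, mul_zero, zero_sub, neg_eq_zero] at e3
      exact (mul_eq_zero.1 e3).resolve_left fun hh => h1 (hs _ hh)
    ext i
    fin_cases i <;> simp [w0, w1]
  · have w1 : W 1 = 0 := (mul_eq_zero.1 e1).resolve_left fun hh => h0 (hs _ hh)
    have w0 : W 0 = 0 := by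
      rw [w1, mul_zero, sub_zero] at e3
      exact (mul_eq_zero.1 e3).resolve_left fun hh => h0 (hs _ hh)
    ext i
    fin_cases i <;> simp [w0, w1]

/-! ### Change of frame -/

theorem altSum_mul_one_three (E : Matrix (Fin 4) (Fin 4) ℝ) (f : Fin 4 → ℝ)
    (g : Fin 4 → Fin 4 → Fin 4 → ℝ) :
    (altSum fun α β γ δ => (∑ a, E a α * f a) *
      ∑ b, E b β * ∑ c, ∑ d, E c γ * E d δ * g b c d) =
      E.det * altSum fun a b c d => f a * g b c d := by
  rw [← altSum_pullback]
  congr 1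
  ext α β γ δ
  rw [Finset.sum_mul_sum]
  simp only [Finset.mul_sum]
  refine Finset.sum_congr rfl fun a _ => Finset.sum_congr rfl fun b _ =>
    Finset.sum_congr rfl fun c _ => Finset.sum_congr rfl fun d _ => ?_
  ring

theorem altSum_mul_two_two (E : Matrix (Fin 4) (Fin 4) ℝ) (f g : Fin 4 → Fin 4 → ℝ) :
    (altSum fun α β γ δ => (∑ c, ∑ a, E c γ * E a α * f c a) *
      ∑ b, E b β * ∑ d, E d δ * g b d) =
      E.det * altSum fun a b c d => f c a * g b d := by
  rw [← altSum_pullback]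
  congr 1
  ext α β γ δ
  rw [Finset.sum_comm, Finset.sum_mul_sum]
  refine Finset.sum_congr rfl fun a _ => Finset.sum_congr rfl fun b _ => ?_
  rw [Finset.mul_sum, Finset.sum_mul_sum]
  refine Finset.sum_congr rfl fun c _ => Finset.sum_congr rfl fun d _ => ?_
  ring

theorem altSum_congr {X Y : Fin 4 → Fin 4 → Fin 4 → Fin 4 → ℝ}
    (h : ∀ a b c d, X a b c d = Y a b c d) : altSum X = altSum Y := by
  congr 1
  ext a b c d
  exact h a b c d

/-- `L` is a Lorentz matrix. -/
def IsLorentz (L : Fin 4 → Fin 4 → ℝ) : Prop :=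
  ∀ a b, ∑ j, eta j * L j a * L j b = if a = b then eta a else 0

theorem IsLorentz.sum_eq {L : Fin 4 → Fin 4 → ℝ} (hL : IsLorentz L) (u v : Fin 4 → ℝ) :
    ∑ j, eta j * (∑ a, L j a * u a) * (∑ a, L j a * v a) = ∑ a, eta a * u a * v a := by
  have h1 : ∀ j, eta j * (∑ a, L j a * u a) * (∑ a, L j a * v a) =
      ∑ a, ∑ b, (eta j * L j a * L j b) * (u a * v b) := by
    intro j
    rw [mul_assoc, Finset.sum_mul_sum, Finset.mul_sum]
    refine Finset.sum_congr rfl fun a _ => ?_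
    rw [Finset.mul_sum]
    refine Finset.sum_congr rfl fun b _ => ?_
    ring
  simp only [h1]
  rw [Finset.sum_comm]
  refine Finset.sum_congr rfl fun a _ => ?_
  rw [Finset.sum_comm]
  simp only [← Finset.sum_mul, hL a]
  simp [ite_mul, mul_assoc]

theorem sum_mul_frame (l : Fin 4 → ℝ) (L : Fin 4 → Fin 4 → ℝ) (u : Fin 4 → ℝ) :
    ∑ j, l j * ∑ a, L j a * u a = ∑ a, (∑ j, l j * L j a) * u a := by
  simp only [Finset.mul_sum, Finset.sum_mul, mul_assoc]
  rw [Finset.sum_comm]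

/-- Contractions of coframe indices with `eta` do not see the Lorentz matrix `L`, which survives
only in the frame components of `l`; the four coordinate indices are then pulled back along `E`, at
the cost of `det E`. -/
theorem eulerLagrange_eq (E : Matrix (Fin 4) (Fin 4) ℝ) {L : Fin 4 → Fin 4 → ℝ} (hL : IsLorentz L)
    {l : Fin 4 → ℝ} {T Q : Matrix (Fin 4) (Fin 4) ℝ} {P K : Fin 4 → Fin 4 → Fin 4 → ℝ}
    {B : Fin 4 → Fin 4 → ℝ}
    (hT : ∀ j α, T j α = ∑ a, L j a * E a α)
    (hP : ∀ γ j δ, P γ j δ = ∑ a, L j a * ∑ c, ∑ d, E c γ * E d δ * (eta a * K a c d))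
    (hQ : ∀ j α, Q j α = ∑ a, L j a * ∑ b, E b α * (eta a * B a b)) :
    eulerLagrange l T P Q = E.det * altSum fun a b c d =>
      (∑ j, eta j * (∑ i, l i * L i j) * B j a) * K b c d +
      (∑ i, l i * L i a) * (∑ j, eta j * B j b * K j c d) -
      (∑ j, eta j * (∑ i, l i * L i j) * K j c a) * B b d -
      (∑ i, l i * L i a) * (∑ j, eta j * K j c b * B j d) := by
  have e1 : ∀ α, ∑ j, l j * Q j α = ∑ b, E b α * ∑ j, eta j * (∑ i, l i * L i j) * B j b := by
    intro α
    simp only [hQ, sum_mul_frame]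
    simp only [Finset.mul_sum]
    rw [Finset.sum_comm]
    refine Finset.sum_congr rfl fun b _ => Finset.sum_congr rfl fun a _ => ?_
    rw [← Finset.mul_sum]
    ring
  have e2 : ∀ β γ δ, ∑ j, eta j * T j β * P γ j δ =
      ∑ b, E b β * ∑ c, ∑ d, E c γ * E d δ * K b c d := by
    intro β γ δ
    simp only [hT, hP, hL.sum_eq]
    refine Finset.sum_congr rfl fun b _ => ?_
    simp only [Finset.mul_sum]
    refine Finset.sum_congr rfl fun c _ => Finset.sum_congr rfl fun d _ => ?_
    linear_combination E b β * E c γ * E d δ * K b c d * eta_mul_eta b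
  have e3 : ∀ α, ∑ j, l j * T j α = ∑ a, E a α * ∑ i, l i * L i a := by
    intro α
    simp only [hT, sum_mul_frame, mul_comm]
  have e4 : ∀ β γ δ, ∑ j, eta j * Q j β * P γ j δ =
      ∑ b, E b β * ∑ c, ∑ d, E c γ * E d δ * ∑ j, eta j * B j b * K j c d := by
    intro β γ δ
    simp only [hQ, hP, hL.sum_eq]
    have hj : ∀ j, eta j * (∑ b, E b β * (eta j * B j b)) *
        (∑ c, ∑ d, E c γ * E d δ * (eta j * K j c d)) =
        ∑ b, ∑ c, ∑ d, E b β * (E c γ * E d δ * (eta j * B j b * K j c d)) := by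
      intro j
      rw [mul_assoc, Finset.sum_mul_sum]
      simp only [Finset.mul_sum]
      refine Finset.sum_congr rfl fun b _ => Finset.sum_congr rfl fun c _ =>
        Finset.sum_congr rfl fun d _ => ?_
      linear_combination eta j * (E b β * (E c γ * E d δ * (B j b * K j c d))) * eta_mul_eta j
    rw [Finset.sum_congr rfl fun j _ => hj j]
    simp only [Finset.mul_sum]
    rw [Finset.sum_comm]
    refine Finset.sum_congr rfl fun b _ => ?_
    rw [Finset.sum_comm]
    refine Finset.sum_congr rfl fun c _ => ?_
    rw [Finset.sum_comm]
  have e5 : ∀ α γ, ∑ j, l j * P γ j α =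
      ∑ c, ∑ a, E c γ * E a α * ∑ j, eta j * (∑ i, l i * L i j) * K j c a := by
    intro α γ
    simp only [hP, sum_mul_frame]
    simp only [Finset.mul_sum]
    rw [Finset.sum_comm]
    refine Finset.sum_congr rfl fun c _ => ?_
    rw [Finset.sum_comm]
    refine Finset.sum_congr rfl fun d _ => Finset.sum_congr rfl fun a _ => ?_
    rw [← Finset.mul_sum]
    ring
  have e6 : ∀ β δ, ∑ j, eta j * T j β * Q j δ = ∑ b, E b β * ∑ d, E d δ * B b d := by
    intro β δ
    simp only [hT, hQ, hL.sum_eq]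
    refine Finset.sum_congr rfl fun b _ => ?_
    simp only [Finset.mul_sum]
    refine Finset.sum_congr rfl fun d _ => ?_
    linear_combination E b β * E d δ * B b d * eta_mul_eta b
  have e7 : ∀ β γ δ, ∑ j, eta j * P γ j β * Q j δ =
      ∑ b, E b β * ∑ c, ∑ d, E c γ * E d δ * ∑ j, eta j * K j c b * B j d := by
    intro β γ δ
    simp only [hQ, hP, hL.sum_eq]
    have hj : ∀ j, eta j * (∑ c, ∑ b, E c γ * E b β * (eta j * K j c b)) *
        (∑ d, E d δ * (eta j * B j d)) =
        ∑ b, ∑ c, ∑ d, E b β * (E c γ * E d δ * (eta j * K j c b * B j d)) := by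
      intro j
      rw [Finset.sum_comm, mul_assoc, Finset.sum_mul, Finset.mul_sum]
      refine Finset.sum_congr rfl fun b _ => ?_
      rw [Finset.sum_mul_sum]
      simp only [Finset.mul_sum]
      refine Finset.sum_congr rfl fun c _ => Finset.sum_congr rfl fun d _ => ?_
      linear_combination eta j * (E b β * (E c γ * E d δ * (B j d * K j c b))) * eta_mul_eta j
    rw [Finset.sum_congr rfl fun j _ => hj j]
    simp only [Finset.mul_sum]
    rw [Finset.sum_comm]
    refine Finset.sum_congr rfl fun b _ => ?_
    rw [Finset.sum_comm]
    refine Finset.sum_congr rfl fun c _ => ?_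
    rw [Finset.sum_comm]
  simp only [eulerLagrange, e1, e2, e3, e4, e5, e6, e7]
  rw [altSum_sub, altSum_sub, altSum_add, altSum_mul_one_three, altSum_mul_one_three,
    altSum_mul_one_three, altSum_mul_two_two, altSum_sub, altSum_sub, altSum_add]
  ring

theorem altSum_frame (E : Matrix (Fin 4) (Fin 4) ℝ) {L : Fin 4 → Fin 4 → ℝ} (hL : IsLorentz L)
    {l : Fin 4 → ℝ} {T : Matrix (Fin 4) (Fin 4) ℝ} {P K : Fin 4 → Fin 4 → Fin 4 → ℝ}
    (hT : ∀ j α, T j α = ∑ a, L j a * E a α)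
    (hP : ∀ γ j δ, P γ j δ = ∑ a, L j a * ∑ c, ∑ d, E c γ * E d δ * (eta a * K a c d)) :
    (altSum fun α β γ δ => (∑ j, l j * T j α) * ∑ j, eta j * T j β * P γ j δ) =
      E.det * altSum fun a b c d => (∑ i, l i * L i a) * K b c d := by
  have e2 : ∀ β γ δ, ∑ j, eta j * T j β * P γ j δ =
      ∑ b, E b β * ∑ c, ∑ d, E c γ * E d δ * K b c d := by
    intro β γ δ
    simp only [hT, hP, hL.sum_eq]
    refine Finset.sum_congr rfl fun b _ => ?_
    simp only [Finset.mul_sum]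
    refine Finset.sum_congr rfl fun c _ => Finset.sum_congr rfl fun d _ => ?_
    linear_combination E b β * E c γ * E d δ * K b c d * eta_mul_eta b
  have e3 : ∀ α, ∑ j, l j * T j α = ∑ a, E a α * ∑ i, l i * L i a := by
    intro α
    simp only [hT, sum_mul_frame, mul_comm]
  simp only [e2, e3, altSum_mul_one_three]

/-! ### Orthonormal frames adapted to the Pauli matrices. -/

theorem exists_pauli_coords {A : Matrix (Fin 2) (Fin 2) ℂ} (hA : A.IsHermitian) :
    ∃ u : Fin 4 → ℝ, A = ∑ j, (u j : ℂ) • pauli j := by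
  refine ⟨![((A 0 0).re + (A 1 1).re) / 2, (A 0 1).re, -(A 0 1).im,
    ((A 0 0).re - (A 1 1).re) / 2], ?_⟩
  have h00 := congrArg Complex.im (hA.apply 0 0)
  have h11 := congrArg Complex.im (hA.apply 1 1)
  have h10r := congrArg Complex.re (hA.apply 1 0)
  have h10i := congrArg Complex.im (hA.apply 1 0)
  simp at h00 h11 h10r h10i
  ext i j
  fin_cases i <;> fin_cases j <;> apply Complex.ext <;>
    simp [pauli, Fin.sum_univ_four] <;> linarith

theorem clifford_pauli_coords (u v : Fin 4 → ℝ) :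
    ((∑ j, (u j : ℂ) • pauli j) * (spinorRaise (∑ j, (v j : ℂ) • pauli j)).transpose +
      (∑ j, (v j : ℂ) • pauli j) * (spinorRaise (∑ j, (u j : ℂ) • pauli j)).transpose) 0 0 =
      ((2 * ∑ j, eta j * u j * v j : ℝ) : ℂ) := by
  simp [spinorRaise_eq, Fin.sum_univ_four, pauli, eta, Matrix.vecMul, dotProduct]
  linear_combination (2 * (u 2 : ℂ) * v 2) * Complex.I_sq

theorem pauli_eq_zero {m : Fin 2 → Fin 2 → ℂ}
    (h : ∀ j, ∑ a, ∑ b, pauli j a b * m a b = 0) : ∀ a b, m a b = 0 := by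
  have h0 := h 0
  have h1 := h 1
  have h2 := h 2
  have h3 := h 3
  simp [pauli, Fin.sum_univ_two] at h0 h1 h2 h3
  have hI : Complex.I * (m 1 0 - m 0 1) = 0 := by linear_combination h2
  have h2' := (mul_eq_zero.1 hI).resolve_left Complex.I_ne_zero
  intro a b
  fin_cases a <;> fin_cases b
  · show m 0 0 = 0
    linear_combination (h0 + h3) / 2
  · show m 0 1 = 0
    linear_combination (h1 - h2') / 2
  · show m 1 0 = 0
    linear_combination (h1 + h2') / 2
  · show m 1 1 = 0
    linear_combination (h0 - h3) / 2

/-- Contraction of dual frames. -/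
theorem sum_frame_mul {R : Type*} [CommRing R] {A B : Matrix (Fin 4) (Fin 4) R} (h : A * B = 1)
    (v u : Fin 4 → R) :
    ∑ γ, (∑ d, A d γ * v d) * (∑ j, B γ j * u j) = ∑ d, v d * u d := by
  have h1 : (Matrix.vecMul v A) ⬝ᵥ (Matrix.mulVec B u) = v ⬝ᵥ u := by
    rw [← Matrix.dotProduct_mulVec, Matrix.mulVec_mulVec, h, Matrix.one_mulVec]
  simpa only [Matrix.vecMul, Matrix.mulVec, dotProduct, mul_comm] using h1

theorem sum_frame_mul_single {R : Type*} [CommRing R] {A B : Matrix (Fin 4) (Fin 4) R}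
    (h : A * B = 1) (v : Fin 4 → R) (i : Fin 4) :
    ∑ γ, (∑ d, A d γ * v d) * B γ i = v i := by
  have := sum_frame_mul h v (Pi.single i 1)
  simpa [Pi.single_apply] using this

/-- `E` is an orthonormal frame of `G` in which the Pauli matrices `S` are the standard ones. -/
structure IsPauliFrame (G : Matrix (Fin 4) (Fin 4) ℝ) (S : Fin 4 → Matrix (Fin 2) (Fin 2) ℂ)
    (E : Matrix (Fin 4) (Fin 4) ℝ) : Prop where
  metric : ∀ α β, G α β = ∑ j, eta j * E j α * E j β
  pauli : ∀ α a b, S α a b = ∑ j, (E j α : ℂ) * pauli j a b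
  unit : IsUnit E.det

theorem metric_eq_matrix {G E : Matrix (Fin 4) (Fin 4) ℝ}
    (h : ∀ α β, G α β = ∑ j, eta j * E j α * E j β) : G = E.transpose * mink * E := by
  ext α β
  rw [h, mink, Matrix.mul_apply]
  refine Finset.sum_congr rfl fun j _ => ?_
  rw [Matrix.mul_diagonal, Matrix.transpose_apply, eta]
  ring

theorem mink_mul_mink : mink * mink = 1 := by
  rw [mink, Matrix.diagonal_mul_diagonal, ← Matrix.diagonal_one]
  congr 1
  ext j
  fin_cases j <;> simp

theorem det_metric {G E : Matrix (Fin 4) (Fin 4) ℝ}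
    (h : ∀ α β, G α β = ∑ j, eta j * E j α * E j β) : G.det = -E.det ^ 2 := by
  rw [metric_eq_matrix h, Matrix.det_mul, Matrix.det_mul, Matrix.det_transpose, mink,
    Matrix.det_diagonal]
  simp [Fin.prod_univ_four]
  ring

theorem inv_metric_mul {G E : Matrix (Fin 4) (Fin 4) ℝ} (hE : IsUnit E.det)
    (h : ∀ α β, G α β = ∑ j, eta j * E j α * E j β) (α j : Fin 4) :
    ∑ β, G⁻¹ α β * E j β = E⁻¹ α j * eta j := by
  have hG : IsUnit G.det := by
    rw [det_metric h]
    exact (hE.pow 2).neg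
  have h1 : G⁻¹ * E.transpose = E⁻¹ * mink := by
    have h2 : E.transpose = G * (E⁻¹ * mink) := by
      rw [metric_eq_matrix h, Matrix.mul_assoc, ← Matrix.mul_assoc E, Matrix.mul_nonsing_inv _ hE,
        Matrix.one_mul, Matrix.mul_assoc, mink_mul_mink, Matrix.mul_one]
    rw [h2, ← Matrix.mul_assoc, Matrix.nonsing_inv_mul _ hG, Matrix.one_mul]
  have h3 := congrFun (congrFun h1 α) j
  rw [mink, Matrix.mul_diagonal, Matrix.mul_apply] at h3
  exact h3

theorem IsPauliFrame.up {G E : Matrix (Fin 4) (Fin 4) ℝ} {S : Fin 4 → Matrix (Fin 2) (Fin 2) ℂ}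
    (h : IsPauliFrame G S E) (β : Fin 4) (a b : Fin 2) :
    ∑ γ, ((G⁻¹ β γ : ℝ) : ℂ) * S γ a b =
      ∑ j, ((E⁻¹ β j : ℝ) : ℂ) * ((eta j : ℂ) * Teleparallel.pauli j a b) := by
  simp only [h.pauli, Finset.mul_sum]
  rw [Finset.sum_comm]
  refine Finset.sum_congr rfl fun j _ => ?_
  rw [← mul_assoc, ← Complex.ofReal_mul, ← inv_metric_mul h.unit h.metric, Complex.ofReal_sum,
    Finset.sum_mul]
  refine Finset.sum_congr rfl fun γ _ => ?_
  push_cast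
  ring

theorem mul_inv_ofReal {E : Matrix (Fin 4) (Fin 4) ℝ} (h : IsUnit E.det) :
    E.map Complex.ofReal * E⁻¹.map Complex.ofReal = 1 := by
  have h2 := (Complex.ofRealHom.mapMatrix (m := Fin 4)).map_mul E E⁻¹
  rw [Matrix.mul_nonsing_inv _ h, map_one] at h2
  exact h2.symm

/-- The frame consists of the real coefficients of `S α` in the standard Pauli matrices. One
diagonal entry of the Clifford relation already says that these coefficients are orthonormal for
`G`. -/
theorem exists_isPauliFrame {G : Matrix (Fin 4) (Fin 4) ℝ} (hG : IsUnit G.det)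
    {S : Fin 4 → Matrix (Fin 2) (Fin 2) ℂ} (hS : ∀ α, (S α).IsHermitian)
    (hc : ∀ α β, S α * (spinorRaise (S β)).transpose + S β * (spinorRaise (S α)).transpose =
      ((2 * G α β : ℝ) : ℂ) • (1 : Matrix (Fin 2) (Fin 2) ℂ)) : ∃ E, IsPauliFrame G S E := by
  choose u hu using fun α => exists_pauli_coords (hS α)
  have hm : ∀ α β, G α β = ∑ j, eta j * u α j * u β j := by
    intro α β
    have h1 := congrFun (congrFun (hc α β) 0) 0
    rw [hu α, hu β, clifford_pauli_coords] at h1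
    simp only [Matrix.smul_apply, Matrix.one_apply_eq, smul_eq_mul, mul_one,
      Complex.ofReal_inj] at h1
    linarith
  refine ⟨Matrix.of fun j α => u α j, hm, fun α a b => ?_, ?_⟩
  · rw [hu α, Matrix.sum_apply]
    rfl
  · have h2 := det_metric (E := Matrix.of fun j α => u α j) hm
    rw [h2] at hG
    exact (isUnit_pow_iff two_ne_zero).1 ((IsUnit.neg_iff _).1 hG)

theorem spinorRaise_sum (u : Fin 4 → ℂ) (A : Fin 4 → Matrix (Fin 2) (Fin 2) ℂ) (a c : Fin 2) :
    spinorRaise (Matrix.of fun a b => ∑ j, u j * A j a b) a c =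
      ∑ j, u j * spinorRaise (A j) a c := by
  simp only [spinorRaise_eq]
  fin_cases a <;> fin_cases c <;> simp

theorem sum_inv_frame_mul {E : Matrix (Fin 4) (Fin 4) ℝ} (hE : IsUnit E.det)
    (f : Fin 4 → Fin 4 → ℝ) (γ δ : Fin 4) :
    ∑ c, ∑ d, E c γ * E d δ * (∑ γ', ∑ δ', E⁻¹ γ' c * E⁻¹ δ' d * f γ' δ') = f γ δ := by
  have h1 : E.transpose * (E⁻¹.transpose * Matrix.of f * E⁻¹) * E = Matrix.of f := by
    rw [Matrix.mul_assoc, Matrix.mul_assoc, Matrix.mul_assoc, Matrix.nonsing_inv_mul _ hE,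
      Matrix.mul_one, ← Matrix.mul_assoc, ← Matrix.transpose_mul, Matrix.nonsing_inv_mul _ hE,
      Matrix.transpose_one, Matrix.one_mul]
  have h2 := congrFun (congrFun h1 γ) δ
  simp only [Matrix.mul_apply, Matrix.transpose_apply, Matrix.of_apply, Finset.sum_mul,
    Finset.mul_sum] at h2
  rw [← h2, Finset.sum_comm]
  simp only [Finset.mul_sum]
  refine Finset.sum_congr rfl fun d _ => Finset.sum_congr rfl fun c _ => ?_
  rw [Finset.sum_comm]
  refine Finset.sum_congr rfl fun δ' _ => Finset.sum_congr rfl fun γ' _ => ?_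
  ring

/-- A connection difference compatible with the metric, in an orthonormal frame. -/
theorem exists_contortion {G E : Matrix (Fin 4) (Fin 4) ℝ} (hE : IsUnit E.det)
    (h : ∀ α β, G α β = ∑ j, eta j * E j α * E j β) {Q : Fin 4 → Fin 4 → Fin 4 → ℝ}
    (hQ : ∀ β γ δ, ∑ μ, G β μ * Q μ γ δ = -∑ μ, G δ μ * Q μ γ β) :
    ∃ K, IsContortion K ∧ ∀ a γ δ, ∑ μ, E a μ * Q μ γ δ =
      ∑ c, ∑ d, E c γ * E d δ * (eta a * K a c d) := by
  have hlow : ∀ β γ δ, ∑ μ, G β μ * Q μ γ δ = ∑ j, E j β * (eta j * ∑ μ, E j μ * Q μ γ δ) := by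
    intro β γ δ
    simp only [h, Finset.sum_mul, Finset.mul_sum]
    rw [Finset.sum_comm]
    refine Finset.sum_congr rfl fun j _ => Finset.sum_congr rfl fun μ _ => ?_
    ring
  -- The contortion is `Q` with its first index lowered by the metric, evaluated on the frame dual
  -- to `E`; the factor `eta a` in the conclusion raises that index again.
  refine ⟨fun b c d => ∑ β, ∑ γ, ∑ δ, E⁻¹ β b * E⁻¹ γ c * E⁻¹ δ d * ∑ μ, G β μ * Q μ γ δ,
    fun b c d => ?_, fun a γ δ => ?_⟩
  · show (∑ β, ∑ γ, ∑ δ, E⁻¹ β b * E⁻¹ γ c * E⁻¹ δ d * ∑ μ, G β μ * Q μ γ δ) =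
      -∑ β, ∑ γ, ∑ δ, E⁻¹ β d * E⁻¹ γ c * E⁻¹ δ b * ∑ μ, G β μ * Q μ γ δ
    rw [Finset.sum_comm]
    rw [Finset.sum_comm (s := Finset.univ) (t := Finset.univ)
      (f := fun β γ => ∑ δ, E⁻¹ β d * E⁻¹ γ c * E⁻¹ δ b * ∑ μ, G β μ * Q μ γ δ)]
    rw [← Finset.sum_neg_distrib]
    refine Finset.sum_congr rfl fun γ _ => ?_
    rw [Finset.sum_comm, ← Finset.sum_neg_distrib]
    refine Finset.sum_congr rfl fun β _ => ?_
    rw [← Finset.sum_neg_distrib]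
    refine Finset.sum_congr rfl fun δ _ => ?_
    rw [hQ δ γ β]
    ring
  · rw [← sum_inv_frame_mul hE (fun γ δ => ∑ μ, E a μ * Q μ γ δ) γ δ]
    refine Finset.sum_congr rfl fun c _ => Finset.sum_congr rfl fun d _ => ?_
    congr 1
    rw [Finset.mul_sum]
    simp only [hlow]
    have h1 : ∀ γ δ, ∑ β, E⁻¹ β a * ∑ j, E j β * (eta j * ∑ μ, E j μ * Q μ γ δ) =
        eta a * ∑ μ, E a μ * Q μ γ δ := by
      intro γ δ
      have := sum_frame_mul_single (Matrix.mul_nonsing_inv _ hE)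
        (fun j => eta j * ∑ μ, E j μ * Q μ γ δ) a
      rw [← this]
      exact Finset.sum_congr rfl fun β _ => mul_comm _ _
    simp only [Finset.mul_sum (s := Finset.univ) (a := eta a)]
    symm
    rw [Finset.sum_comm]
    refine Finset.sum_congr rfl fun γ' _ => ?_
    rw [Finset.sum_comm]
    refine Finset.sum_congr rfl fun δ' _ => ?_
    have h2 : ∀ β, eta a * (E⁻¹ β a * E⁻¹ γ' c * E⁻¹ δ' d *
        ∑ j, E j β * (eta j * ∑ μ, E j μ * Q μ γ' δ')) =
        (eta a * E⁻¹ γ' c * E⁻¹ δ' d) *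
          (E⁻¹ β a * ∑ j, E j β * (eta j * ∑ μ, E j μ * Q μ γ' δ')) := fun β => by ring
    rw [Finset.sum_congr rfl fun β _ => h2 β, ← Finset.mul_sum, h1]
    linear_combination (E⁻¹ γ' c * E⁻¹ δ' d * ∑ μ, E a μ * Q μ γ' δ') * eta_mul_eta a

theorem sum_mul_sum_assoc {ι κ R : Type*} [Fintype ι] [Fintype κ] [CommSemiring R] (A : ι → R)
    (q : ι → κ → R) (u : κ → R) :
    ∑ β, A β * ∑ γ, q β γ * u γ = ∑ γ, (∑ β, A β * q β γ) * u γ := by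
  simp only [Finset.mul_sum, Finset.sum_mul, mul_assoc]
  rw [Finset.sum_comm]

/-- The passage of the algebraic difference of two spinor derivatives from coordinates to the frame:
the Pauli matrices become the standard ones and dual frames cancel, so that only the direction of
differentiation keeps a factor of `E`. -/
theorem contortionDeriv_eq {G E : Matrix (Fin 4) (Fin 4) ℝ} {S : Fin 4 → Matrix (Fin 2) (Fin 2) ℂ}
    (h : IsPauliFrame G S E) {Q K : Fin 4 → Fin 4 → Fin 4 → ℝ}
    (hK : ∀ a γ δ, ∑ μ, E a μ * Q μ γ δ = ∑ c, ∑ d, E c γ * E d δ * (eta a * K a c d))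
    (ξ : Fin 2 → ℂ) (α : Fin 4) (a : Fin 2) :
    -(1 / 4) * ∑ b, (∑ β, ∑ c, spinorRaise (S β) a c *
        ∑ γ, (Q β α γ : ℂ) * ∑ μ, ((G⁻¹ γ μ : ℝ) : ℂ) * S μ b c) * ξ b =
      ∑ c, (E c α : ℂ) * contortionDeriv K ξ c a := by
  have hr : ∀ β e, spinorRaise (S β) a e = ∑ m, (E m β : ℂ) * spinorRaise (pauli m) a e := by
    intro β e
    rw [← spinorRaise_sum]
    congr 1
    ext a b
    exact h.pauli β a b
  have hm : ∀ b e m, ∑ β, (E m β : ℂ) *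
      ∑ γ, (Q β α γ : ℂ) * ∑ μ, ((G⁻¹ γ μ : ℝ) : ℂ) * S μ b e =
      ∑ c, (E c α : ℂ) * ∑ d, ((eta m * eta d * K m c d : ℝ) : ℂ) * pauli d b e := by
    intro b e m
    have h1 : ∀ γ, ∑ β, (E m β : ℂ) * (Q β α γ : ℂ) =
        ∑ d, (E d γ : ℂ) * ∑ c, (E c α : ℂ) * ((eta m * K m c d : ℝ) : ℂ) := by
      intro γ
      have := congrArg Complex.ofReal (hK m α γ)
      rw [Finset.sum_comm] at this
      push_cast at this
      rw [this]
      refine Finset.sum_congr rfl fun d _ => ?_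
      rw [Finset.mul_sum]
      refine Finset.sum_congr rfl fun c _ => ?_
      push_cast
      ring
    simp only [h.up, sum_mul_sum_assoc (fun β => (E m β : ℂ)) (fun β γ => (Q β α γ : ℂ)), h1]
    have h2 := sum_frame_mul (mul_inv_ofReal h.unit)
      (fun d => ∑ c, (E c α : ℂ) * ((eta m * K m c d : ℝ) : ℂ))
      (fun j => (eta j : ℂ) * pauli j b e)
    simp only [Matrix.map_apply] at h2
    rw [h2]
    simp only [Finset.mul_sum, Finset.sum_mul]
    rw [Finset.sum_comm]
    refine Finset.sum_congr rfl fun c _ => Finset.sum_congr rfl fun d _ => ?_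
    push_cast
    ring
  have hb : ∀ b, ∑ β, ∑ e, spinorRaise (S β) a e *
        ∑ γ, (Q β α γ : ℂ) * ∑ μ, ((G⁻¹ γ μ : ℝ) : ℂ) * S μ b e =
      ∑ c, (E c α : ℂ) * ∑ m, ∑ d, ((eta m * eta d * K m c d : ℝ) : ℂ) *
        ∑ e, spinorRaise (pauli m) a e * pauli d b e := by
    intro b
    have e1 : ∀ e, ∑ β, spinorRaise (S β) a e *
        ∑ γ, (Q β α γ : ℂ) * ∑ μ, ((G⁻¹ γ μ : ℝ) : ℂ) * S μ b e =
        ∑ m, spinorRaise (pauli m) a e *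
          ∑ c, (E c α : ℂ) * ∑ d, ((eta m * eta d * K m c d : ℝ) : ℂ) * pauli d b e := by
      intro e
      simp only [← hm, hr, Finset.sum_mul]
      rw [Finset.sum_comm]
      refine Finset.sum_congr rfl fun m _ => ?_
      rw [Finset.mul_sum]
      refine Finset.sum_congr rfl fun β _ => ?_
      ring
    rw [Finset.sum_comm, Finset.sum_congr rfl fun e _ => e1 e]
    simp only [Finset.mul_sum]
    rw [Finset.sum_comm]
    rw [Finset.sum_comm (f := fun c m => ∑ d, ∑ e, (E c α : ℂ) *
      (((eta m * eta d * K m c d : ℝ) : ℂ) * (spinorRaise (pauli m) a e * pauli d b e)))]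
    refine Finset.sum_congr rfl fun m _ => ?_
    rw [Finset.sum_comm]
    refine Finset.sum_congr rfl fun c _ => ?_
    rw [Finset.sum_comm]
    refine Finset.sum_congr rfl fun d _ => Finset.sum_congr rfl fun e _ => ?_
    ring
  simp only [hb, contortionDeriv]
  simp only [Finset.sum_mul (s := Finset.univ) (f := fun c => (E c α : ℂ) * _)]
  rw [Finset.sum_comm, Finset.mul_sum]
  refine Finset.sum_congr rfl fun c _ => ?_
  simp only [mul_assoc, ← Finset.mul_sum]
  ring

theorem pauli_contract {G E : Matrix (Fin 4) (Fin 4) ℝ} {S : Fin 4 → Matrix (Fin 2) (Fin 2) ℂ}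
    (h : IsPauliFrame G S E) (v : Fin 4 → ℂ) (a b : Fin 2) :
    ∑ α, (∑ γ, ((G⁻¹ α γ : ℝ) : ℂ) * S γ a b) * (∑ c, (E c α : ℂ) * v c) =
      ∑ c, ((eta c : ℂ) * pauli c a b) * v c := by
  simp only [h.up]
  have := sum_frame_mul (mul_inv_ofReal h.unit) v fun j => (eta j : ℂ) * pauli j a b
  simpa only [Matrix.map_apply, mul_comm] using this

/-- The standard Pauli matrices have the prescribed polarization exactly in positively oriented
coordinates. The real part of one entry of the polarization identity suffices; evaluated on two
vectors of the dual frame it reads `√|det G| / det E = 1`. -/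
theorem IsPauliFrame.det_pos {G E : Matrix (Fin 4) (Fin 4) ℝ}
    {S : E4 → Fin 4 → Matrix (Fin 2) (Fin 2) ℂ} {y : E4} (h : IsPauliFrame G (S y) E)
    (hp : ∀ α β a c, (1 / 2) * (Real.sqrt |G.det| : ℂ) *
      (∑ γ, ∑ δ, ∑ μ, ∑ ν, (G⁻¹ γ μ : ℂ) * (G⁻¹ δ ν : ℂ) *
        sigmaTwo S y μ ν a c * (leviCivita γ δ α β : ℂ)) = Complex.I * sigmaTwo S y α β a c) :
    0 < E.det := by
  have h2 : ∀ μ ν, sigmaTwo S y μ ν 0 0 = S y μ 0 0 * S y ν 0 1 - S y μ 0 1 * S y ν 0 0 := by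
    intro μ ν
    simp [sigmaTwo, spinorEps, Matrix.mul_apply, Fin.sum_univ_two]
    ring
  have h3 : ∀ γ δ α β, ∑ μ, ∑ ν, (G⁻¹ γ μ : ℂ) * (G⁻¹ δ ν : ℂ) *
      sigmaTwo S y μ ν 0 0 * (leviCivita γ δ α β : ℂ) =
      ((∑ μ, (G⁻¹ γ μ : ℂ) * S y μ 0 0) * (∑ ν, (G⁻¹ δ ν : ℂ) * S y ν 0 1) -
        (∑ μ, (G⁻¹ γ μ : ℂ) * S y μ 0 1) * (∑ ν, (G⁻¹ δ ν : ℂ) * S y ν 0 0)) *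
        (leviCivita γ δ α β : ℂ) := by
    intro γ δ α β
    rw [Finset.sum_mul_sum, Finset.sum_mul_sum, ← Finset.sum_sub_distrib, Finset.sum_mul]
    refine Finset.sum_congr rfl fun μ _ => ?_
    rw [← Finset.sum_sub_distrib, Finset.sum_mul]
    refine Finset.sum_congr rfl fun ν _ => ?_
    rw [h2]
    ring
  have h00 : ∀ γ, ∑ μ, (G⁻¹ γ μ : ℂ) * S y μ 0 0 = ((E⁻¹ γ 0 - E⁻¹ γ 3 : ℝ) : ℂ) := by
    intro γ
    rw [h.up]
    simp [Fin.sum_univ_four, eta, Teleparallel.pauli]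
    ring
  have h01 : ∀ γ, ∑ μ, (G⁻¹ γ μ : ℂ) * S y μ 0 1 =
      ((-E⁻¹ γ 1 : ℝ) : ℂ) + Complex.I * (E⁻¹ γ 2 : ℝ) := by
    intro γ
    rw [h.up]
    simp [Fin.sum_univ_four, eta, Teleparallel.pauli]
    ring
  have s00 : ∀ α, S y α 0 0 = ((E 0 α + E 3 α : ℝ) : ℂ) := by
    intro α
    rw [h.pauli]
    simp [Fin.sum_univ_four, Teleparallel.pauli]
  have s01 : ∀ α, S y α 0 1 = ((E 1 α : ℝ) : ℂ) - Complex.I * (E 2 α : ℝ) := by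
    intro α
    rw [h.pauli]
    simp [Fin.sum_univ_four, Teleparallel.pauli]
    ring
  have key : ∀ α β, (1 / 2) * Real.sqrt |G.det| * (∑ γ, ∑ δ,
      ((E⁻¹ γ 0 - E⁻¹ γ 3) * -E⁻¹ δ 1 - -E⁻¹ γ 1 * (E⁻¹ δ 0 - E⁻¹ δ 3)) * leviCivita γ δ α β) =
      (E 0 α + E 3 α) * E 2 β - E 2 α * (E 0 β + E 3 β) := by
    intro α β
    have hk := hp α β 0 0
    simp only [h3, h00, h01] at hk
    simp only [h2, s00, s01] at hk
    have hk2 := congrArg Complex.re hk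
    rw [show (1 / 2 : ℂ) * (Real.sqrt |G.det| : ℂ) = ((1 / 2 * Real.sqrt |G.det| : ℝ) : ℂ) by
      push_cast; rfl, Complex.re_ofReal_mul, Complex.re_sum] at hk2
    simp only [Complex.re_sum] at hk2
    simp at hk2
    simp
    linarith
  have hE := h.unit
  have hc := fun v i => sum_frame_mul_single (Matrix.mul_nonsing_inv _ hE) v i
  have hd : ∀ j i, ∑ α, E j α * E⁻¹ α i = if j = i then 1 else 0 := by
    intro j i
    rw [← Matrix.mul_apply, Matrix.mul_nonsing_inv _ hE, Matrix.one_apply]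
  -- Evaluation on the dual frame vectors number `2` and `3`. Only `E 2 ∧ E 3` contributes on the
  -- right, and on the left only the symbol with the indices `0, 1, 2, 3`.
  have hR : ∑ α, ∑ β, ((E 0 α + E 3 α) * E 2 β - E 2 α * (E 0 β + E 3 β)) *
      (E⁻¹ α 2 * E⁻¹ β 3) = -1 := by
    have : ∀ α β, ((E 0 α + E 3 α) * E 2 β - E 2 α * (E 0 β + E 3 β)) * (E⁻¹ α 2 * E⁻¹ β 3) =
        (E 0 α * E⁻¹ α 2 + E 3 α * E⁻¹ α 2) * (E 2 β * E⁻¹ β 3) -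
        (E 2 α * E⁻¹ α 2) * (E 0 β * E⁻¹ β 3 + E 3 β * E⁻¹ β 3) := fun α β => by ring
    simp only [this, Finset.sum_sub_distrib, ← Finset.sum_mul_sum, Finset.sum_add_distrib, hd]
    simp
  have hdet : E⁻¹.det = E.det⁻¹ := by
    rw [Matrix.det_nonsing_inv, Ring.inverse_eq_inv']
  have hrow := fun a b c d => altSum_rows E⁻¹.transpose a b c d
  rw [Matrix.det_transpose, hdet] at hrow
  have hL : ∑ α, ∑ β, (∑ γ, ∑ δ,
      ((E⁻¹ γ 0 - E⁻¹ γ 3) * -E⁻¹ δ 1 - -E⁻¹ γ 1 * (E⁻¹ δ 0 - E⁻¹ δ 3)) * leviCivita γ δ α β) *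
      (E⁻¹ α 2 * E⁻¹ β 3) = -2 * E.det⁻¹ := by
    have e : (-(altSum fun γ δ α β => E⁻¹ γ 0 * E⁻¹ δ 1 * E⁻¹ α 2 * E⁻¹ β 3) +
        (altSum fun γ δ α β => E⁻¹ γ 3 * E⁻¹ δ 1 * E⁻¹ α 2 * E⁻¹ β 3) +
        (altSum fun γ δ α β => E⁻¹ γ 1 * E⁻¹ δ 0 * E⁻¹ α 2 * E⁻¹ β 3) -
        (altSum fun γ δ α β => E⁻¹ γ 1 * E⁻¹ δ 3 * E⁻¹ α 2 * E⁻¹ β 3)) = -2 * E.det⁻¹ := by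
      rw [show (altSum fun γ δ α β => E⁻¹ γ 0 * E⁻¹ δ 1 * E⁻¹ α 2 * E⁻¹ β 3) = _ from hrow 0 1 2 3,
        show (altSum fun γ δ α β => E⁻¹ γ 3 * E⁻¹ δ 1 * E⁻¹ α 2 * E⁻¹ β 3) = _ from hrow 3 1 2 3,
        show (altSum fun γ δ α β => E⁻¹ γ 1 * E⁻¹ δ 0 * E⁻¹ α 2 * E⁻¹ β 3) = _ from hrow 1 0 2 3,
        show (altSum fun γ δ α β => E⁻¹ γ 1 * E⁻¹ δ 3 * E⁻¹ α 2 * E⁻¹ β 3) = _ from hrow 1 3 2 3]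
      simp [leviCivita_eq]
      norm_num
      ring
    rw [← e]
    simp only [altSum_eq, leviCivita_eq, Fin.sum_univ_four, Fin.val_zero, Fin.val_one, Fin.val_two,
      show ((3 : Fin 4) : ℕ) = 3 from rfl]
    norm_num
    ring
  have hfin : 1 / 2 * Real.sqrt |G.det| * (-2 * E.det⁻¹) = -1 := by
    rw [← hL, ← hR, Finset.mul_sum]
    refine Finset.sum_congr rfl fun α _ => ?_
    rw [Finset.mul_sum]
    refine Finset.sum_congr rfl fun β _ => ?_
    rw [← key α β]
    ring
  have hpos : 0 ≤ Real.sqrt |G.det| := Real.sqrt_nonneg _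
  by_contra hneg
  have : E.det⁻¹ ≤ 0 := inv_nonpos.2 (not_lt.1 hneg)
  nlinarith

section

/-! ### The fields in one coordinate patch -/

/-- The components of a metric, a coframe and Pauli matrices in a coordinate patch. -/
structure IsPatch (U : Set E4) (G T : E4 → Matrix (Fin 4) (Fin 4) ℝ)
    (S : E4 → Fin 4 → Matrix (Fin 2) (Fin 2) ℂ) : Prop where
  isOpen : IsOpen U
  metric : ∀ y ∈ U, ∀ α β, G y α β = ∑ j, eta j * T y j α * T y j β
  unit : ∀ y ∈ U, IsUnit (T y).det
  smooth : ∀ j α, ContDiffOn ℝ ∞ (fun y => T y j α) U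
  smoothPauli : ∀ α a b, ContDiffOn ℝ ∞ (fun y => S y α a b) U
  hermitian : ∀ y ∈ U, ∀ α, (S y α).IsHermitian
  clifford : ∀ y ∈ U, ∀ α β, S y α * (spinorRaise (S y β)).transpose +
    S y β * (spinorRaise (S y α)).transpose =
      ((2 * G y α β : ℝ) : ℂ) • (1 : Matrix (Fin 2) (Fin 2) ℂ)
  polarized : ∀ y ∈ U, ∀ α β a c, (1 / 2) * (Real.sqrt |(G y).det| : ℂ) *
      (∑ γ, ∑ δ, ∑ μ, ∑ ν, ((G y)⁻¹ γ μ : ℂ) * ((G y)⁻¹ δ ν : ℂ) *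
        sigmaTwo S y μ ν a c * (leviCivita γ δ α β : ℂ)) = Complex.I * sigmaTwo S y α β a c

section pd
variable {F : Type*} [NormedAddCommGroup F] [NormedSpace ℝ F]

theorem pd_congr {f g : E4 → F} {U : Set E4} (hU : IsOpen U) (h : ∀ z ∈ U, f z = g z) {y : E4}
    (hy : y ∈ U) (α : Fin 4) : pd α f y = pd α g y := by
  have : f =ᶠ[nhds y] g := Filter.eventuallyEq_of_mem (hU.mem_nhds hy) h
  rw [pd, pd, this.fderiv_eq]

theorem pd_mul {R : Type*} [NormedCommRing R] [NormedAlgebra ℝ R] {f g : E4 → R} {y : E4}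
    (hf : DifferentiableAt ℝ f y) (hg : DifferentiableAt ℝ g y) (α : Fin 4) :
    pd α (fun z => f z * g z) y = pd α f y * g y + f y * pd α g y := by
  rw [pd, fderiv_fun_mul hf hg]
  simp [pd]
  ring

theorem pd_sum {ι : Type*} (s : Finset ι) {f : ι → E4 → F} {y : E4}
    (hf : ∀ i ∈ s, DifferentiableAt ℝ (f i) y) (α : Fin 4) :
    pd α (fun z => ∑ i ∈ s, f i z) y = ∑ i ∈ s, pd α (f i) y := by
  rw [pd, fderiv_fun_sum hf]
  simp [pd]

theorem pd_const_mul {f : E4 → ℝ} {y : E4} (c : ℝ)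
    (hf : DifferentiableAt ℝ f y) (α : Fin 4) :
    pd α (fun z => c * f z) y = c * pd α f y := by
  rw [pd, fderiv_const_mul hf]
  simp [pd]

end pd

theorem ContDiffOn.differentiableAt_of_mem {F : Type*} [NormedAddCommGroup F] [NormedSpace ℝ F]
    {f : E4 → F} {U : Set E4} (h : ContDiffOn ℝ ∞ f U) (hU : IsOpen U) {y : E4} (hy : y ∈ U) :
    DifferentiableAt ℝ f y :=
  (h.differentiableOn (by simp)).differentiableAt (hU.mem_nhds hy)

variable {U : Set E4} {G T : E4 → Matrix (Fin 4) (Fin 4) ℝ}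
  {S : E4 → Fin 4 → Matrix (Fin 2) (Fin 2) ℂ} {y : E4}

theorem IsPatch.diff (h : IsPatch U G T S) (hy : y ∈ U) (j α : Fin 4) :
    DifferentiableAt ℝ (fun z => T z j α) y :=
  ContDiffOn.differentiableAt_of_mem (h.smooth j α) h.isOpen hy

theorem IsPatch.pd_metric (h : IsPatch U G T S) (hy : y ∈ U) (γ α β : Fin 4) :
    pd γ (fun z => G z α β) y = ∑ j, eta j *
      (pd γ (fun z => T z j α) y * T y j β + T y j α * pd γ (fun z => T z j β) y) := by
  rw [pd_congr h.isOpen (fun z hz => h.metric z hz α β) hy, pd_sum]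
  · refine Finset.sum_congr rfl fun j _ => ?_
    simp only [mul_assoc]
    rw [pd_const_mul (f := fun z => T z j α * T z j β) _ ((h.diff hy j α).mul (h.diff hy j β)),
      pd_mul (h.diff hy j α) (h.diff hy j β)]
  · intro j _
    exact ((h.diff hy j α).const_mul _).mul (h.diff hy j β)

theorem IsPatch.metric_symm (h : IsPatch U G T S) (hy : y ∈ U) (α β : Fin 4) :
    G y α β = G y β α := by
  rw [h.metric y hy, h.metric y hy]
  exact Finset.sum_congr rfl fun j _ => by ring

theorem IsPatch.isUnit_det (h : IsPatch U G T S) (hy : y ∈ U) : IsUnit (G y).det := by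
  rw [det_metric (h.metric y hy)]
  exact ((h.unit y hy).pow 2).neg

theorem IsPatch.christoffel_symm (h : IsPatch U G T S) (hy : y ∈ U) (β α γ : Fin 4) :
    christoffel G y β α γ = christoffel G y β γ α := by
  rw [christoffel, christoffel]
  congr 1
  refine Finset.sum_congr rfl fun δ _ => ?_
  rw [pd_congr h.isOpen (fun z hz => h.metric_symm hz α γ) hy]
  ring

theorem IsPatch.metric_mul_christoffel (h : IsPatch U G T S) (hy : y ∈ U) (β α γ : Fin 4) :
    ∑ μ, G y β μ * christoffel G y μ α γ = (1 / 2) *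
      (pd α (fun z => G z γ β) y + pd γ (fun z => G z α β) y - pd β (fun z => G z α γ) y) := by
  have h1 : ∀ μ, G y β μ * christoffel G y μ α γ = (1 / 2) * (G y β μ * ∑ δ, (G y)⁻¹ μ δ *
    (pd α (fun z => G z γ δ) y + pd γ (fun z => G z α δ) y - pd δ (fun z => G z α γ) y)) :=
    fun μ => by rw [christoffel]; ring
  simp only [h1, ← Finset.mul_sum]
  congr 1
  rw [sum_mul_sum_assoc (fun μ => G y β μ) (fun μ δ => (G y)⁻¹ μ δ)]
  simp only [← Matrix.mul_apply, Matrix.mul_nonsing_inv _ (h.isUnit_det hy), Matrix.one_apply]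
  simp

theorem IsPatch.sum_mul_weitzenbock (h : IsPatch U G T S) (hy : y ∈ U) (j α β : Fin 4) :
    ∑ μ, T y j μ * weitzenbock T y μ α β = pd α (fun z => T z j β) y := by
  have := (weitzenbock_spec T y (h.unit y hy) _).2 rfl j α β
  rw [sub_eq_zero] at this
  rw [this]
  exact Finset.sum_congr rfl fun μ _ => mul_comm _ _

/-- Both connections annihilate the metric, so the derivatives of the metric cancel in the symmetric
part of the difference. -/
theorem IsPatch.contortion_antisymm (h : IsPatch U G T S) (hy : y ∈ U) (β γ δ : Fin 4) :
    ∑ μ, G y β μ * (weitzenbock T y μ γ δ - christoffel G y μ γ δ) =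
      -∑ μ, G y δ μ * (weitzenbock T y μ γ β - christoffel G y μ γ β) := by
  have hw : ∀ β γ δ, ∑ μ, G y β μ * weitzenbock T y μ γ δ =
      ∑ j, eta j * (T y j β * pd γ (fun z => T z j δ) y) := by
    intro β γ δ
    simp only [← h.sum_mul_weitzenbock hy, h.metric y hy, Finset.sum_mul, Finset.mul_sum]
    rw [Finset.sum_comm]
    exact Finset.sum_congr rfl fun j _ => Finset.sum_congr rfl fun μ _ => by ring
  simp only [mul_sub, Finset.sum_sub_distrib, hw, h.metric_mul_christoffel hy]
  have e1 : pd γ (fun z => G z δ β) y = ∑ j, eta j * (T y j β * pd γ (fun z => T z j δ) y) +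
      ∑ j, eta j * (T y j δ * pd γ (fun z => T z j β) y) := by
    rw [h.pd_metric hy, ← Finset.sum_add_distrib]
    exact Finset.sum_congr rfl fun j _ => by ring
  have e2 := pd_congr h.isOpen (fun z hz => h.metric_symm hz β δ) hy γ
  linarith

/-- An alternating sum annihilates what is symmetric in two indices. The three variants allow the
term containing the symmetric Christoffel symbols to be dropped wherever its two lower indices
stand. -/
theorem altSum_congr_swap_34 {X Y : Fin 4 → Fin 4 → Fin 4 → Fin 4 → ℝ}
    (h : ∀ a b c d, X a b c d - Y a b c d = X a b d c - Y a b d c) :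
    altSum X = altSum Y := by
  rw [altSum_eq, altSum_eq]
  linear_combination h 0 1 2 3 - h 0 2 1 3 + h 0 3 1 2 - h 1 0 2 3 + h 1 2 0 3 - h 1 3 0 2 + h 2
    0 1 3 - h 2 1 0 3 + h 2 3 0 1 - h 3 0 1 2 + h 3 1 0 2 - h 3 2 0 1

theorem altSum_congr_swap_13 {X Y : Fin 4 → Fin 4 → Fin 4 → Fin 4 → ℝ}
    (h : ∀ a b c d, X a b c d - Y a b c d = X c b a d - Y c b a d) :
    altSum X = altSum Y := by
  rw [altSum_eq, altSum_eq]
  linear_combination h 0 1 2 3 - h 0 1 3 2 - h 0 2 1 3 + h 0 2 3 1 + h 0 3 1 2 - h 0 3 2 1 - h 1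
    0 2 3 + h 1 0 3 2 - h 1 2 3 0 + h 1 3 2 0 - h 2 0 3 1 + h 2 1 3 0

theorem altSum_congr_swap_23 {X Y : Fin 4 → Fin 4 → Fin 4 → Fin 4 → ℝ}
    (h : ∀ a b c d, X a b c d - Y a b c d = X a c b d - Y a c b d) :
    altSum X = altSum Y := by
  rw [altSum_eq, altSum_eq]
  linear_combination h 0 1 2 3 - h 0 1 3 2 + h 0 2 3 1 - h 1 0 2 3 + h 1 0 3 2 - h 1 2 3 0 + h 2
    0 1 3 - h 2 0 3 1 + h 2 1 3 0 - h 3 0 1 2 + h 3 0 2 1 - h 3 1 2 0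

theorem altSum_sum {ι : Type*} (s : Finset ι) (X : ι → Fin 4 → Fin 4 → Fin 4 → Fin 4 → ℝ) :
    (altSum fun α β γ δ => ∑ i ∈ s, X i α β γ δ) = ∑ i ∈ s, altSum (X i) := by
  simp only [altSum_eq, Finset.sum_add_distrib, Finset.sum_sub_distrib]

theorem altSum_const_mul (c : ℝ) (X : Fin 4 → Fin 4 → Fin 4 → Fin 4 → ℝ) :
    (altSum fun α β γ δ => c * X α β γ δ) = c * altSum X := by
  simp only [altSum_eq]
  ring

theorem teleparallelDensity_eq (l : Fin 4 → ℝ) (T : E4 → Matrix (Fin 4) (Fin 4) ℝ) (y : E4) :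
    teleparallelDensity l T y = altSum fun α β γ δ => (∑ j, l j * T y j α) *
      ∑ j, eta j * T y j β * pd γ (fun z => T z j δ) y := by
  simp only [Finset.sum_mul_sum, altSum_sum]
  rw [teleparallelDensity]
  refine Finset.sum_congr rfl fun i _ => ?_
  have h1 : ∀ j k, l i * mink j k * ∑ α, ∑ β, ∑ γ, ∑ δ,
      leviCivita α β γ δ * T y i α * T y j β * pd γ (fun z => T z k δ) y =
      mink j k * (l i * altSum fun α β γ δ => T y i α * T y j β * pd γ (fun z => T z k δ) y) := by
    intro j k
    simp only [altSum, mul_assoc]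
    ring
  simp only [h1]
  rw [sum_mink fun j k => l i * altSum fun α β γ δ =>
    T y i α * T y j β * pd γ (fun z => T z k δ) y]
  refine Finset.sum_congr rfl fun j _ => ?_
  rw [← altSum_const_mul, ← altSum_const_mul]
  exact altSum_congr fun α β γ δ => by ring

theorem sum_mul_sub_symm {P P' : Fin 4 → Fin 4 → Fin 4 → ℝ}
    (h : ∀ γ j δ, P γ j δ - P' γ j δ = P δ j γ - P' δ j γ) (u : Fin 4 → ℝ) (γ δ : Fin 4) :
    ∑ j, u j * P γ j δ - ∑ j, u j * P' γ j δ = ∑ j, u j * P δ j γ - ∑ j, u j * P' δ j γ := by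
  simp only [← Finset.sum_sub_distrib, ← mul_sub, h γ _ δ]

theorem altSum_congr_symm {l : Fin 4 → ℝ} {A : Matrix (Fin 4) (Fin 4) ℝ}
    {P P' : Fin 4 → Fin 4 → Fin 4 → ℝ}
    (h : ∀ γ j δ, P γ j δ - P' γ j δ = P δ j γ - P' δ j γ) :
    (altSum fun α β γ δ => (∑ j, l j * A j α) * ∑ j, eta j * A j β * P γ j δ) =
      altSum fun α β γ δ => (∑ j, l j * A j α) * ∑ j, eta j * A j β * P' γ j δ := by
  refine altSum_congr_swap_34 fun a b c d => ?_
  rw [← mul_sub, ← mul_sub, sum_mul_sub_symm h fun j => eta j * A j b]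

/-- Only the exterior derivative of the coframe enters. This allows the partial derivatives of the
coframe to be replaced by its contraction with the contortion. -/
theorem eulerLagrange_congr_symm {l : Fin 4 → ℝ} {A Q : Matrix (Fin 4) (Fin 4) ℝ}
    {P P' : Fin 4 → Fin 4 → Fin 4 → ℝ}
    (h : ∀ γ j δ, P γ j δ - P' γ j δ = P δ j γ - P' δ j γ) :
    eulerLagrange l A P Q = eulerLagrange l A P' Q := by
  have hr : ∀ (v : Fin 4 → ℝ) (γ δ : Fin 4),
      ∑ j, eta j * P γ j δ * v j - ∑ j, eta j * P' γ j δ * v j =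
      ∑ j, eta j * P δ j γ * v j - ∑ j, eta j * P' δ j γ * v j := by
    intro v γ δ
    have := sum_mul_sub_symm h (fun j => eta j * v j) γ δ
    simpa only [mul_right_comm] using this
  simp only [eulerLagrange, altSum_sub, altSum_add]
  congr 1
  · congr 1
    · congr 1
      · refine altSum_congr_swap_34 fun a b c d => ?_
        rw [← mul_sub, ← mul_sub, sum_mul_sub_symm h fun j => eta j * A j b]
      · refine altSum_congr_swap_34 fun a b c d => ?_
        rw [← mul_sub, ← mul_sub, sum_mul_sub_symm h fun j => eta j * Q j b]
    · refine altSum_congr_swap_13 fun a b c d => ?_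
      rw [← sub_mul, ← sub_mul, sum_mul_sub_symm h l]
  · refine altSum_congr_swap_23 fun a b c d => ?_
    rw [← mul_sub, ← mul_sub, hr fun j => Q j d]

theorem spinorCovDeriv_sub (G : E4 → Matrix (Fin 4) (Fin 4) ℝ)
    (S : E4 → Fin 4 → Matrix (Fin 2) (Fin 2) ℂ) (Γ Γ' : E4 → Fin 4 → Fin 4 → Fin 4 → ℝ)
    (X : E4 → Fin 2 → ℂ) (y : E4) (α : Fin 4) (a : Fin 2) :
    spinorCovDeriv G S Γ X y α a = spinorCovDeriv G S Γ' X y α a +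
      -(1 / 4) * ∑ b, (∑ β, ∑ c, spinorRaise (S y β) a c *
        ∑ γ, ((Γ' y β α γ - Γ y β α γ : ℝ) : ℂ) * ∑ μ, (((G y)⁻¹ γ μ : ℝ) : ℂ) * S y μ b c) *
        X y b := by
  simp only [spinorCovDeriv]
  rw [add_assoc, neg_mul, ← mul_neg, ← mul_add, ← Finset.sum_neg_distrib, ← Finset.sum_add_distrib]
  congr 2
  refine Finset.sum_congr rfl fun b _ => ?_
  rw [← neg_mul, ← add_mul, ← Finset.sum_neg_distrib, ← Finset.sum_add_distrib]
  congr 1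
  refine Finset.sum_congr rfl fun β _ => ?_
  rw [← Finset.sum_neg_distrib, ← Finset.sum_add_distrib]
  refine Finset.sum_congr rfl fun c _ => ?_
  rw [← mul_neg, ← mul_add, add_assoc, ← Finset.sum_neg_distrib, ← Finset.sum_add_distrib]
  congr 2
  refine Finset.sum_congr rfl fun γ _ => ?_
  rw [sigmaUp]
  push_cast
  ring

/-! ### The Lagrangians and the Weyl operator at a point. -/

/-- A frame in which the Pauli matrices are the standard ones, adapted to a patch with an
associated spinor: `L` relates it to the coframe and `K` is the contortion. -/
theorem IsPatch.exists_frame (h : IsPatch U G T S) (hy : y ∈ U) {l : Fin 4 → ℝ} {s : ℝ}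
    (hs : s = 1 ∨ s = -1) {X : E4 → Fin 2 → ℂ}
    (hpar : ∀ α a, spinorCovDeriv G S (weitzenbock T) X y α a = 0)
    (hcur : ∀ α, ∑ a, ∑ b, S y α a b * X y a * star (X y b) = ((s * ∑ j, l j * T y j α : ℝ) : ℂ)) :
    ∃ (E : Matrix (Fin 4) (Fin 4) ℝ) (L : Fin 4 → Fin 4 → ℝ) (K : Fin 4 → Fin 4 → Fin 4 → ℝ),
      IsPauliFrame (G y) (S y) E ∧ 0 < E.det ∧ IsLorentz L ∧ IsContortion K ∧
      (∀ j α, T y j α = ∑ a, L j a * E a α) ∧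
      (∀ a, ∑ j, l j * L j a = s * current (X y) a) ∧
      (∀ γ j δ, ∑ μ, T y j μ * (weitzenbock T y μ γ δ - christoffel G y μ γ δ) =
        ∑ a, L j a * ∑ c, ∑ d, E c γ * E d δ * (eta a * K a c d)) ∧
      (∀ α a, spinorCovDeriv G S (christoffel G) X y α a =
        ∑ c, (E c α : ℂ) * contortionDeriv K (X y) c a) := by
  obtain ⟨E, hE⟩ := exists_isPauliFrame (h.isUnit_det hy) (h.hermitian y hy) (h.clifford y hy)
  obtain ⟨K, hK, hKE⟩ := exists_contortion hE.unit hE.metric (h.contortion_antisymm hy)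
  have hT : ∀ j α, T y j α = ∑ a, (T y * E⁻¹) j a * E a α := by
    intro j α
    rw [← Matrix.mul_apply, Matrix.mul_assoc, Matrix.nonsing_inv_mul _ hE.unit, Matrix.mul_one]
  refine ⟨E, fun j a => (T y * E⁻¹) j a, K, hE, hE.det_pos (h.polarized y hy), ?_, hK, hT, ?_, ?_, ?_⟩
  · intro a b
    have h1 : (T y * E⁻¹).transpose * mink * (T y * E⁻¹) = mink := by
      have h2 := metric_eq_matrix (h.metric y hy)
      rw [metric_eq_matrix hE.metric] at h2
      rw [Matrix.transpose_mul]
      calc E⁻¹.transpose * (T y).transpose * mink * (T y * E⁻¹)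
          = E⁻¹.transpose * ((T y).transpose * mink * T y) * E⁻¹ := by
            simp only [Matrix.mul_assoc]
        _ = (E * E⁻¹).transpose * mink * (E * E⁻¹) := by
            rw [← h2, Matrix.transpose_mul]
            simp only [Matrix.mul_assoc]
        _ = mink := by
            rw [Matrix.mul_nonsing_inv _ hE.unit, Matrix.transpose_one, Matrix.one_mul,
              Matrix.mul_one]
    have h2 := congrFun (congrFun h1 a) b
    rw [mink_apply, mink, Matrix.mul_apply] at h2
    rw [← h2]
    refine Finset.sum_congr rfl fun j _ => ?_
    rw [Matrix.mul_diagonal, Matrix.transpose_apply, eta]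
    ring
  · intro a
    have h1 : ∀ α, s * ∑ j, l j * T y j α = ∑ j, E j α * current (X y) j := by
      intro α
      have h2 := hcur α
      apply Complex.ofReal_injective
      rw [← h2]
      push_cast
      simp only [← current_eq, hE.pauli, Fin.sum_univ_two, Finset.sum_mul,
        ← Finset.sum_add_distrib]
      exact Finset.sum_congr rfl fun j _ => by ring
    have h2 := sum_frame_mul_single (Matrix.mul_nonsing_inv _ hE.unit) (current (X y)) a
    rw [← h2]
    simp only [← h1]
    have hss : s * s = 1 := by rcases hs with rfl | rfl <;> norm_num
    have h3 : ∀ γ, s * (∑ j, l j * T y j γ) * E⁻¹ γ a = s * ((∑ j, l j * T y j γ) * E⁻¹ γ a) :=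
      fun γ => by ring
    simp only [h3, ← Finset.mul_sum]
    rw [← mul_assoc, hss, one_mul]
    simp only [Matrix.mul_apply]
    rw [sum_mul_sum_assoc l (fun j γ => T y j γ) (fun γ => E⁻¹ γ a)]
  · intro γ j δ
    simp only [← hKE]
    rw [sum_mul_sum_assoc (fun a => (T y * E⁻¹) j a) (fun a μ => E a μ)]
    simp only [← hT]
  -- The Weitzenböck derivative of the spinor vanishes, so its Levi-Civita derivative is the
  -- algebraic difference of the two connections.
  · intro α a
    rw [spinorCovDeriv_sub G S _ (weitzenbock T), hpar, zero_add]
    exact contortionDeriv_eq hE hKE (X y) α a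

variable {l : Fin 4 → ℝ} {s : ℝ} {X : E4 → Fin 2 → ℂ}

theorem IsPauliFrame.weylOperator_eq {E : Matrix (Fin 4) (Fin 4) ℝ}
    {K : Fin 4 → Fin 4 → Fin 4 → ℝ} (hE : IsPauliFrame (G y) (S y) E)
    (hD : ∀ α a, spinorCovDeriv G S (christoffel G) X y α a =
        ∑ c, (E c α : ℂ) * contortionDeriv K (X y) c a) (b : Fin 2) :
    weylOperator G S X y b = frameWeyl K (X y) b := by
  rw [weylOperator, frameWeyl, Finset.sum_comm, Finset.sum_comm (γ := Fin 4)]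
  congr 1
  refine Finset.sum_congr rfl fun a _ => ?_
  simp only [hD]
  exact pauli_contract hE (fun c => contortionDeriv K (X y) c a) a b

/-- The Lagrangians agree in a coordinate patch. -/
theorem IsPatch.lagrangian_eq (h : IsPatch U G T S) (hy : y ∈ U) (hs : s = 1 ∨ s = -1)
    (hpar : ∀ α a, spinorCovDeriv G S (weitzenbock T) X y α a = 0)
    (hcur : ∀ α, ∑ a, ∑ b, S y α a b * X y a * star (X y b) =
      ((s * ∑ j, l j * T y j α : ℝ) : ℂ)) :
    (teleparallelDensity l T y : ℂ) = (s : ℂ) * 4 * weylDensity G S X y := by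
  obtain ⟨E, L, K, hE, hpos, hL, hK, hT, hl, hP, hD⟩ := h.exists_frame hy hs hpar hcur
  have h1 : teleparallelDensity l T y =
      E.det * (s * altSum fun a b c d => current (X y) a * K b c d) := by
    -- The derivative of the coframe is its contraction with the Weitzenböck coefficients;
    -- subtracting the Christoffel symbols changes it by a term symmetric in the two lower indices.
    rw [teleparallelDensity_eq, altSum_congr_symm (P := fun γ j δ => pd γ (fun z => T z j δ) y)
      (P' := fun γ j δ => ∑ μ, T y j μ * (weitzenbock T y μ γ δ - christoffel G y μ γ δ)),
      altSum_frame E hL hT hP, ← altSum_const_mul s]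
    · simp only [hl, mul_assoc]
    · intro γ j δ
      simp only [mul_sub, Finset.sum_sub_distrib, h.sum_mul_weitzenbock hy,
        h.christoffel_symm hy _ γ δ]
      ring
  have h2 : Real.sqrt |(G y).det| = E.det := by
    rw [det_metric hE.metric, abs_neg, abs_of_nonneg (sq_nonneg _), Real.sqrt_sq hpos.le]
  have hpc := fun (v : Fin 4 → ℂ) a b => pauli_contract hE v a b
  have h3 : ∀ a b, ∑ α, (star (X y b) * sigmaUp G S y α a b *
      spinorCovDeriv G S (christoffel G) X y α a - X y a * sigmaUp G S y α a b *
        star (spinorCovDeriv G S (christoffel G) X y α b)) =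
      ∑ c, (star (X y b) * (eta c * pauli c a b) * contortionDeriv K (X y) c a -
          X y a * (eta c * pauli c a b) * star (contortionDeriv K (X y) c b)) := by
    intro a b
    have e1 := hpc (fun c => contortionDeriv K (X y) c a) a b
    have e2 := hpc (fun c => star (contortionDeriv K (X y) c b)) a b
    simp only [Finset.sum_sub_distrib, mul_assoc, ← Finset.mul_sum]
    simp only [mul_assoc] at e1 e2
    rw [← e1, ← e2]
    simp only [hD, star_sum, star_mul', Complex.star_def, Complex.conj_ofReal]
    rfl
  rw [h1, weylDensity, h2]
  push_cast
  rw [altSum_current_eq hK]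
  have h4 : ∑ α, ∑ a, ∑ b, (star (X y b) * sigmaUp G S y α a b *
      spinorCovDeriv G S (christoffel G) X y α a - X y a * sigmaUp G S y α a b *
        star (spinorCovDeriv G S (christoffel G) X y α b)) = ∑ c, ∑ a, ∑ b,
        (star (X y b) * (eta c * pauli c a b) * contortionDeriv K (X y) c a -
          X y a * (eta c * pauli c a b) * star (contortionDeriv K (X y) c b)) := by
    rw [Finset.sum_comm, Finset.sum_comm (γ := Fin 4) (s := Finset.univ (α := Fin 4))]
    refine Finset.sum_congr rfl fun a _ => ?_
    rw [Finset.sum_comm, Finset.sum_comm (γ := Fin 4) (s := Finset.univ (α := Fin 4))]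
    exact Finset.sum_congr rfl fun b _ => h3 a b
  rw [h4]
  ring

/-- The current of the zero spinor is zero, whereas a coframe is linearly independent. -/
theorem IsPatch.ne_zero (h : IsPatch U G T S) (hy : y ∈ U) (hs : s = 1 ∨ s = -1) (hl0 : l ≠ 0)
    (hcur : ∀ α, ∑ a, ∑ b, S y α a b * X y a * star (X y b) =
      ((s * ∑ j, l j * T y j α : ℝ) : ℂ)) : X y ≠ 0 := by
  intro h0
  have h1 : Matrix.vecMul l (T y) = 0 := by
    ext α
    have h2 := hcur α
    have hs0 : s ≠ 0 := by rcases hs with rfl | rfl <;> norm_num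
    simp only [h0, Pi.zero_apply, mul_zero, zero_mul, Finset.sum_const_zero] at h2
    exact (mul_eq_zero.1 (Complex.ofReal_eq_zero.1 h2.symm)).resolve_left hs0
  apply hl0
  have h2 := congrArg (fun v => Matrix.vecMul v (T y)⁻¹) h1
  simpa [Matrix.vecMul_vecMul, Matrix.mul_nonsing_inv _ (h.unit y hy)] using h2

/-- The Weyl equation holds at a point if and only if the linearized density vanishes at that
point for all infinitesimal Lorentz transformations. -/
theorem IsPatch.weyl_iff (h : IsPatch U G T S) (hy : y ∈ U) (hs : s = 1 ∨ s = -1) (hl0 : l ≠ 0)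
    (hpar : ∀ α a, spinorCovDeriv G S (weitzenbock T) X y α a = 0)
    (hcur : ∀ α, ∑ a, ∑ b, S y α a b * X y a * star (X y b) =
      ((s * ∑ j, l j * T y j α : ℝ) : ℂ)) :
    (∀ b, weylOperator G S X y b = 0) ↔ ∀ Q : Matrix (Fin 4) (Fin 4) ℝ,
      (∀ α β, ∑ j, eta j * T y j α * Q j β = -∑ j, eta j * T y j β * Q j α) →
      eulerLagrange l (T y) (fun γ j δ => pd γ (fun z => T z j δ) y) Q = 0 := by
  have hX := h.ne_zero hy hs hl0 hcur
  obtain ⟨E, L, K, hE, hpos, hL, hK, hT, hl, hP, hD⟩ := h.exists_frame hy hs hpar hcur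
  have hW := hE.weylOperator_eq hD
  have hs0 : s ≠ 0 := by rcases hs with rfl | rfl <;> norm_num
  have key : ∀ (Q : Matrix (Fin 4) (Fin 4) ℝ) (B : Fin 4 → Fin 4 → ℝ), (∀ a b, B a b = -B b a) →
      (∀ j α, Q j α = ∑ a, L j a * ∑ b, E b α * (eta a * B a b)) →
      eulerLagrange l (T y) (fun γ j δ => pd γ (fun z => T z j δ) y) Q =
        E.det * (s * (-8 * (∑ b, star (spinorRotation B (X y) b) * frameWeyl K (X y) b).re)) := by
    intro Q B hB hQ
    rw [eulerLagrange_congr_symm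
      (P' := fun γ j δ => ∑ μ, T y j μ * (weitzenbock T y μ γ δ - christoffel G y μ γ δ)),
      eulerLagrange_eq E hL hT hP hQ, ← eulerLagrange_frame hK hB, ← altSum_const_mul s]
    · congr 1
      refine altSum_congr fun a b c d => ?_
      simp only [hl, mul_add, mul_sub, Finset.mul_sum, Finset.sum_mul]
      congr 1
      · congr 1
        · congr 1
          · exact Finset.sum_congr rfl fun j _ => by ring
          · exact Finset.sum_congr rfl fun j _ => by ring
        · exact Finset.sum_congr rfl fun j _ => by ring
      · exact Finset.sum_congr rfl fun j _ => by ring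
    · intro γ j δ
      simp only [mul_sub, Finset.sum_sub_distrib, h.sum_mul_weitzenbock hy,
        h.christoffel_symm hy _ γ δ]
      ring
  have hTQ : ∀ (Q : Matrix (Fin 4) (Fin 4) ℝ) (C : Fin 4 → Fin 4 → ℝ),
      (∀ j α, Q j α = ∑ a, L j a * C a α) → ∀ α β, ∑ j, eta j * T y j α * Q j β =
        ∑ a, eta a * E a α * C a β := by
    intro Q C hQ α β
    simp only [hT, hQ]
    exact hL.sum_eq _ _
  constructor
  · intro hw Q hQ
    have hLm : (Matrix.of L).transpose * mink * Matrix.of L = mink := by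
      ext a b
      rw [mink_apply, ← hL a b, mink, Matrix.mul_apply]
      refine Finset.sum_congr rfl fun j _ => ?_
      rw [Matrix.mul_diagonal, Matrix.transpose_apply, eta]
      simp only [Matrix.of_apply]
      ring
    have hLm' : Matrix.of L * mink * (Matrix.of L).transpose * mink = 1 := by
      have h1 : mink * (Matrix.of L).transpose * mink * Matrix.of L = 1 := by
        rw [Matrix.mul_assoc, Matrix.mul_assoc, ← Matrix.mul_assoc _ mink, hLm, mink_mul_mink]
      simpa only [Matrix.mul_assoc] using mul_eq_one_comm.1 h1
    have hTm : T y = Matrix.of L * E := by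
      ext j α
      rw [hT, Matrix.mul_apply]
      rfl
    have hN : ∀ Q : Matrix (Fin 4) (Fin 4) ℝ, ∀ α β,
        ((T y).transpose * mink * Q) α β = ∑ j, eta j * T y j α * Q j β := by
      intro Q α β
      rw [mink, Matrix.mul_apply]
      refine Finset.sum_congr rfl fun j _ => ?_
      rw [Matrix.mul_diagonal, Matrix.transpose_apply, eta]
      ring
    have hNt : ((T y).transpose * mink * Q).transpose = -((T y).transpose * mink * Q) := by
      ext α β
      rw [Matrix.transpose_apply, Matrix.neg_apply, hN, hN, hQ]
    -- The skew form defined by `Q`, read on the frame dual to `E`. Since `L` is Lorentz, `Q = L η B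
    -- E` recovers `Q`.
    let B : Matrix (Fin 4) (Fin 4) ℝ := E⁻¹.transpose * ((T y).transpose * mink * Q) * E⁻¹
    have hB : B.transpose = -B := by
      simp only [B]
      rw [Matrix.transpose_mul, Matrix.transpose_mul, hNt, Matrix.transpose_transpose,
        Matrix.neg_mul, Matrix.mul_neg]
      simp only [Matrix.mul_assoc]
    have hQB : Q = Matrix.of L * (mink * (B * E)) := by
      have e1 : B * E = (Matrix.of L).transpose * mink * Q := by
        simp only [B]
        rw [Matrix.mul_assoc, Matrix.nonsing_inv_mul _ hE.unit, Matrix.mul_one, hTm,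
          Matrix.transpose_mul, Matrix.mul_assoc, Matrix.mul_assoc, ← Matrix.mul_assoc,
          ← Matrix.transpose_mul, Matrix.mul_nonsing_inv _ hE.unit, Matrix.transpose_one,
          Matrix.one_mul, Matrix.mul_assoc]
      rw [e1, ← Matrix.mul_assoc, ← Matrix.mul_assoc, ← Matrix.mul_assoc, hLm', Matrix.one_mul]
    rw [key Q (fun a b => B a b) (fun a b => congrFun (congrFun hB b) a) fun j α => ?_]
    · simp only [← hW, hw, mul_zero, Finset.sum_const_zero, Complex.zero_re]
    · have e2 := congrFun (congrFun hQB j) α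
      rw [e2, Matrix.mul_apply]
      refine Finset.sum_congr rfl fun a _ => ?_
      rw [Matrix.of_apply, mink, Matrix.diagonal_mul, Matrix.mul_apply, Finset.mul_sum]
      congr 1
      refine Finset.sum_congr rfl fun b _ => ?_
      rw [eta]
      ring
  · intro hQ b
    rw [hW]
    refine congrFun (eq_zero_of_forall_spinorRotation hX fun B hB => ?_) b
    -- Conversely `L η B E` is an admissible direction for every skew `B`.
    let Q : Matrix (Fin 4) (Fin 4) ℝ :=
      Matrix.of fun j α => ∑ a, L j a * ∑ b, E b α * (eta a * B a b)
    have h1 := hQ Q fun α β => by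
      have e : ∀ α β, ∑ a, eta a * E a α * ∑ b, E b β * (eta a * B a b) =
          ∑ a, ∑ b, E a α * E b β * B a b := by
        intro α β
        refine Finset.sum_congr rfl fun a _ => ?_
        rw [Finset.mul_sum]
        refine Finset.sum_congr rfl fun b _ => ?_
        linear_combination E a α * E b β * B a b * eta_mul_eta a
      rw [hTQ Q (fun a α => ∑ b, E b α * (eta a * B a b)) (fun _ _ => rfl),
        hTQ Q (fun a α => ∑ b, E b α * (eta a * B a b)) (fun _ _ => rfl), e, e, Finset.sum_comm,
        ← Finset.sum_neg_distrib]
      refine Finset.sum_congr rfl fun a _ => ?_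
      rw [← Finset.sum_neg_distrib]
      refine Finset.sum_congr rfl fun b _ => ?_
      rw [hB b a]
      ring
    rw [key Q B hB fun _ _ => rfl] at h1
    have h2 := (mul_eq_zero.1 ((mul_eq_zero.1 h1).resolve_left hpos.ne')).resolve_left hs0
    linarith

end

/-! ### The calculus of variations -/

section
open scoped Matrix.Norms.Operator

/-- One-parameter groups of Lorentz matrices. -/
theorem exists_lorentz_curve {A : Matrix (Fin 4) (Fin 4) ℝ}
    (hA : (mink * A).transpose = -(mink * A)) : ∃ R : ℝ → Matrix (Fin 4) (Fin 4) ℝ,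
      (∀ i j, ContDiff ℝ ∞ fun s => R s i j) ∧ R 0 = 1 ∧
      (∀ i j, HasDerivAt (fun s => R s i j) (A i j) 0) ∧
      ∀ s, (R s).transpose * mink * R s = mink := by
  have hd : HasDerivAt (fun s : ℝ => NormedSpace.exp (s • A)) A 0 := by
    have h := hasDerivAt_exp_smul_const (𝕂 := ℝ) A 0
    rw [zero_smul, NormedSpace.exp_zero, Matrix.one_mul] at h
    exact h
  let ev : Fin 4 → Fin 4 → Matrix (Fin 4) (Fin 4) ℝ →L[ℝ] ℝ := fun i j =>
    LinearMap.toContinuousLinearMap (Matrix.entryLinearMap ℝ ℝ i j)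
  refine ⟨fun s => NormedSpace.exp (s • A), fun i j => ?_, by simp, fun i j => ?_, fun s => ?_⟩
  · have h1 : ContDiff ℝ ∞ fun s : ℝ => NormedSpace.exp (s • A) := by
      have h2 : ContDiff ℝ ∞ (NormedSpace.exp : Matrix (Fin 4) (Fin 4) ℝ → _) :=
        contDiff_iff_contDiffAt.2 fun x => (NormedSpace.exp_analytic (𝕂 := ℝ) x).contDiffAt
      exact h2.comp (contDiff_id.smul contDiff_const)
    exact (ev i j).contDiff.comp h1
  · exact (ev i j).hasFDerivAt.comp_hasDerivAt (0 : ℝ) hd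
  · have hm : mink⁻¹ = mink := Matrix.inv_eq_left_inv mink_mul_mink
    have hu : IsUnit mink := IsUnit.of_mul_eq_one _ mink_mul_mink
    have hmt : mink.transpose = mink := Matrix.diagonal_transpose _
    -- Skewness of `η A` says that the transpose of `A` is the conjugate of `-A` by `η`; the
    -- exponential commutes with transposition and conjugation.
    have h1 : A.transpose = mink * (-A) * mink⁻¹ := by
      rw [Matrix.transpose_mul, hmt] at hA
      rw [hm, Matrix.mul_neg, ← hA, Matrix.mul_assoc, mink_mul_mink, Matrix.mul_one]
    have h2 : (NormedSpace.exp (s • A)).transpose =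
        mink * NormedSpace.exp (-(s • A)) * mink := by
      rw [← Matrix.exp_transpose, Matrix.transpose_smul, h1, ← Matrix.smul_mul, ← Matrix.mul_smul,
        Matrix.exp_conj _ _ hu, hm, smul_neg]
    have h3 : NormedSpace.exp (-(s • A)) * NormedSpace.exp (s • A) = 1 := by
      rw [Matrix.exp_neg]
      exact Matrix.nonsing_inv_mul _ ((Matrix.isUnit_iff_isUnit_det _).1 (Matrix.isUnit_exp _))
    rw [h2, Matrix.mul_assoc, Matrix.mul_assoc, ← Matrix.mul_assoc mink mink, mink_mul_mink,
      Matrix.one_mul, Matrix.mul_assoc, h3, Matrix.mul_one]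

end

open MeasureTheory in
theorem hasDerivAt_setIntegral {U K : Set E4} (hU : IsOpen U) (hK : IsCompact K) (hKU : K ⊆ U)
    {D : ℝ × E4 → ℝ} (hD : ContDiffOn ℝ ∞ D (Set.univ ×ˢ U)) :
    HasDerivAt (fun t : ℝ => ∫ y in K, D (t, y)) (∫ y in K, fderiv ℝ D (0, y) (1, 0)) 0 := by
  have hW : IsOpen (Set.univ ×ˢ U : Set (ℝ × E4)) := isOpen_univ.prod hU
  have hF : ContinuousOn (fun p => fderiv ℝ D p (1, 0)) (Set.univ ×ˢ U) :=
    ((hD.fderiv_of_isOpen (m := ∞) hW (by simp)).continuousOn).clm_apply continuousOn_const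
  have hcomp : IsCompact (Set.Icc (-1 : ℝ) 1 ×ˢ K) := isCompact_Icc.prod hK
  -- The dominating function is a constant: the bound of the time derivative on the compact set
  -- `[-1, 1] × K`.
  obtain ⟨C, hC⟩ := hcomp.exists_bound_of_continuousOn
    (hF.mono (Set.prod_mono (Set.subset_univ _) hKU))
  have hsl : ∀ t : ℝ, Set.MapsTo (fun y : E4 => (t, y)) K (Set.univ ×ˢ U) :=
    fun t y hy => ⟨trivial, hKU hy⟩
  have hc : ∀ t : ℝ, ContinuousOn (fun y => D (t, y)) K := fun t =>
    hD.continuousOn.comp (by fun_prop) (hsl t)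
  have hc' : ContinuousOn (fun y => fderiv ℝ D (0, y) (1, 0)) K :=
    hF.comp (by fun_prop) (hsl 0)
  refine (hasDerivAt_integral_of_dominated_loc_of_deriv_le (μ := volume.restrict K)
    (F := fun t y => D (t, y)) (F' := fun t y => fderiv ℝ D (t, y) (1, 0))
    (bound := fun _ => C) (s := Set.Icc (-1 : ℝ) 1)
    (Icc_mem_nhds (by norm_num) (by norm_num)) ?_ ?_ ?_ ?_ ?_ ?_).2
  · exact Filter.Eventually.of_forall fun t => (hc t).aestronglyMeasurable hK.measurableSet
  · exact (hc 0).integrableOn_compact hK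
  · exact hc'.aestronglyMeasurable hK.measurableSet
  · refine (ae_restrict_mem hK.measurableSet).mono fun y hy t ht => hC (t, y) ⟨ht, hy⟩
  · exact continuousOn_const.integrableOn_compact hK
  · refine (ae_restrict_mem hK.measurableSet).mono fun y hy t _ => ?_
    have h1 : HasFDerivAt D (fderiv ℝ D (t, y)) (t, y) :=
      ((hD.differentiableOn (by simp)).differentiableAt
        (hW.mem_nhds ⟨trivial, hKU hy⟩)).hasFDerivAt
    have h2 : HasDerivAt (fun t : ℝ => (t, y)) ((1 : ℝ), (0 : E4)) t :=
      (hasDerivAt_id t).prodMk (hasDerivAt_const t y)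
    exact h1.comp_hasDerivAt t h2

open MeasureTheory in
-- Extended by zero from `K`, the function is smooth with compact support on the whole space,
-- because `U` and the complement of `K` cover it; it is then integrated by parts against the
-- constant `1`.
theorem setIntegral_pd_eq_zero {U K : Set E4} (hU : IsOpen U) (hK : IsCompact K) (hKU : K ⊆ U)
    {v : E4 → ℝ} (hv : ContDiffOn ℝ ∞ v U) (h0 : ∀ y ∈ U \ K, v y = 0) (γ : Fin 4) :
    ∫ y in K, pd γ v y = 0 := by
  classical
  let w : E4 → ℝ := K.indicator v
  have hwU : ∀ y ∈ U, w y = v y := by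
    intro y hy
    by_cases hyK : y ∈ K
    · exact Set.indicator_of_mem hyK v
    · rw [h0 y ⟨hy, hyK⟩]
      exact Set.indicator_of_notMem hyK v
  have hwK : ∀ y ∈ Kᶜ, w y = 0 := fun y hy => Set.indicator_of_notMem hy v
  have hKo : IsOpen Kᶜ := hK.isClosed.isOpen_compl
  have hw : ContDiff ℝ ∞ w := by
    rw [contDiff_iff_contDiffAt]
    intro y
    by_cases hy : y ∈ U
    · exact (hv.contDiffAt (hU.mem_nhds hy)).congr_of_eventuallyEq
        (Filter.eventuallyEq_of_mem (hU.mem_nhds hy) hwU)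
    · have hy' : y ∈ Kᶜ := fun h => hy (hKU h)
      exact (contDiffAt_const (c := (0 : ℝ))).congr_of_eventuallyEq
        (Filter.eventuallyEq_of_mem (hKo.mem_nhds hy') hwK)
  have hcs : HasCompactSupport w := HasCompactSupport.intro hK fun y hy => hwK y hy
  have hint : Integrable (fun y => fderiv ℝ w y (EuclideanSpace.single γ 1)) :=
    ((hw.continuous_fderiv (by simp)).clm_apply continuous_const).integrable_of_hasCompactSupport
      (hcs.fderiv_apply ℝ _)
  have h1 := integral_mul_fderiv_eq_neg_fderiv_mul_of_integrable (μ := (volume : Measure E4))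
    (f := fun _ => (1 : ℝ)) (g := w) (v := EuclideanSpace.single γ 1) (by simp)
    (by simpa using hint)
    (by simpa using hw.continuous.integrable_of_hasCompactSupport hcs)
    (fun x _ => by fun_prop) (fun x _ => hw.differentiable (by simp) x)
  simp only [one_mul, fderiv_fun_const, Pi.zero_apply, zero_apply,
    zero_mul, integral_zero, neg_zero] at h1
  have h2 : ∫ y in K, pd γ v y = ∫ y in K, fderiv ℝ w y (EuclideanSpace.single γ 1) :=
    setIntegral_congr_fun hK.measurableSet fun y hy => (pd_congr hU hwU (hKU hy) γ).symm
  rw [h2, setIntegral_eq_integral_of_forall_compl_eq_zero, h1]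
  intro y hy
  have h3 := pd_congr (f := w) (g := fun _ => (0 : ℝ)) hKo hwK (show y ∈ Kᶜ from hy) γ
  simpa [pd] using h3

section

theorem hasDerivAt_altSum {X : Fin 4 → Fin 4 → Fin 4 → Fin 4 → ℝ → ℝ}
    {X' : Fin 4 → Fin 4 → Fin 4 → Fin 4 → ℝ} {t : ℝ}
    (h : ∀ a b c d, HasDerivAt (X a b c d) (X' a b c d) t) :
    HasDerivAt (fun t => altSum fun a b c d => X a b c d t) (altSum X') t :=
  HasDerivAt.fun_sum fun a _ => HasDerivAt.fun_sum fun b _ => HasDerivAt.fun_sum fun c _ =>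
    HasDerivAt.fun_sum fun d _ => (h a b c d).const_mul _

theorem contDiffOn_altSum {E : Type*} [NormedAddCommGroup E] [NormedSpace ℝ E] {s : Set E}
    {X : Fin 4 → Fin 4 → Fin 4 → Fin 4 → E → ℝ}
    (h : ∀ a b c d, ContDiffOn ℝ ∞ (X a b c d) s) :
    ContDiffOn ℝ ∞ (fun y => altSum fun a b c d => X a b c d y) s :=
  ContDiffOn.sum fun a _ => ContDiffOn.sum fun b _ => ContDiffOn.sum fun c _ =>
    ContDiffOn.sum fun d _ => contDiffOn_const.mul (h a b c d)

open MeasureTheory in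
theorem integral_altSum {μ : Measure E4} {X : Fin 4 → Fin 4 → Fin 4 → Fin 4 → E4 → ℝ}
    (h : ∀ a b c d, Integrable (X a b c d) μ) :
    ∫ y, (altSum fun a b c d => X a b c d y) ∂μ = altSum fun a b c d => ∫ y, X a b c d y ∂μ := by
  simp only [altSum]
  rw [integral_finsetSum _ fun a _ => integrable_finsetSum _ fun b _ =>
    integrable_finsetSum _ fun c _ => integrable_finsetSum _ fun d _ => (h a b c d).const_mul _]
  refine Finset.sum_congr rfl fun a _ => ?_
  rw [integral_finsetSum _ fun b _ =>
    integrable_finsetSum _ fun c _ => integrable_finsetSum _ fun d _ => (h a b c d).const_mul _]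
  refine Finset.sum_congr rfl fun b _ => ?_
  rw [integral_finsetSum _ fun c _ =>
    integrable_finsetSum _ fun d _ => (h a b c d).const_mul _]
  refine Finset.sum_congr rfl fun c _ => ?_
  rw [integral_finsetSum _ fun d _ => (h a b c d).const_mul _]
  exact Finset.sum_congr rfl fun d _ => integral_const_mul _ _

section family
variable {U : Set E4} {θ : ℝ × E4 → ℝ} {t : ℝ} {y : E4}

theorem hasDerivAt_family (hU : IsOpen U) (hθ : ContDiffOn ℝ ∞ θ (Set.univ ×ˢ U)) (hy : y ∈ U) :
    HasDerivAt (fun t => θ (t, y)) (fderiv ℝ θ (t, y) (1, 0)) t := by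
  have h1 : HasFDerivAt θ (fderiv ℝ θ (t, y)) (t, y) :=
    ((hθ.differentiableOn (by simp)).differentiableAt
      ((isOpen_univ.prod hU).mem_nhds ⟨trivial, hy⟩)).hasFDerivAt
  exact h1.comp_hasDerivAt t ((hasDerivAt_id t).prodMk (hasDerivAt_const t y))

theorem pd_family (hU : IsOpen U) (hθ : ContDiffOn ℝ ∞ θ (Set.univ ×ˢ U)) (hy : y ∈ U)
    (γ : Fin 4) : pd γ (fun z => θ (t, z)) y =
      fderiv ℝ θ (t, y) (0, EuclideanSpace.single γ 1) := by
  have h1 : HasFDerivAt θ (fderiv ℝ θ (t, y)) (t, y) :=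
    ((hθ.differentiableOn (by simp)).differentiableAt
      ((isOpen_univ.prod hU).mem_nhds ⟨trivial, hy⟩)).hasFDerivAt
  have h2 : HasFDerivAt (fun z : E4 => (t, z))
      ((0 : E4 →L[ℝ] ℝ).prod (ContinuousLinearMap.id ℝ E4)) y :=
    (hasFDerivAt_const t y).prodMk (hasFDerivAt_id y)
  have h3 := h1.comp y h2
  change HasFDerivAt (fun z => θ (t, z)) _ y at h3
  rw [pd, h3.fderiv]
  simp

theorem contDiffOn_fderiv_family (hU : IsOpen U) (hθ : ContDiffOn ℝ ∞ θ (Set.univ ×ˢ U))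
    (v : ℝ × E4) : ContDiffOn ℝ ∞ (fun p => fderiv ℝ θ p v) (Set.univ ×ˢ U) :=
  (hθ.fderiv_of_isOpen (m := ∞) (isOpen_univ.prod hU) (by simp)).clm_apply contDiffOn_const

theorem contDiffOn_slice (hθ : ContDiffOn ℝ ∞ θ (Set.univ ×ˢ U)) (t : ℝ) :
    ContDiffOn ℝ ∞ (fun y => θ (t, y)) U :=
  hθ.comp (contDiffOn_const.prodMk contDiffOn_id) fun _ hy => ⟨trivial, hy⟩

/-- Symmetry of the second derivative: the parameter of the variation and the coordinates may be
differentiated in either order. -/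
theorem fderiv_fderiv_family (hU : IsOpen U) (hθ : ContDiffOn ℝ ∞ θ (Set.univ ×ˢ U)) (hy : y ∈ U)
    (γ : Fin 4) :
    fderiv ℝ (fun p => fderiv ℝ θ p (0, EuclideanSpace.single γ 1)) (t, y) (1, 0) =
      pd γ (fun z => fderiv ℝ θ (t, z) (1, 0)) y := by
  have hmem : (Set.univ ×ˢ U : Set (ℝ × E4)) ∈ nhds (t, y) :=
    (isOpen_univ.prod hU).mem_nhds ⟨trivial, hy⟩
  rw [pd_family hU (contDiffOn_fderiv_family hU hθ _) hy]
  have h2 : DifferentiableAt ℝ (fderiv ℝ θ) (t, y) :=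
    ((hθ.fderiv_of_isOpen (m := ∞) (isOpen_univ.prod hU) (by simp)).differentiableOn
      (by simp)).differentiableAt hmem
  have h3 : ∀ v w, fderiv ℝ (fun p => fderiv ℝ θ p v) (t, y) w =
      fderiv ℝ (fderiv ℝ θ) (t, y) w v := by
    intro v w
    rw [fderiv_clm_apply h2 (differentiableAt_const v)]
    simp
  rw [h3, h3]
  have hs : IsSymmSndFDerivAt ℝ θ (t, y) :=
    (hθ.contDiffAt hmem).isSymmSndFDerivAt (by
      rw [minSmoothness_of_isRCLikeNormedField]
      exact WithTop.coe_le_coe.2 le_top)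
  exact hs.eq _ _

end family

variable {U : Set E4} {G T : E4 → Matrix (Fin 4) (Fin 4) ℝ}
  {S : E4 → Fin 4 → Matrix (Fin 2) (Fin 2) ℂ} {l : Fin 4 → ℝ}

/-- The linearized density at the coframe `T` in the direction `Q`. -/
def linDensity (l : Fin 4 → ℝ) (T Q : E4 → Matrix (Fin 4) (Fin 4) ℝ) (y : E4) : ℝ :=
  eulerLagrange l (T y) (fun γ j δ => pd γ (fun z => T z j δ) y) (Q y)

theorem contDiffOn_linDensity {Q : E4 → Matrix (Fin 4) (Fin 4) ℝ} (hU : IsOpen U)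
    (hT : ∀ j α, ContDiffOn ℝ ∞ (fun y => T y j α) U)
    (hQ : ∀ j α, ContDiffOn ℝ ∞ (fun y => Q y j α) U) :
    ContDiffOn ℝ ∞ (linDensity l T Q) U := by
  have hP : ∀ γ j δ, ContDiffOn ℝ ∞ (fun y => pd γ (fun z => T z j δ) y) U := fun γ j δ =>
    ((hT j δ).fderiv_of_isOpen (m := ∞) hU (by simp)).clm_apply contDiffOn_const
  have hl : ∀ {f : Fin 4 → E4 → ℝ}, (∀ j, ContDiffOn ℝ ∞ (f j) U) →
      ContDiffOn ℝ ∞ (fun y => ∑ j, l j * f j y) U := fun hf =>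
    ContDiffOn.sum fun j _ => contDiffOn_const.mul (hf j)
  have he : ∀ {f g : Fin 4 → E4 → ℝ}, (∀ j, ContDiffOn ℝ ∞ (f j) U) →
      (∀ j, ContDiffOn ℝ ∞ (g j) U) →
      ContDiffOn ℝ ∞ (fun y => ∑ j, eta j * f j y * g j y) U := fun hf hg =>
    ContDiffOn.sum fun j _ => (contDiffOn_const.mul (hf j)).mul (hg j)
  unfold linDensity eulerLagrange
  refine contDiffOn_altSum fun a b c d => ?_
  exact ((((hl fun j => hQ j a).mul (he (fun j => hT j b) fun j => hP c j d)).add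
    ((hl fun j => hT j a).mul (he (fun j => hQ j b) fun j => hP c j d))).sub
    ((hl fun j => hP c j a).mul (he (fun j => hT j b) fun j => hQ j d))).sub
    ((hl fun j => hT j a).mul (he (fun j => hP c j b) fun j => hQ j d))

open MeasureTheory in
/-- The first variation of the action. -/
theorem hasDerivAt_action (hU : IsOpen U) {K : Set E4} (hK : IsCompact K) (hKU : K ⊆ U)
    {Θ : ℝ → E4 → Matrix (Fin 4) (Fin 4) ℝ}
    (hΘ : ∀ j α, ContDiffOn ℝ ∞ (fun p : ℝ × E4 => Θ p.1 p.2 j α) (Set.univ ×ˢ U))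
    {Q : E4 → Matrix (Fin 4) (Fin 4) ℝ}
    (hQ : ∀ y ∈ U, ∀ j α, HasDerivAt (fun t => Θ t y j α) (Q y j α) 0)
    (hQK : ∀ y ∈ U \ K, Q y = 0) :
    HasDerivAt (fun t : ℝ => ∫ y in K, teleparallelDensity l (Θ t) y)
      (∫ y in K, linDensity l (Θ 0) Q y) 0 := by
  let θ : Fin 4 → Fin 4 → ℝ × E4 → ℝ := fun j α p => Θ p.1 p.2 j α
  let P : Fin 4 → Fin 4 → Fin 4 → ℝ × E4 → ℝ := fun γ j δ p =>
    fderiv ℝ (θ j δ) p (0, EuclideanSpace.single γ 1)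
  have hP : ∀ γ j δ, ContDiffOn ℝ ∞ (P γ j δ) (Set.univ ×ˢ U) := fun γ j δ =>
    contDiffOn_fderiv_family hU (hΘ j δ) _
  have hPd : ∀ t, ∀ y ∈ U, ∀ γ j δ, pd γ (fun z => Θ t z j δ) y = P γ j δ (t, y) :=
    fun t y hy γ j δ => pd_family hU (hΘ j δ) hy γ
  have hQθ : ∀ y ∈ U, ∀ j α, Q y j α = fderiv ℝ (θ j α) (0, y) (1, 0) := fun y hy j α =>
    (hQ y hy j α).unique (hasDerivAt_family hU (hΘ j α) hy)
  have hTs : ∀ j α, ContDiffOn ℝ ∞ (fun y => Θ 0 y j α) U := fun j α => contDiffOn_slice (hΘ j α) 0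
  have hQs : ∀ j α, ContDiffOn ℝ ∞ (fun y => Q y j α) U := fun j α =>
    (contDiffOn_slice (contDiffOn_fderiv_family hU (hΘ j α) (1, 0)) 0).congr
      fun y hy => hQθ y hy j α
  have hPt : ∀ y ∈ U, ∀ γ j δ,
      HasDerivAt (fun t => P γ j δ (t, y)) (pd γ (fun z => Q z j δ) y) 0 := by
    intro y hy γ j δ
    have h1 := hasDerivAt_family (t := 0) hU (hP γ j δ) hy
    rw [fderiv_fderiv_family hU (hΘ j δ) hy] at h1
    rwa [pd_congr hU (fun z hz => hQθ z hz j δ) hy]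
  let D : ℝ × E4 → ℝ := fun p => altSum fun α β γ δ =>
    (∑ j, l j * θ j α p) * ∑ j, eta j * θ j β p * P γ j δ p
  have hD : ContDiffOn ℝ ∞ D (Set.univ ×ˢ U) :=
    contDiffOn_altSum fun a b c d =>
      (ContDiffOn.sum fun j _ => contDiffOn_const.mul (hΘ j a)).mul
        (ContDiffOn.sum fun j _ => (contDiffOn_const.mul (hΘ j b)).mul (hP c j d))
  -- The boundary term: subtracting its divergence removes the derivative of `Q` from the first
  -- variation and leaves the two negative terms of `eulerLagrange`. It vanishes off `K` together
  -- with `Q`.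
  let v : Fin 4 → Fin 4 → Fin 4 → E4 → ℝ := fun α β δ y =>
    (∑ j, l j * Θ 0 y j α) * ∑ j, eta j * Θ 0 y j β * Q y j δ
  have hv : ∀ α β δ, ContDiffOn ℝ ∞ (v α β δ) U := fun α β δ =>
      (ContDiffOn.sum fun j _ => contDiffOn_const.mul (hTs j α)).mul
        (ContDiffOn.sum fun j _ => (contDiffOn_const.mul (hTs j β)).mul (hQs j δ))
  have hvd : ∀ y ∈ U, ∀ α β γ δ, pd γ (v α β δ) y =
      (∑ j, l j * pd γ (fun z => Θ 0 z j α) y) * (∑ j, eta j * Θ 0 y j β * Q y j δ) +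
      (∑ j, l j * Θ 0 y j α) * ((∑ j, eta j * pd γ (fun z => Θ 0 z j β) y * Q y j δ) +
        ∑ j, eta j * Θ 0 y j β * pd γ (fun z => Q z j δ) y) := by
    intro y hy α β γ δ
    have dT : ∀ j α, DifferentiableAt ℝ (fun z => Θ 0 z j α) y := fun j α =>
      ContDiffOn.differentiableAt_of_mem (hTs j α) hU hy
    have dQ : ∀ j α, DifferentiableAt ℝ (fun z => Q z j α) y := fun j α =>
      ContDiffOn.differentiableAt_of_mem (hQs j α) hU hy
    have e1 : pd γ (fun z => ∑ j, l j * Θ 0 z j α) y =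
        ∑ j, l j * pd γ (fun z => Θ 0 z j α) y := by
      rw [pd_sum (f := fun j z => l j * Θ 0 z j α) _ fun j _ => (dT j α).const_mul _]
      exact Finset.sum_congr rfl fun j _ => pd_const_mul _ (dT j α) γ
    have e2 : pd γ (fun z => ∑ j, eta j * Θ 0 z j β * Q z j δ) y =
        (∑ j, eta j * pd γ (fun z => Θ 0 z j β) y * Q y j δ) +
          ∑ j, eta j * Θ 0 y j β * pd γ (fun z => Q z j δ) y := by
      rw [pd_sum (f := fun j z => eta j * Θ 0 z j β * Q z j δ) _
        fun j _ => ((dT j β).const_mul _).mul (dQ j δ), ← Finset.sum_add_distrib]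
      refine Finset.sum_congr rfl fun j _ => ?_
      rw [pd_mul (f := fun z => eta j * Θ 0 z j β) (g := fun z => Q z j δ)
        ((dT j β).const_mul _) (dQ j δ), pd_const_mul (f := fun z => Θ 0 z j β) _ (dT j β)]
    rw [pd_mul (f := fun z => ∑ j, l j * Θ 0 z j α)
      (g := fun z => ∑ j, eta j * Θ 0 z j β * Q z j δ)
      (DifferentiableAt.fun_sum fun j _ => (dT j α).const_mul _)
      (DifferentiableAt.fun_sum fun j _ => ((dT j β).const_mul _).mul (dQ j δ)), e1, e2]
  have hder : ∀ y ∈ U, fderiv ℝ D (0, y) (1, 0) =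
      linDensity l (Θ 0) Q y + altSum fun α β γ δ => pd γ (v α β δ) y := by
    intro y hy
    have h1 := hasDerivAt_family (t := 0) hU hD hy
    have h2 : HasDerivAt (fun t => D (t, y)) (altSum fun α β γ δ =>
        (∑ j, l j * Q y j α) * (∑ j, eta j * θ j β (0, y) * P γ j δ (0, y)) +
        (∑ j, l j * θ j α (0, y)) * ∑ j, ((eta j * Q y j β) * P γ j δ (0, y) +
          eta j * θ j β (0, y) * pd γ (fun z => Q z j δ) y)) 0 := by
      refine hasDerivAt_altSum fun a b c d => ?_
      exact (HasDerivAt.fun_sum fun j _ => (hQ y hy j a).const_mul (l j)).mul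
        (HasDerivAt.fun_sum fun j _ => ((hQ y hy j b).const_mul (eta j)).mul (hPt y hy c j d))
    rw [h1.unique h2, linDensity, eulerLagrange, ← altSum_add]
    refine altSum_congr fun α β γ δ => ?_
    rw [hvd y hy]
    simp only [hPd 0 y hy, Finset.sum_add_distrib]
    ring
  have hi : ∀ f : E4 → ℝ, ContinuousOn f U → IntegrableOn f K := fun f hf =>
    (hf.mono hKU).integrableOn_compact hK
  have hpv : ∀ α β γ δ, ContinuousOn (fun y => pd γ (v α β δ) y) U := fun α β γ δ =>
    (((hv α β δ).fderiv_of_isOpen (m := ∞) hU (by simp)).continuousOn).clm_apply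
      continuousOn_const
  have hvar := hasDerivAt_setIntegral hU hK hKU hD
  have hint : ∫ y in K, fderiv ℝ D (0, y) (1, 0) = ∫ y in K, linDensity l (Θ 0) Q y := by
    rw [setIntegral_congr_fun hK.measurableSet fun y hy => hder y (hKU hy), integral_add,
      integral_altSum]
    · have : ∀ α β γ δ, ∫ y in K, pd γ (v α β δ) y = 0 := fun α β γ δ =>
        setIntegral_pd_eq_zero hU hK hKU (hv α β δ) (fun y hy => by simp [v, hQK y hy]) γ
      simp [this, altSum]
    · exact fun α β γ δ => hi _ (hpv α β γ δ)
    · exact hi _ (contDiffOn_linDensity hU hTs hQs).continuousOn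
    · refine hi (fun y => altSum fun α β γ δ => pd γ (v α β δ) y) ?_
      exact continuousOn_finsetSum _ fun a _ => continuousOn_finsetSum _ fun b _ =>
        continuousOn_finsetSum _ fun c _ => continuousOn_finsetSum _ fun d _ =>
          continuousOn_const.mul (hpv a b c d)
  rw [← hint]
  refine hvar.congr_of_eventuallyEq (Filter.Eventually.of_forall fun t => ?_)
  refine setIntegral_congr_fun hK.measurableSet fun y hy => ?_
  simp only [teleparallelDensity_eq, hPd t y (hKU hy)]
  rfl

end

/-! ### Stationarity as a pointwise condition. -/

section

variable {U : Set E4} {G T : E4 → Matrix (Fin 4) (Fin 4) ℝ}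
  {S : E4 → Fin 4 → Matrix (Fin 2) (Fin 2) ℂ} {l : Fin 4 → ℝ} {s : ℝ} {X : E4 → Fin 2 → ℂ}

theorem eulerLagrange_smul (l : Fin 4 → ℝ) (T : Matrix (Fin 4) (Fin 4) ℝ)
    (P : Fin 4 → Fin 4 → Fin 4 → ℝ) (c : ℝ) (Q : Matrix (Fin 4) (Fin 4) ℝ) :
    eulerLagrange l T P (c • Q) = c * eulerLagrange l T P Q := by
  rw [eulerLagrange, eulerLagrange, ← altSum_const_mul]
  refine altSum_congr fun α β γ δ => ?_
  have e1 : ∀ α, ∑ j, l j * (c • Q) j α = c * ∑ j, l j * Q j α := by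
    intro α
    rw [Finset.mul_sum]
    exact Finset.sum_congr rfl fun j _ => by rw [Matrix.smul_apply, smul_eq_mul]; ring
  have e2 : ∀ (u : Fin 4 → ℝ) β, ∑ j, eta j * (c • Q) j β * u j = c * ∑ j, eta j * Q j β * u j := by
    intro u α
    rw [Finset.mul_sum]
    exact Finset.sum_congr rfl fun j _ => by rw [Matrix.smul_apply, smul_eq_mul]; ring
  have e3 : ∀ (u : Fin 4 → ℝ) β, ∑ j, eta j * u j * (c • Q) j β = c * ∑ j, eta j * u j * Q j β := by
    intro u α
    rw [Finset.mul_sum]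
    exact Finset.sum_congr rfl fun j _ => by rw [Matrix.smul_apply, smul_eq_mul]; ring
  rw [e1, e2 (fun j => P γ j δ), e3 (fun j => T j β), e3 (fun j => P γ j β)]
  ring

/-- A coframe is stationary if and only if the linearized density vanishes for all infinitesimal
Lorentz transformations. -/
theorem IsPatch.isStationary_iff (h : IsPatch U G T S) : IsStationary U G l T ↔
    ∀ y ∈ U, ∀ Q : Matrix (Fin 4) (Fin 4) ℝ,
      (∀ α β, ∑ j, eta j * T y j α * Q j β = -∑ j, eta j * T y j β * Q j α) →
      eulerLagrange l (T y) (fun γ j δ => pd γ (fun z => T z j δ) y) Q = 0 := by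
  constructor
  · intro hst y hy Q hQ
    have hTu := h.unit y hy
    -- The direction at the one point `y` extends to the direction `A * T` on the whole patch, with
    -- a constant `A` in the Lorentz algebra.
    let A : Matrix (Fin 4) (Fin 4) ℝ := Q * (T y)⁻¹
    have hQA : Q = A * T y := by
      simp only [A]
      rw [Matrix.mul_assoc, Matrix.nonsing_inv_mul _ hTu, Matrix.mul_one]
    have hN : ((T y).transpose * mink * Q).transpose = -((T y).transpose * mink * Q) := by
      have hN : ∀ α β, ((T y).transpose * mink * Q) α β = ∑ j, eta j * T y j α * Q j β := by
        intro α β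
        rw [mink, Matrix.mul_apply]
        refine Finset.sum_congr rfl fun j _ => ?_
        rw [Matrix.mul_diagonal, Matrix.transpose_apply, eta]
        ring
      ext α β
      rw [Matrix.transpose_apply, Matrix.neg_apply, hN, hN, hQ]
    have hA : (mink * A).transpose = -(mink * A) := by
      have e1 : mink * A = (T y)⁻¹.transpose * ((T y).transpose * mink * Q) * (T y)⁻¹ := by
        simp only [A]
        rw [Matrix.mul_assoc (T y).transpose, ← Matrix.mul_assoc (T y)⁻¹.transpose,
          ← Matrix.transpose_mul, Matrix.mul_nonsing_inv _ hTu, Matrix.transpose_one,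
          Matrix.one_mul, Matrix.mul_assoc]
      rw [e1, Matrix.transpose_mul, Matrix.transpose_mul, hN, Matrix.transpose_transpose,
        Matrix.neg_mul, Matrix.mul_neg]
      simp only [Matrix.mul_assoc]
    obtain ⟨R, hR, hR0, hRd, hRm⟩ := exists_lorentz_curve hA
    have hAT : ∀ j α, ContDiffOn ℝ ∞ (fun y => (A * T y) j α) U := fun j α => by
      simp only [Matrix.mul_apply]
      exact ContDiffOn.sum fun k _ => contDiffOn_const.mul (h.smooth k α)
    have hc : ContDiffOn ℝ ∞ (linDensity l T fun y => A * T y) U :=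
      contDiffOn_linDensity h.isOpen h.smooth hAT
    -- The fundamental lemma of the calculus of variations. A test function `φ` is realized by the
    -- family `R (t φ) T`, which keeps the metric, equals `T` off the support of `φ` and has initial
    -- velocity `φ A T`.
    have hae := h.isOpen.ae_eq_zero_of_integral_contDiff_smul_eq_zero
      (μ := MeasureTheory.volume) (hc.continuousOn.locallyIntegrableOn h.isOpen.measurableSet)
      fun φ hφ hφc hφU => by
        have hsm : ∀ j α, ContDiffOn ℝ ∞
            (fun p : ℝ × E4 => (R (p.1 * φ p.2) * T p.2) j α) (Set.univ ×ˢ U) := by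
          intro j α
          simp only [Matrix.mul_apply]
          refine ContDiffOn.sum fun k _ => ContDiffOn.mul ?_ ?_
          · exact ((hR j k).comp (contDiff_fst.mul (hφ.comp contDiff_snd))).contDiffOn
          · exact (h.smooth k α).comp contDiff_snd.contDiffOn fun p hp => hp.2
        have h1 := hst (fun t y => R (t * φ y) * T y) (tsupport φ) hφc hφU ?_ ?_ ?_ ?_
        · have h2 := hasDerivAt_action (l := l) h.isOpen hφc hφU
            (Θ := fun t y => R (t * φ y) * T y) (Q := fun y => φ y • (A * T y)) ?_ ?_ ?_
          · have h3 := h2.unique h1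
            simp only [zero_mul, hR0, Matrix.one_mul] at h3
            rw [← MeasureTheory.setIntegral_eq_integral_of_forall_compl_eq_zero (s := tsupport φ)]
            · rw [← h3]
              refine MeasureTheory.setIntegral_congr_fun hφc.measurableSet fun y _ => ?_
              exact (eulerLagrange_smul l _ _ _ _).symm
            · intro y hy
              rw [image_eq_zero_of_notMem_tsupport hy, zero_smul]
          · exact hsm
          · intro y _ j α
            simp only [Matrix.mul_apply, Matrix.smul_apply, smul_eq_mul, Finset.mul_sum]
            refine HasDerivAt.fun_sum fun k _ => ?_
            have e1 : HasDerivAt (fun t : ℝ => t * φ y) (φ y) 0 := by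
              simpa using (hasDerivAt_id (0 : ℝ)).mul_const (φ y)
            have e2 : HasDerivAt (fun s => R s j k) (A j k) ((fun t : ℝ => t * φ y) 0) := by
              simpa using hRd j k
            have e3 := (e2.comp (0 : ℝ) e1).mul_const (T y k α)
            rw [show φ y * (A j k * T y k α) = A j k * φ y * T y k α by ring]
            exact e3
          · intro y hy
            simp only [image_eq_zero_of_notMem_tsupport hy.2, zero_smul]
        · exact hsm
        · intro t y hy α β
          have e1 : (R (t * φ y) * T y).transpose * mink * (R (t * φ y) * T y) =
              (T y).transpose * mink * T y := by
            rw [Matrix.transpose_mul, Matrix.mul_assoc, Matrix.mul_assoc, ← Matrix.mul_assoc mink,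
              ← Matrix.mul_assoc _ _ (T y), ← Matrix.mul_assoc (R (t * φ y)).transpose, hRm,
              Matrix.mul_assoc]
          have e2 := congrFun (congrFun e1 α) β
          rw [← metric_eq_matrix (h.metric y hy), mink, Matrix.mul_apply] at e2
          rw [← e2]
          simp only [mul_assoc]
          rw [sum_mink fun j k => (R (t * φ y) * T y) j α * (R (t * φ y) * T y) k β]
          refine Finset.sum_congr rfl fun j _ => ?_
          rw [Matrix.mul_diagonal, Matrix.transpose_apply, eta]
          ring
        · intro y _
          simp only [zero_mul, hR0, Matrix.one_mul]
        · intro t y hy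
          simp only [image_eq_zero_of_notMem_tsupport hy.2, mul_zero, hR0, Matrix.one_mul]
    have heq := MeasureTheory.Measure.eqOn_open_of_ae_eq (μ := MeasureTheory.volume)
      (f := linDensity l T fun y => A * T y) (g := fun _ => (0 : ℝ))
      ((MeasureTheory.ae_restrict_iff' h.isOpen.measurableSet).2 hae) h.isOpen hc.continuousOn
      continuousOn_const hy
    rw [hQA]
    exact heq
  · intro hel Θ K hK hKU hΘ hm h0 hc
    have hW : ∀ y ∈ U, ∀ j α, HasDerivAt (fun t => Θ t y j α)
        (fderiv ℝ (fun p : ℝ × E4 => Θ p.1 p.2 j α) (0, y) (1, 0)) 0 := fun y hy j α =>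
      hasDerivAt_family (t := 0) h.isOpen (hΘ j α) hy
    let Q : E4 → Matrix (Fin 4) (Fin 4) ℝ := fun y => Matrix.of fun j α =>
      fderiv ℝ (fun p : ℝ × E4 => Θ p.1 p.2 j α) (0, y) (1, 0)
    have h1 := hasDerivAt_action (l := l) h.isOpen hK hKU hΘ (Q := Q) hW fun y hy => by
      ext j α
      refine (hW y hy.1 j α).unique ?_
      simp only [hc _ y hy]
      exact hasDerivAt_const _ _
    have h2 : ∫ y in K, linDensity l (Θ 0) Q y = 0 := by
      rw [MeasureTheory.setIntegral_congr_fun (g := fun _ => (0 : ℝ)) hK.measurableSet]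
      · simp
      · intro y hy
        have hyU := hKU hy
        have e1 : (fun γ j δ => pd γ (fun z => Θ 0 z j δ) y) =
            fun γ j δ => pd γ (fun z => T z j δ) y := by
          ext γ j δ
          exact pd_congr h.isOpen (fun z hz => by rw [h0 z hz]) hyU γ
        simp only [linDensity, e1, h0 y hyU]
        refine hel y hyU (Q y) fun α β => ?_
        -- Differentiating the constraint that the metric is fixed shows that the velocity of the
        -- family is an infinitesimal Lorentz rotation of the coframe.
        have e2 : HasDerivAt (fun t => ∑ j, eta j * Θ t y j α * Θ t y j β)
            (∑ j, (eta j * Q y j α * Θ 0 y j β + eta j * Θ 0 y j α * Q y j β)) 0 :=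
          HasDerivAt.fun_sum fun j _ =>
            ((hW y hyU j α).const_mul (eta j)).mul (hW y hyU j β)
        have e3 : (fun t => ∑ j, eta j * Θ t y j α * Θ t y j β) = fun _ => G y α β := by
          ext t
          rw [hm t y hyU α β]
          simp only [mul_assoc]
          rw [sum_mink fun j k => Θ t y j α * Θ t y k β]
        rw [e3] at e2
        have e4 := e2.unique (hasDerivAt_const _ _)
        rw [h0 y hyU, Finset.sum_add_distrib] at e4
        have e5 : ∑ j, eta j * Q y j α * T y j β = ∑ j, eta j * T y j β * Q y j α :=
          Finset.sum_congr rfl fun j _ => by ring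
        linarith
    rwa [h2] at h1

theorem IsPatch.isStationary_iff_weyl (h : IsPatch U G T S) (hs : s = 1 ∨ s = -1) (hl0 : l ≠ 0)
    (hpar : ∀ y ∈ U, ∀ α a, spinorCovDeriv G S (weitzenbock T) X y α a = 0)
    (hcur : ∀ y ∈ U, ∀ α, ∑ a, ∑ b, S y α a b * X y a * star (X y b) =
      ((s * ∑ j, l j * T y j α : ℝ) : ℂ)) :
    IsStationary U G l T ↔ ∀ y ∈ U, ∀ b, weylOperator G S X y b = 0 := by
  rw [h.isStationary_iff]
  exact forall₂_congr fun y hy => (h.weyl_iff hy hs hl0 (hpar y hy) (hcur y hy)).symm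

end

section

/-! ### Pauli bases -/

abbrev M2 := Matrix (Fin 2) (Fin 2) ℂ

theorem spinorRaise_eq_adjugate (A : M2) : spinorRaise A = A.adjugate.transpose := by
  rw [spinorRaise_eq, Matrix.adjugate_fin_two]
  ext i j
  fin_cases i <;> fin_cases j <;> rfl

/-- Both sides are the same scalar matrix, the polarization of the determinant. -/
theorem adjugate_clifford_comm (A B : M2) :
    A.adjugate * B + B.adjugate * A = A * B.adjugate + B * A.adjugate := by
  rw [Matrix.adjugate_fin_two, Matrix.adjugate_fin_two]
  ext i j
  fin_cases i <;> fin_cases j <;> simp [Matrix.mul_apply, Fin.sum_univ_two, Matrix.vecMul, dotProduct] <;> ring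

/-- Hermitian matrices that satisfy the Clifford relations of an orthonormal frame. -/
structure IsPauliBasis (R : Fin 4 → M2) : Prop where
  hermitian : ∀ j, (R j).IsHermitian
  clifford : ∀ j k, (R j).adjugate * R k + (R k).adjugate * R j =
    ((2 * mink j k : ℝ) : ℂ) • (1 : M2)

namespace IsPauliBasis
variable {R : Fin 4 → M2} (h : IsPauliBasis R)
include h

theorem det_eq (j : Fin 4) : (R j).det = eta j := by
  have h1 := congrFun (congrFun (h.clifford j j) 0) 0
  rw [Matrix.adjugate_mul, mink_apply, if_pos rfl] at h1
  simp at h1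
  linear_combination h1 / 2

theorem mul_adjugate (j : Fin 4) : R j * (R j).adjugate = (eta j : ℂ) • (1 : M2) := by
  rw [Matrix.mul_adjugate, h.det_eq]

theorem adjugate_mul (j : Fin 4) : (R j).adjugate * R j = (eta j : ℂ) • (1 : M2) := by
  rw [Matrix.adjugate_mul, h.det_eq]

theorem exists_lorentz : ∃ L : Fin 4 → Fin 4 → ℝ, (∀ j, R j = ∑ k, (L j k : ℂ) • pauli k) ∧
    IsLorentz L := by
  choose L hL using fun j => exists_pauli_coords (h.hermitian j)
  refine ⟨L, hL, ?_⟩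
  have h1 : ∀ j k, ∑ a, L j a * (eta a * L k a) = mink j k := by
    intro j k
    have h2 := clifford_pauli_coords (L j) (L k)
    rw [← hL, ← hL, spinorRaise_eq_adjugate, spinorRaise_eq_adjugate, Matrix.transpose_transpose,
      Matrix.transpose_transpose, ← adjugate_clifford_comm, h.clifford] at h2
    simp only [Matrix.smul_apply, Matrix.one_apply_eq, smul_eq_mul, mul_one,
      Complex.ofReal_inj] at h2
    have h3 : ∑ a, L j a * (eta a * L k a) = ∑ a, eta a * L j a * L k a :=
      Finset.sum_congr rfl fun a _ => by ring
    linarith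
  have h2 : Matrix.of L * mink * (Matrix.of L).transpose = mink := by
    ext j k
    rw [← h1 j k, mink, Matrix.mul_apply]
    refine Finset.sum_congr rfl fun a _ => ?_
    rw [Matrix.mul_diagonal, Matrix.transpose_apply, eta]
    simp only [Matrix.of_apply]
    ring
  -- The Clifford relations give orthonormal rows of `L`; orthonormal columns follow because a right
  -- inverse of a square matrix is also a left inverse.
  have h3 : (Matrix.of L).transpose * mink * Matrix.of L = mink := by
    have e1 : (Matrix.of L * mink) * ((Matrix.of L).transpose * mink) = 1 := by
      rw [← Matrix.mul_assoc, h2, mink_mul_mink]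
    have e2 := mul_eq_one_comm.1 e1
    calc (Matrix.of L).transpose * mink * Matrix.of L
        = ((Matrix.of L).transpose * mink) * (Matrix.of L * mink) * mink := by
          simp only [Matrix.mul_assoc, mink_mul_mink, Matrix.mul_one]
      _ = mink := by rw [e2, Matrix.one_mul]
  intro a b
  rw [← mink_apply, ← h3, mink, Matrix.mul_apply]
  refine Finset.sum_congr rfl fun j _ => ?_
  rw [Matrix.mul_diagonal, Matrix.transpose_apply, eta]
  simp only [Matrix.of_apply]
  ring

/-- The sum is invariant under Lorentz changes of the basis, so it may be evaluated on the standard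
Pauli matrices. It kills traceless `Y`, which is its use for connection forms. -/
theorem sum_sandwich (Y : M2) :
    ∑ j, (eta j : ℂ) • ((R j).adjugate * Y * R j) = (2 * Y.trace) • (1 : M2) := by
  obtain ⟨L, hR, hL⟩ := h.exists_lorentz
  have h1 : ∀ j, (eta j : ℂ) • ((R j).adjugate * Y * R j) =
      ∑ a, ∑ b, ((eta j * L j a * L j b : ℝ) : ℂ) • ((pauli a).adjugate * Y * pauli b) := by
    intro j
    have e1 : (R j).adjugate = ∑ k, (L j k : ℂ) • (pauli k).adjugate := by
      rw [hR]
      simp only [Matrix.adjugate_fin_two]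
      ext a b
      fin_cases a <;> fin_cases b <;> simp [Matrix.sum_apply]
    rw [e1, hR, Finset.sum_mul, Finset.sum_mul, Finset.smul_sum]
    refine Finset.sum_congr rfl fun a _ => ?_
    rw [Finset.mul_sum, Finset.smul_sum]
    refine Finset.sum_congr rfl fun b _ => ?_
    simp only [Matrix.smul_mul, Matrix.mul_smul, smul_smul]
    congr 1
    push_cast
    ring
  rw [Finset.sum_congr rfl fun j _ => h1 j, Finset.sum_comm]
  have h2 : ∀ a, ∑ j, ∑ b, ((eta j * L j a * L j b : ℝ) : ℂ) •
      ((pauli a).adjugate * Y * pauli b) = (eta a : ℂ) • ((pauli a).adjugate * Y * pauli a) := by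
    intro a
    rw [Finset.sum_comm]
    simp only [← Finset.sum_smul, ← Complex.ofReal_sum, hL a]
    simp [ite_smul]
  rw [Finset.sum_congr rfl fun a _ => h2 a]
  simp only [Matrix.adjugate_fin_two]
  ext i j
  fin_cases i <;> fin_cases j <;>
    simp [Fin.sum_univ_four, pauli, eta, Matrix.mul_apply, Fin.sum_univ_two, Matrix.trace,
      Matrix.vecMul, dotProduct] <;> ring_nf <;> simp <;> ring

end IsPauliBasis

/-- A matrix that commutes with two anticommuting invertible matrices is scalar. -/
theorem eq_smul_one_of_commute {X a b : M2} (ha : a * a = 1) (hb : b * b = 1)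
    (hab : a * b = -(b * a)) (hXa : X * a = a * X) (hXb : X * b = b * X) :
    X = X 0 0 • (1 : M2) := by
  have hne : a * b - b * a ≠ 0 := by
    intro h0
    have h1 : a * b = 0 := by
      have h2 : (2 : ℂ) • (a * b) = 0 := by
        rw [two_smul]
        nth_rewrite 1 [hab]
        rw [← h0]
        abel
      exact (smul_eq_zero.1 h2).resolve_left two_ne_zero
    have h2 : a * (a * b) * b = 1 := by
      rw [← Matrix.mul_assoc, ha, Matrix.one_mul, hb]
    rw [h1, Matrix.mul_zero, Matrix.zero_mul] at h2
    exact zero_ne_one h2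
  have hent : ∀ c : M2, X * c = c * X → X 0 1 * c 1 0 = c 0 1 * X 1 0 ∧
      (X 0 0 - X 1 1) * c 0 1 = X 0 1 * (c 0 0 - c 1 1) ∧
      (X 0 0 - X 1 1) * c 1 0 = X 1 0 * (c 0 0 - c 1 1) := by
    intro c hc
    have h00 := congrFun (congrFun hc 0) 0
    have h01 := congrFun (congrFun hc 0) 1
    have h10 := congrFun (congrFun hc 1) 0
    simp only [Matrix.mul_apply, Fin.sum_univ_two] at h00 h01 h10
    refine ⟨?_, ?_, ?_⟩
    · linear_combination h00
    · linear_combination h01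
    · linear_combination -h10
  obtain ⟨a1, a2, a3⟩ := hent a hXa
  obtain ⟨b1, b2, b3⟩ := hent b hXb
  -- By the relations of `hent`, each off-diagonal entry of `X` and the difference of its diagonal
  -- entries annihilate the nonzero commutator of `a` and `b`.
  have hz : ∀ w : ℂ, w • (a * b - b * a) = 0 → w = 0 := fun w hw =>
    (smul_eq_zero.1 hw).resolve_right hne
  have e1 : X 0 1 = 0 := by
    refine hz _ ?_
    ext i j
    fin_cases i <;> fin_cases j <;> simp [Matrix.mul_apply, Fin.sum_univ_two] <;> grind
  have e2 : X 1 0 = 0 := by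
    refine hz _ ?_
    ext i j
    fin_cases i <;> fin_cases j <;> simp [Matrix.mul_apply, Fin.sum_univ_two] <;> grind
  have e3 : X 0 0 - X 1 1 = 0 := by
    refine hz _ ?_
    ext i j
    fin_cases i <;> fin_cases j <;> simp [Matrix.mul_apply, Fin.sum_univ_two] <;> grind
  ext i j
  fin_cases i <;> fin_cases j <;> simp [e1, e2]
  linear_combination -e3

end

/-! ### Intertwiners of Pauli bases. -/

section

/-- The sum `1 + ∑ bₖ aₖ` intertwines two representations of the Pauli algebra. -/
theorem intertwining {a1 a2 a3 b1 b2 b3 : M2} {z : ℂ}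
    (ha : a1 * a1 = 1 ∧ a2 * a2 = 1 ∧ a3 * a3 = 1)
    (hb : b1 * b1 = 1 ∧ b2 * b2 = 1 ∧ b3 * b3 = 1)
    (ha' : a2 * a1 = -(a1 * a2) ∧ a3 * a2 = -(a2 * a3) ∧ a1 * a3 = -(a3 * a1))
    (hb' : b2 * b1 = -(b1 * b2) ∧ b3 * b2 = -(b2 * b3) ∧ b1 * b3 = -(b3 * b1))
    (haz : a1 * a2 = z • a3 ∧ a2 * a3 = z • a1 ∧ a3 * a1 = z • a2)
    (hbz : b1 * b2 = z • b3 ∧ b2 * b3 = z • b1 ∧ b3 * b1 = z • b2) :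
    b1 * (1 + b1 * a1 + b2 * a2 + b3 * a3) = (1 + b1 * a1 + b2 * a2 + b3 * a3) * a1 := by
  -- Both sides reduce to `a₁ + b₁ + z (b₃ a₂ - b₂ a₃)`.
  have e1 : b1 * (1 + b1 * a1 + b2 * a2 + b3 * a3) =
      b1 + (b1 * b1) * a1 + (b1 * b2) * a2 + (b1 * b3) * a3 := by noncomm_ring
  have e2 : (1 + b1 * a1 + b2 * a2 + b3 * a3) * a1 =
      a1 + b1 * (a1 * a1) + b2 * (a2 * a1) + b3 * (a3 * a1) := by noncomm_ring
  rw [e1, e2, hb.1, ha.1, hb'.2.2, ha'.1, hbz.1, hbz.2.2, haz.1, haz.2.2]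
  simp only [Matrix.one_mul, Matrix.mul_one, Matrix.neg_mul, Matrix.mul_neg, Matrix.smul_mul,
    Matrix.mul_smul]
  abel

/-- The generator `adj(R₀) R_k` of the even Clifford algebra. -/
def evenGen (R : Fin 4 → M2) (k : Fin 4) : M2 := (R 0).adjugate * R k

/-- The orientation of a Pauli basis. -/
def orientation (R : Fin 4 → M2) : ℂ := (evenGen R 1 * evenGen R 2 * evenGen R 3) 0 0

/-- The matrix that intertwines two Pauli bases up to a factor. -/
def intertwiner (ρ R : Fin 4 → M2) : M2 :=
  1 + evenGen ρ 1 * evenGen R 1 + evenGen ρ 2 * evenGen R 2 + evenGen ρ 3 * evenGen R 3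

namespace IsPauliBasis
variable {R : Fin 4 → M2} (h : IsPauliBasis R)
include h

theorem evenGen_mul {i : Fin 4} (hi : i ≠ 0) (k : Fin 4) :
    evenGen R i * evenGen R k = -((R i).adjugate * R k) := by
  have h1 : R i * (R 0).adjugate = -(R 0 * (R i).adjugate) := by
    rw [eq_neg_iff_add_eq_zero, ← adjugate_clifford_comm, h.clifford, mink_apply, if_neg hi]
    simp
  have h2 := h.adjugate_mul 0
  simp only [eta, Matrix.cons_val_zero, Complex.ofReal_one, one_smul] at h2
  calc evenGen R i * evenGen R k = (R 0).adjugate * (R i * (R 0).adjugate) * R k := by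
        simp only [evenGen, Matrix.mul_assoc]
    _ = -(((R 0).adjugate * R 0) * (R i).adjugate * R k) := by
        rw [h1]
        simp only [Matrix.mul_neg, Matrix.neg_mul, Matrix.mul_assoc]
    _ = _ := by rw [h2, Matrix.one_mul]

theorem evenGen_mul_self {i : Fin 4} (hi : i ≠ 0) : evenGen R i * evenGen R i = 1 := by
  rw [h.evenGen_mul hi, h.adjugate_mul]
  have : eta i = -1 := by fin_cases i <;> simp_all [eta]
  simp [this]

theorem evenGen_anticomm {i k : Fin 4} (hi : i ≠ 0) (hk : k ≠ 0) (hik : i ≠ k) :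
    evenGen R i * evenGen R k = -(evenGen R k * evenGen R i) := by
  rw [h.evenGen_mul hi, h.evenGen_mul hk, neg_neg, neg_eq_iff_add_eq_zero, h.clifford, mink_apply,
    if_neg hik]
  simp

theorem mul_evenGen (k : Fin 4) : R 0 * evenGen R k = R k := by
  have h2 := h.mul_adjugate 0
  simp only [eta, Matrix.cons_val_zero, Complex.ofReal_one, one_smul] at h2
  rw [evenGen, ← Matrix.mul_assoc, h2, Matrix.one_mul]

/-- The product of the three generators commutes with each of the first two, hence is scalar. With
`orientation_mul_self` the scalar is `i` or `-i`, so a continuous family cannot change it locally.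
-/
theorem triple_eq : evenGen R 1 * evenGen R 2 * evenGen R 3 = orientation R • (1 : M2) := by
  have a11 := h.evenGen_mul_self (i := 1) (by decide)
  have a22 := h.evenGen_mul_self (i := 2) (by decide)
  have a12 := h.evenGen_anticomm (i := 1) (k := 2) (by decide) (by decide) (by decide)
  have a13 := h.evenGen_anticomm (i := 1) (k := 3) (by decide) (by decide) (by decide)
  have a23 := h.evenGen_anticomm (i := 2) (k := 3) (by decide) (by decide) (by decide)
  refine eq_smul_one_of_commute a11 a22 a12 ?_ ?_
  · calc evenGen R 1 * evenGen R 2 * evenGen R 3 * evenGen R 1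
        = evenGen R 1 * (evenGen R 2 * (evenGen R 3 * evenGen R 1)) := by
          simp only [Matrix.mul_assoc]
      _ = evenGen R 1 * (-(evenGen R 2 * evenGen R 1) * evenGen R 3) := by
          rw [← neg_eq_iff_eq_neg.2 a13]
          simp only [Matrix.neg_mul, Matrix.mul_neg, Matrix.mul_assoc]
      _ = _ := by
          rw [← a12]
  · calc evenGen R 1 * evenGen R 2 * evenGen R 3 * evenGen R 2
        = evenGen R 1 * evenGen R 2 * (evenGen R 3 * evenGen R 2) := by
          simp only [Matrix.mul_assoc]
      _ = -(evenGen R 1 * evenGen R 2) * (evenGen R 2 * evenGen R 3) := by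
          rw [a23]
          simp only [Matrix.neg_mul, Matrix.mul_neg, neg_neg]
      _ = evenGen R 2 * evenGen R 1 * (evenGen R 2 * evenGen R 3) := by rw [a12, neg_neg]
      _ = _ := by simp only [Matrix.mul_assoc]

theorem even_relations :
    (evenGen R 1 * evenGen R 1 = 1 ∧ evenGen R 2 * evenGen R 2 = 1 ∧
      evenGen R 3 * evenGen R 3 = 1) ∧
    (evenGen R 2 * evenGen R 1 = -(evenGen R 1 * evenGen R 2) ∧
      evenGen R 3 * evenGen R 2 = -(evenGen R 2 * evenGen R 3) ∧
      evenGen R 1 * evenGen R 3 = -(evenGen R 3 * evenGen R 1)) ∧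
    (evenGen R 1 * evenGen R 2 = orientation R • evenGen R 3 ∧
      evenGen R 2 * evenGen R 3 = orientation R • evenGen R 1 ∧
      evenGen R 3 * evenGen R 1 = orientation R • evenGen R 2) := by
  have a11 := h.evenGen_mul_self (i := 1) (by decide)
  have a22 := h.evenGen_mul_self (i := 2) (by decide)
  have a33 := h.evenGen_mul_self (i := 3) (by decide)
  have hz := h.triple_eq
  have e1 : evenGen R 1 * evenGen R 2 = orientation R • evenGen R 3 := by
    have := congrArg (· * evenGen R 3) hz
    simpa only [Matrix.mul_assoc, a33, Matrix.mul_one, Matrix.smul_mul, Matrix.one_mul] using this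
  have e2 : evenGen R 2 * evenGen R 3 = orientation R • evenGen R 1 := by
    have := congrArg (evenGen R 1 * ·) hz
    simpa only [← Matrix.mul_assoc, a11, Matrix.mul_one, Matrix.mul_smul, Matrix.one_mul] using this
  have e3 : evenGen R 3 * evenGen R 1 = orientation R • evenGen R 2 := by
    have h1 : evenGen R 2 * (evenGen R 3 * evenGen R 1) = orientation R • (1 : M2) := by
      rw [← Matrix.mul_assoc, e2, Matrix.smul_mul, a11]
    have := congrArg (evenGen R 2 * ·) h1
    simpa only [← Matrix.mul_assoc, a22, Matrix.mul_one, Matrix.mul_smul, Matrix.one_mul] using this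
  exact ⟨⟨a11, a22, a33⟩, ⟨h.evenGen_anticomm (by decide) (by decide) (by decide),
    h.evenGen_anticomm (by decide) (by decide) (by decide),
    h.evenGen_anticomm (by decide) (by decide) (by decide)⟩, e1, e2, e3⟩

theorem orientation_mul_self : orientation R * orientation R = -1 := by
  obtain ⟨⟨a11, a22, a33⟩, ⟨a21, a32, a13⟩, e1, e2, e3⟩ := h.even_relations
  have h1 : (orientation R * orientation R) • (1 : M2) = -1 := by
    calc (orientation R * orientation R) • (1 : M2)
        = (orientation R • evenGen R 3) * (orientation R • evenGen R 3) := by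
          rw [Matrix.smul_mul, Matrix.mul_smul, a33, smul_smul]
      _ = evenGen R 1 * (evenGen R 2 * evenGen R 1) * evenGen R 2 := by
          rw [← e1]
          simp only [Matrix.mul_assoc]
      _ = -((evenGen R 1 * evenGen R 1) * (evenGen R 2 * evenGen R 2)) := by
          rw [a21]
          simp only [Matrix.neg_mul, Matrix.mul_neg, Matrix.mul_assoc]
      _ = -1 := by rw [a11, a22, Matrix.one_mul]
  have h2 := congrFun (congrFun h1 0) 0
  simpa using h2

theorem intertwiner_self : intertwiner R R = (4 : ℂ) • (1 : M2) := by
  obtain ⟨⟨a11, a22, a33⟩, -, -⟩ := h.even_relations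
  rw [intertwiner, a11, a22, a33]
  module

theorem evenGen_mul_intertwiner {ρ : Fin 4 → M2} (hρ : IsPauliBasis ρ)
    (ho : orientation ρ = orientation R) {k : Fin 4} (hk : k ≠ 0) :
    evenGen ρ k * intertwiner ρ R = intertwiner ρ R * evenGen R k := by
  obtain ⟨⟨a11, a22, a33⟩, ⟨a21, a32, a13⟩, e1, e2, e3⟩ := h.even_relations
  obtain ⟨⟨b11, b22, b33⟩, ⟨b21, b32, b13⟩, f1, f2, f3⟩ := hρ.even_relations
  rw [ho] at f1 f2 f3
  have k1 := intertwining ⟨a11, a22, a33⟩ ⟨b11, b22, b33⟩ ⟨a21, a32, a13⟩ ⟨b21, b32, b13⟩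
    ⟨e1, e2, e3⟩ ⟨f1, f2, f3⟩
  have k2 := intertwining ⟨a22, a33, a11⟩ ⟨b22, b33, b11⟩ ⟨a32, a13, a21⟩ ⟨b32, b13, b21⟩
    ⟨e2, e3, e1⟩ ⟨f2, f3, f1⟩
  have k3 := intertwining ⟨a33, a11, a22⟩ ⟨b33, b11, b22⟩ ⟨a13, a21, a32⟩ ⟨b13, b21, b32⟩
    ⟨e3, e1, e2⟩ ⟨f3, f1, f2⟩
  have s2 : intertwiner ρ R = 1 + evenGen ρ 2 * evenGen R 2 + evenGen ρ 3 * evenGen R 3 +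
      evenGen ρ 1 * evenGen R 1 := by rw [intertwiner]; abel
  have s3 : intertwiner ρ R = 1 + evenGen ρ 3 * evenGen R 3 + evenGen ρ 1 * evenGen R 1 +
      evenGen ρ 2 * evenGen R 2 := by rw [intertwiner]; abel
  fin_cases k
  · exact absurd rfl hk
  · exact k1
  · show evenGen ρ 2 * intertwiner ρ R = intertwiner ρ R * evenGen R 2
    rw [s2]
    exact k2
  · show evenGen ρ 3 * intertwiner ρ R = intertwiner ρ R * evenGen R 3
    rw [s3]
    exact k3

open scoped Matrix in
/-- Two Pauli bases of the same orientation are related by the intertwiner. -/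
theorem exists_conj_eq {ρ : Fin 4 → M2} (hρ : IsPauliBasis ρ)
    (ho : orientation ρ = orientation R) : ∃ μ : ℂ, ∀ k,
      (intertwiner ρ R)ᴴ * ρ k * intertwiner ρ R = μ • R k := by
  set C := intertwiner ρ R with hC
  set H := Cᴴ * ρ 0 * C with hH
  have hHk : ∀ k, k ≠ 0 → H * evenGen R k = Cᴴ * ρ k * C := by
    intro k hk
    rw [hH, Matrix.mul_assoc, ← h.evenGen_mul_intertwiner hρ ho hk, ← Matrix.mul_assoc,
      Matrix.mul_assoc _ (ρ 0), hρ.mul_evenGen]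
  have hherm : ∀ k, (Cᴴ * ρ k * C)ᴴ = Cᴴ * ρ k * C := by
    intro k
    rw [Matrix.conjTranspose_mul, Matrix.conjTranspose_mul, Matrix.conjTranspose_conjTranspose,
      (hρ.hermitian k).eq, Matrix.mul_assoc]
  have hadj : ((R 0).adjugate)ᴴ = (R 0).adjugate := by
    rw [Matrix.adjugate_conjTranspose, (h.hermitian 0).eq]
  -- `H * evenGen R k` is a congruence of `ρ k`, hence Hermitian; comparison with its adjoint makes
  -- `adj(R₀) H` commute with the generators, so it is a scalar.
  have hcomm : ∀ k, k ≠ 0 → ((R 0).adjugate * H) * evenGen R k =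
      evenGen R k * ((R 0).adjugate * H) := by
    intro k hk
    have e1 : H * evenGen R k = R k * (R 0).adjugate * H := by
      have e2 := hherm k
      rw [← hHk k hk, Matrix.conjTranspose_mul, evenGen, Matrix.conjTranspose_mul, hadj,
        (h.hermitian k).eq, hherm 0] at e2
      rw [evenGen]
      exact e2.symm
    rw [Matrix.mul_assoc, e1, evenGen]
    simp only [Matrix.mul_assoc]
  obtain ⟨⟨a11, a22, -⟩, ⟨a21, -, -⟩, -⟩ := h.even_relations
  have hs := eq_smul_one_of_commute a11 a22 (by rw [a21, neg_neg]) (hcomm 1 (by decide))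
    (hcomm 2 (by decide))
  set μ := ((R 0).adjugate * H) 0 0
  have hHμ : H = μ • R 0 := by
    have h2 := h.mul_adjugate 0
    simp only [eta, Matrix.cons_val_zero, Complex.ofReal_one, one_smul] at h2
    have h3 := congrArg (R 0 * ·) hs
    simpa only [← Matrix.mul_assoc, h2, Matrix.one_mul, Matrix.mul_smul, Matrix.mul_one] using h3
  refine ⟨μ, fun k => ?_⟩
  by_cases hk : k = 0
  · rw [hk]
    exact hHμ
  · rw [← hHk k hk, hHμ, Matrix.smul_mul, h.mul_evenGen]

open scoped Matrix in
-- By `exists_conj_eq` the two sides differ by a common scalar. Determinants force its square to be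
-- `1`, and the two positive traces exclude `-1`.
theorem conj_eq {ρ : Fin 4 → M2} (hρ : IsPauliBasis ρ) (ho : orientation ρ = orientation R)
    {f : ℂ} (hf : f * f * (intertwiner ρ R).det = 1)
    (hpos : 0 < ((ρ 0).adjugate * R 0).trace.re)
    (hpos' : 0 < ((ρ 0).adjugate * ((f • intertwiner ρ R)ᴴ * ρ 0 * (f • intertwiner ρ R))).trace.re)
    (k : Fin 4) : (f • intertwiner ρ R)ᴴ * ρ k * (f • intertwiner ρ R) = R k := by
  obtain ⟨μ, hμ⟩ := h.exists_conj_eq hρ ho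
  have hν : ∀ k, (f • intertwiner ρ R)ᴴ * ρ k * (f • intertwiner ρ R) =
      (star f * f * μ) • R k := by
    intro k
    rw [Matrix.conjTranspose_smul, Matrix.smul_mul, Matrix.smul_mul, Matrix.mul_smul, hμ,
      smul_smul, smul_smul]
  set ν := star f * f * μ
  have hdet : (f • intertwiner ρ R).det = 1 := by
    rw [Matrix.det_smul, Fintype.card_fin, pow_two, hf]
  have h0 : ∀ {R : Fin 4 → M2}, IsPauliBasis R → (R 0).det = 1 := fun h => by
    rw [h.det_eq]
    simp [eta]
  have hν2 : ν ^ 2 = 1 := by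
    have e := congrArg Matrix.det (hν 0)
    rw [Matrix.det_mul, Matrix.det_mul, Matrix.det_conjTranspose, hdet, h0 hρ, Matrix.det_smul,
      h0 h, Fintype.card_fin] at e
    simpa using e.symm
  rcases mul_self_eq_one_iff.1 ((pow_two ν).symm.trans hν2) with hν1 | hν1
  · rw [hν, hν1, one_smul]
  · rw [hν, hν1, Matrix.mul_smul, Matrix.trace_smul] at hpos'
    simp at hpos'
    linarith

end IsPauliBasis

/-! ### Null covectors as currents of spinors. -/

/-- A Hermitian matrix of rank at most one. -/
theorem exists_rank_one {H : M2} (hH : H.IsHermitian) (hdet : H.det = 0) :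
    ∃ (s : ℝ) (κ : Fin 2 → ℂ), (s = 1 ∨ s = -1) ∧ ∀ a b, H a b = s * (κ a * star (κ b)) := by
  have hsign : ∀ p : ℝ, ∃ s : ℝ, (s = 1 ∨ s = -1) ∧ s * |p| = p := by
    intro p
    rcases abs_cases p with ⟨h1, -⟩ | ⟨h1, -⟩
    · exact ⟨1, Or.inl rfl, by rw [h1, one_mul]⟩
    · exact ⟨-1, Or.inr rfl, by rw [h1]; ring⟩
  have hre : ∀ a, ((H a a).re : ℂ) = H a a := fun a => Complex.conj_eq_iff_re.1 (hH.apply a a)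
  obtain ⟨p, hp⟩ : ∃ p : ℝ, H 0 0 = p := ⟨_, (hre 0).symm⟩
  obtain ⟨q, hq⟩ : ∃ q : ℝ, H 1 1 = q := ⟨_, (hre 1).symm⟩
  have h10 : star (H 1 0) = H 0 1 := hH.apply 0 1
  rw [Matrix.det_fin_two, hp, hq, ← h10] at hdet
  by_cases hp0 : p = 0
  · have hz : H 1 0 = 0 := by
      rw [hp0, Complex.ofReal_zero, zero_mul] at hdet
      have h1 : star (H 1 0) * H 1 0 = 0 := by
        linear_combination -hdet
      rcases mul_eq_zero.1 h1 with h2 | h2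
      · exact star_eq_zero.1 h2
      · exact h2
    obtain ⟨s, hs, hsq⟩ := hsign q
    have hsqrt : ((Real.sqrt |q| : ℝ) : ℂ) * (Real.sqrt |q| : ℝ) = (|q| : ℝ) := by
      rw [← Complex.ofReal_mul, Real.mul_self_sqrt (abs_nonneg q)]
    refine ⟨s, ![0, (Real.sqrt |q| : ℝ)], hs, ?_⟩
    intro a b
    fin_cases a <;> fin_cases b
    · simp [hp, hp0]
    · simp [← h10, hz]
    · simp [hz]
    · simp only [Fin.mk_one, Matrix.cons_val_one, hq, Matrix.cons_val_fin_one,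
        Complex.star_def, Complex.conj_ofReal, hsqrt]
      rw [← Complex.ofReal_mul, hsq]
  · obtain ⟨s, hs, hsp⟩ := hsign p
    have hss : (s : ℂ) * s = 1 := by
      rcases hs with rfl | rfl <;> simp
    have hsqrt : ((Real.sqrt |p| : ℝ) : ℂ) * (Real.sqrt |p| : ℝ) = (|p| : ℝ) := by
      rw [← Complex.ofReal_mul, Real.mul_self_sqrt (abs_nonneg p)]
    have hr0 : ((Real.sqrt |p| : ℝ) : ℂ) ≠ 0 := by
      rw [Complex.ofReal_ne_zero]
      exact (Real.sqrt_pos.2 (abs_pos.2 hp0)).ne'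
    have hsp' : (s : ℂ) * (|p| : ℝ) = p := by rw [← Complex.ofReal_mul, hsp]
    set r : ℂ := ((Real.sqrt |p| : ℝ) : ℂ) with hr
    have hrstar : star r = r := Complex.conj_ofReal _
    have hsstar : star (s : ℂ) = s := Complex.conj_ofReal _
    -- The first column of `H` determines the vector: `r² = |p|`, and `s` is the sign of `p`. The
    -- last diagonal entry is then fixed by the vanishing determinant.
    refine ⟨s, ![r, s * H 1 0 / r], hs, ?_⟩
    intro a b
    fin_cases a <;> fin_cases b
    · show H 0 0 = s * (r * star r)
      rw [hrstar, hsqrt, hsp', hp]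
    · show H 0 1 = s * (r * star (s * H 1 0 / r))
      rw [star_div₀, star_mul', hrstar, hsstar, h10]
      field_simp
      linear_combination (-H 0 1) * hss
    · show H 1 0 = s * (s * H 1 0 / r * star r)
      rw [hrstar]
      field_simp
      linear_combination (-H 1 0) * hss
    · show H 1 1 = s * (s * H 1 0 / r * star (s * H 1 0 / r))
      rw [star_div₀, star_mul', hrstar, hsstar, hq]
      have h1 : (r * r) * (s * (s * H 1 0 / r * (s * star (H 1 0) / r))) = (r * r) * q := by
        field_simp
        rw [pow_two, hsqrt]
        linear_combination (s * H 1 0 * star (H 1 0) + (|p| : ℝ) * q) * hss - (s : ℂ) * hdet - (s * q) * hsp'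
      exact (mul_left_cancel₀ (mul_ne_zero hr0 hr0) h1).symm

theorem trace_adjugate_mul_comm (A B : M2) : (B.adjugate * A).trace = (A.adjugate * B).trace := by
  simp [Matrix.adjugate_fin_two, Matrix.trace, Fin.sum_univ_two, Matrix.vecMul, dotProduct]
  ring

theorem IsPauliBasis.trace_adjugate_mul {R : Fin 4 → M2} (h : IsPauliBasis R) (j k : Fin 4) :
    ((R j).adjugate * R k).trace = ((2 * mink j k : ℝ) : ℂ) := by
  have h1 := congrArg Matrix.trace (h.clifford j k)
  rw [Matrix.trace_add, trace_adjugate_mul_comm (R j) (R k), Matrix.trace_smul, Matrix.trace_one,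
    Fintype.card_fin, smul_eq_mul] at h1
  push_cast at h1 ⊢
  linear_combination h1 / 2

/-- Every null covector is the current of a spinor. -/
theorem IsPauliBasis.exists_spinor {R : Fin 4 → M2} (h : IsPauliBasis R) {l : Fin 4 → ℝ}
    (hl : ∑ j, ∑ k, mink j k * l j * l k = 0) :
    ∃ (s : ℝ) (κ : Fin 2 → ℂ), (s = 1 ∨ s = -1) ∧
      ∀ j, ∑ a, ∑ b, R j b a * κ a * star (κ b) = ((s * l j : ℝ) : ℂ) := by
  -- The coefficients are dual to `l`: since the trace of `adj(R_j) R_k` is `2 η_{jk}`, the trace of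
  -- `H R_j` is `l_j`. Nullity of `l` makes the determinant of `H` vanish, so that `H` is `s κ κ*`.
  set u : Fin 4 → ℝ := fun j => eta j * l j / 2 with hu
  set H : M2 := ∑ j, (u j : ℂ) • (R j).adjugate with hH
  have hadj : H.adjugate = ∑ j, (u j : ℂ) • R j := by
    rw [hH]
    simp only [Matrix.adjugate_fin_two]
    ext a b
    fin_cases a <;> fin_cases b <;> simp [Matrix.sum_apply]
  have hherm : H.IsHermitian := by
    unfold Matrix.IsHermitian
    rw [hH, Matrix.conjTranspose_sum]
    refine Finset.sum_congr rfl fun j _ => ?_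
    rw [Matrix.conjTranspose_smul, Matrix.adjugate_conjTranspose, (h.hermitian j).eq,
      Complex.star_def, Complex.conj_ofReal]
  have hdet : H.det = 0 := by
    have h1 : H * H.adjugate + H * H.adjugate = 0 := by
      have e1 : H * H.adjugate = ∑ j, ∑ k, ((u j * u k : ℝ) : ℂ) • ((R j).adjugate * R k) := by
        rw [hadj, hH, Finset.sum_mul]
        refine Finset.sum_congr rfl fun j _ => ?_
        rw [Finset.mul_sum]
        refine Finset.sum_congr rfl fun k _ => ?_
        rw [Matrix.smul_mul, Matrix.mul_smul, smul_smul, Complex.ofReal_mul]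
      have e2 : H * H.adjugate = ∑ j, ∑ k, ((u j * u k : ℝ) : ℂ) • ((R k).adjugate * R j) := by
        rw [e1, Finset.sum_comm]
        refine Finset.sum_congr rfl fun j _ => Finset.sum_congr rfl fun k _ => ?_
        rw [mul_comm (u k)]
      nth_rewrite 1 [e1]
      rw [e2]
      simp only [← Finset.sum_add_distrib, ← smul_add, h.clifford, smul_smul, ← Finset.sum_smul,
        ← Complex.ofReal_mul, ← Complex.ofReal_sum]
      have e3 : ∑ j, ∑ k, u j * u k * (2 * mink j k) = 0 := by
        have e4 : ∀ j k, u j * u k * (2 * mink j k) = (1 / 2) * (mink j k * l j * l k) := by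
          intro j k
          rw [mink_apply]
          split_ifs with hjk
          · subst hjk
            rw [hu]
            have := eta_mul_eta j
            linear_combination (eta j * l j * l j / 2) * this
          · ring
        simp only [e4, ← Finset.mul_sum, hl, mul_zero]
      rw [e3, Complex.ofReal_zero, zero_smul]
    rw [Matrix.mul_adjugate] at h1
    have h2 := congrFun (congrFun h1 0) 0
    simp at h2
    exact h2
  obtain ⟨s, κ, hs, hκ⟩ := exists_rank_one hherm hdet
  refine ⟨s, κ, hs, fun j => ?_⟩
  have hss : (s : ℂ) * s = 1 := by rcases hs with rfl | rfl <;> simp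
  have h1 : (H * R j).trace = l j := by
    rw [hH, Finset.sum_mul, Matrix.trace_sum]
    simp only [Matrix.smul_mul, Matrix.trace_smul, h.trace_adjugate_mul, smul_eq_mul,
      ← Complex.ofReal_mul, ← Complex.ofReal_sum]
    congr 1
    rw [Finset.sum_eq_single j]
    · rw [mink_apply, if_pos rfl, hu]
      linear_combination (l j) * eta_mul_eta j
    · intro k _ hk
      rw [mink_apply, if_neg hk]
      ring
    · simp
  have h2 : ∀ a b, κ a * star (κ b) = s * H a b := by
    intro a b
    rw [hκ]
    linear_combination (-κ a * star (κ b)) * hss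
  rw [Complex.ofReal_mul, ← h1, Matrix.trace, Finset.mul_sum]
  refine Finset.sum_congr rfl fun a _ => ?_
  rw [Matrix.diag_apply, Matrix.mul_apply, Finset.mul_sum]
  refine Finset.sum_congr rfl fun b _ => ?_
  rw [mul_assoc, h2]
  ring

end

section

/-! ### Smooth matrices -/

theorem contDiffOn_det {n : ℕ} {A : E4 → Matrix (Fin n) (Fin n) ℝ} {U : Set E4}
    (h : ∀ i j, ContDiffOn ℝ ∞ (fun y => A y i j) U) :
    ContDiffOn ℝ ∞ (fun y => (A y).det) U := by
  simp only [Matrix.det_apply']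
  exact ContDiffOn.sum fun τ _ => contDiffOn_const.mul (contDiffOn_prod fun i _ => h _ _)

theorem contDiffOn_inv {n : ℕ} {A : E4 → Matrix (Fin n) (Fin n) ℝ} {U : Set E4}
    (h : ∀ i j, ContDiffOn ℝ ∞ (fun y => A y i j) U) (hA : ∀ y ∈ U, IsUnit (A y).det)
    (i j : Fin n) : ContDiffOn ℝ ∞ (fun y => (A y)⁻¹ i j) U := by
  have h1 : ∀ y, (A y)⁻¹ i j = (A y).det⁻¹ * ((A y).updateRow j (Pi.single i 1)).det := by
    intro y
    rw [Matrix.inv_def, Ring.inverse_eq_inv', Matrix.smul_apply, Matrix.adjugate_apply, smul_eq_mul]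
  simp only [h1]
  refine ((contDiffOn_det h).inv fun y hy => (hA y hy).ne_zero).mul (contDiffOn_det fun k m => ?_)
  by_cases hk : k = j
  · subst hk
    simp only [Matrix.updateRow_self]
    exact contDiffOn_const
  · simp only [Matrix.updateRow_ne hk]
    exact h k m

/-- The partial derivative of a matrix of functions. -/
def pdMatrix (α : Fin 4) (A : E4 → M2) (y : E4) : M2 :=
  Matrix.of fun a b => pd α (fun z => A z a b) y

/-- Entrywise differentiability. -/
def MatDiffAt (A : E4 → M2) (y : E4) : Prop :=
  ∀ a b, DifferentiableAt ℝ (fun z => A z a b) y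

section matrix
variable {A B : E4 → M2} {y : E4}

theorem MatDiffAt.mul (hA : MatDiffAt A y) (hB : MatDiffAt B y) :
    MatDiffAt (fun z => A z * B z) y := by
  intro a b
  simp only [Matrix.mul_apply]
  exact DifferentiableAt.fun_sum fun c _ => (hA a c).mul (hB c b)

theorem matDiffAt_const (A : M2) : MatDiffAt (fun _ => A) y := fun _ _ => differentiableAt_const _

open scoped Matrix in
theorem MatDiffAt.conjTranspose (hA : MatDiffAt A y) : MatDiffAt (fun z => (A z)ᴴ) y :=
  fun a b => (hA b a).star

theorem MatDiffAt.adjugate (hA : MatDiffAt A y) : MatDiffAt (fun z => (A z).adjugate) y := by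
  intro a b
  simp only [Matrix.adjugate_fin_two]
  fin_cases a <;> fin_cases b
  · exact hA 1 1
  · exact (hA 0 1).neg
  · exact (hA 1 0).neg
  · exact hA 0 0

theorem pdMatrix_mul (hA : MatDiffAt A y) (hB : MatDiffAt B y) (α : Fin 4) :
    pdMatrix α (fun z => A z * B z) y = pdMatrix α A y * B y + A y * pdMatrix α B y := by
  ext a b
  rw [pdMatrix, Matrix.of_apply, Matrix.add_apply, Matrix.mul_apply, Matrix.mul_apply,
    ← Finset.sum_add_distrib]
  simp only [Matrix.mul_apply]
  rw [pd_sum _ fun c _ => (hA a c).fun_mul (hB c b)]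
  exact Finset.sum_congr rfl fun c _ => pd_mul (hA a c) (hB c b) α

theorem pd_const {F : Type*} [NormedAddCommGroup F] [NormedSpace ℝ F] (c : F) (α : Fin 4) :
    pd α (fun _ => c) y = 0 := by
  simp [pd]

theorem pdMatrix_const (A : M2) (α : Fin 4) : pdMatrix α (fun _ => A) y = 0 := by
  ext a b
  exact pd_const _ _

theorem pdMatrix_congr {U : Set E4} (hU : IsOpen U) (h : ∀ z ∈ U, A z = B z) (hy : y ∈ U)
    (α : Fin 4) : pdMatrix α A y = pdMatrix α B y := by
  ext a b
  exact pd_congr hU (fun z hz => by rw [h z hz]) hy α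

/-- Jacobi's formula for a matrix of constant determinant. -/
theorem trace_adjugate_mul_pdMatrix {U : Set E4} (hU : IsOpen U) {d : ℂ}
    (h : ∀ z ∈ U, (A z).det = d) (hA : MatDiffAt A y) (hy : y ∈ U) (α : Fin 4) :
    ((A y).adjugate * pdMatrix α A y).trace = 0 := by
  have h1 := pd_congr hU h hy α
  simp only [Matrix.det_fin_two] at h1
  rw [pd_const] at h1
  have h2 : pd α (fun z => A z 0 0 * A z 1 1 - A z 0 1 * A z 1 0) y =
      pd α (fun z => A z 0 0 * A z 1 1) y - pd α (fun z => A z 0 1 * A z 1 0) y := by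
    rw [pd, fderiv_fun_sub ((hA 0 0).fun_mul (hA 1 1)) ((hA 0 1).fun_mul (hA 1 0))]
    rfl
  rw [h2, pd_mul (hA 0 0) (hA 1 1), pd_mul (hA 0 1) (hA 1 0)] at h1
  rw [Matrix.trace_fin_two, Matrix.mul_apply, Matrix.mul_apply, Matrix.adjugate_fin_two]
  simp [Fin.sum_univ_two, pdMatrix]
  linear_combination h1

end matrix

/-! ### The Weitzenböck derivative of a spinor field -/

variable {U : Set E4} {G T : E4 → Matrix (Fin 4) (Fin 4) ℝ}
  {S : E4 → Fin 4 → Matrix (Fin 2) (Fin 2) ℂ} {y : E4}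

theorem sum_mul_sum_inv_mul {A : Matrix (Fin 4) (Fin 4) ℝ} (hA : IsUnit A.det) (v : Fin 4 → ℂ)
    (k : Fin 4) : ∑ β, (A k β : ℂ) * ∑ j, ((A⁻¹ β j : ℝ) : ℂ) * v j = v k := by
  have := sum_frame_mul (mul_inv_ofReal hA) (Pi.single k 1) v
  simpa [Pi.single_apply] using this

theorem IsPatch.sum_mul_sigmaUp (h : IsPatch U G T S) {R : E4 → Fin 4 → M2}
    (hR : ∀ y ∈ U, ∀ α a b, S y α a b = ∑ j, (T y j α : ℂ) * R y j b a) (hy : y ∈ U)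
    (k : Fin 4) (a b : Fin 2) :
    ∑ β, (T y k β : ℂ) * sigmaUp G S y β a b = (eta k : ℂ) * R y k b a := by
  have h1 : ∀ β, sigmaUp G S y β a b = ∑ j, (((T y)⁻¹ β j : ℝ) : ℂ) * ((eta j : ℂ) * R y j b a) := by
    intro β
    rw [sigmaUp]
    simp only [hR y hy, Finset.mul_sum]
    rw [Finset.sum_comm]
    refine Finset.sum_congr rfl fun j _ => ?_
    rw [← mul_assoc, ← Complex.ofReal_mul, ← inv_metric_mul (h.unit y hy) (h.metric y hy),
      Complex.ofReal_sum, Finset.sum_mul]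
    refine Finset.sum_congr rfl fun γ _ => ?_
    push_cast
    ring
  simp only [h1]
  exact sum_mul_sum_inv_mul (h.unit y hy) (fun j => (eta j : ℂ) * R y j b a) k

theorem IsPatch.smooth_metric (h : IsPatch U G T S) (α β : Fin 4) :
    ContDiffOn ℝ ∞ (fun y => G y α β) U :=
  (ContDiffOn.sum fun j _ => (contDiffOn_const.mul (h.smooth j α)).mul (h.smooth j β)).congr
    fun y hy => h.metric y hy α β

theorem _root_.ContDiffOn.complex_ofReal {f : E4 → ℝ} (h : ContDiffOn ℝ ∞ f U) :
    ContDiffOn ℝ ∞ (fun y => (f y : ℂ)) U :=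
  Complex.ofRealCLM.contDiff.comp_contDiffOn h

theorem IsPatch.smooth_sigmaUp (h : IsPatch U G T S) (β : Fin 4) (a b : Fin 2) :
    ContDiffOn ℝ ∞ (fun y => sigmaUp G S y β a b) U :=
  ContDiffOn.sum fun γ _ => (contDiffOn_inv h.smooth_metric (fun _ hy => h.isUnit_det hy)
    β γ).complex_ofReal.mul (h.smoothPauli γ a b)

theorem pd_ofReal {f : E4 → ℝ} (hf : DifferentiableAt ℝ f y) (α : Fin 4) :
    pd α (fun z => (f z : ℂ)) y = ((pd α f y : ℝ) : ℂ) := by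
  have := (Complex.ofRealCLM.hasFDerivAt.comp y hf.hasFDerivAt).fderiv
  rw [pd, pd]
  exact congrArg (fun D : E4 →L[ℝ] ℂ => D (EuclideanSpace.single α 1)) this

/-- In terms of the frame components `R` of the Pauli matrices the connection form of the
Weitzenböck derivative is `¼ adj(R) dR`. -/
theorem IsPatch.spinorCovDeriv_weitzenbock (h : IsPatch U G T S) {R : E4 → Fin 4 → M2}
    (hR : ∀ y ∈ U, ∀ α a b, S y α a b = ∑ j, (T y j α : ℂ) * R y j b a) (hy : y ∈ U)
    (hRd : ∀ j, MatDiffAt (fun z => R z j) y) (X : E4 → Fin 2 → ℂ) (α : Fin 4) (a : Fin 2) :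
    spinorCovDeriv G S (weitzenbock T) X y α a = pd α (fun z => X z a) y +
      (1 / 4) * ∑ b, (∑ k, (eta k : ℂ) • ((R y k).adjugate * pdMatrix α (fun z => R z k) y)) a b *
        X y b := by
  rw [spinorCovDeriv]
  congr 2
  refine Finset.sum_congr rfl fun b _ => ?_
  congr 1
  have hsU : ∀ β c, DifferentiableAt ℝ (fun z => sigmaUp G S z β b c) y := fun β c =>
    ContDiffOn.differentiableAt_of_mem (h.smooth_sigmaUp β b c) h.isOpen hy
  have hT : ∀ k β, DifferentiableAt ℝ (fun z => (T z k β : ℂ)) y := fun k β =>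
    ContDiffOn.differentiableAt_of_mem (h.smooth k β).complex_ofReal h.isOpen hy
  have h1 : ∀ β c, spinorRaise (S y β) a c = ∑ k, (T y k β : ℂ) * (R y k).adjugate a c := by
    intro β c
    have e : S y β = Matrix.of fun a b => ∑ k, (T y k β : ℂ) * (R y k).transpose a b := by
      ext a b
      exact hR y hy β a b
    rw [e, spinorRaise_sum (fun k => (T y k β : ℂ)) (fun k => (R y k).transpose)]
    refine Finset.sum_congr rfl fun k _ => ?_
    rw [spinorRaise_eq_adjugate, ← Matrix.adjugate_transpose, Matrix.transpose_transpose]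
  -- The coframe is parallel for the Weitzenböck connection, so the covariant derivative of `σ`,
  -- contracted with the coframe, is the plain derivative of the components `R`.
  have h2 : ∀ k c, ∑ β, (T y k β : ℂ) * (pd α (fun z => sigmaUp G S z β b c) y +
      ∑ γ, (weitzenbock T y β α γ : ℂ) * sigmaUp G S y γ b c) =
      (eta k : ℂ) * pd α (fun z => R z k c b) y := by
    intro k c
    have e1 : pd α (fun z => ∑ β, (T z k β : ℂ) * sigmaUp G S z β b c) y =
        (eta k : ℂ) * pd α (fun z => R z k c b) y := by
      rw [pd_congr h.isOpen (fun z hz => h.sum_mul_sigmaUp hR hz k b c) hy,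
        pd_mul (differentiableAt_const _) (hRd k c b), pd_const, zero_mul, zero_add]
    rw [← e1, pd_sum _ fun β _ => (hT k β).fun_mul (hsU β c)]
    have e2 : ∀ β, pd α (fun z => (T z k β : ℂ) * sigmaUp G S z β b c) y =
        ((pd α (fun z => T z k β) y : ℝ) : ℂ) * sigmaUp G S y β b c +
          (T y k β : ℂ) * pd α (fun z => sigmaUp G S z β b c) y := by
      intro β
      rw [pd_mul (hT k β) (hsU β c), pd_ofReal (h.diff hy k β)]
    simp only [e2, mul_add, Finset.sum_add_distrib]
    rw [add_comm]
    congr 1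
    rw [sum_mul_sum_assoc (fun β => (T y k β : ℂ)) (fun β γ => (weitzenbock T y β α γ : ℂ))]
    refine Finset.sum_congr rfl fun γ _ => ?_
    rw [← h.sum_mul_weitzenbock hy k α γ]
    push_cast
    rfl
  simp only [h1, Finset.sum_mul]
  have h3 : ∀ β, ∑ c, ∑ k, (T y k β : ℂ) * (R y k).adjugate a c *
      (pd α (fun z => sigmaUp G S z β b c) y +
        ∑ γ, (weitzenbock T y β α γ : ℂ) * sigmaUp G S y γ b c) =
      ∑ k, ∑ c, (R y k).adjugate a c * ((T y k β : ℂ) *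
      (pd α (fun z => sigmaUp G S z β b c) y +
        ∑ γ, (weitzenbock T y β α γ : ℂ) * sigmaUp G S y γ b c)) := by
    intro β
    rw [Finset.sum_comm]
    exact Finset.sum_congr rfl fun k _ => Finset.sum_congr rfl fun c _ => by ring
  rw [Finset.sum_congr rfl fun β _ => h3 β, Finset.sum_comm, Matrix.sum_apply]
  refine Finset.sum_congr rfl fun k _ => ?_
  rw [Finset.sum_comm, Matrix.smul_apply, Matrix.mul_apply, smul_eq_mul, Finset.mul_sum]
  refine Finset.sum_congr rfl fun c _ => ?_
  rw [← Finset.mul_sum, h2]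
  simp only [pdMatrix, Matrix.of_apply]
  ring

open scoped Matrix in
-- The product rule gives two terms. The one with `dc*` is a sandwich of `adj(c*) dc*`, which is
-- traceless as the determinant is constant, and is killed by `sum_sandwich`. The other collects `∑
-- η_k adj(ρ_k) ρ_k = 4`, which cancels the `¼` of the connection form.
theorem IsPauliBasis.sum_adjugate_mul_pdMatrix {ρ : Fin 4 → M2} (hρ : IsPauliBasis ρ)
    (hU : IsOpen U) {c : E4 → M2} (hc : ∀ z ∈ U, (c z).det = 1) (hy : y ∈ U)
    (hcd : MatDiffAt c y) (α : Fin 4) :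
    ∑ k, (eta k : ℂ) • (((c y)ᴴ * ρ k * c y).adjugate *
      pdMatrix α (fun z => (c z)ᴴ * ρ k * c z) y) =
      (4 : ℂ) • ((c y).adjugate * pdMatrix α c y) := by
  have hdH : ∀ z ∈ U, ((c z)ᴴ).det = 1 := fun z hz => by
    rw [Matrix.det_conjTranspose, hc z hz, star_one]
  have a1 : ((c y)ᴴ).adjugate * (c y)ᴴ = 1 := by rw [Matrix.adjugate_mul, hdH y hy, one_smul]
  have a2 : (c y).adjugate * c y = 1 := by rw [Matrix.adjugate_mul, hc y hy, one_smul]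
  have h1 : ∀ k, ((c y)ᴴ * ρ k * c y).adjugate * pdMatrix α (fun z => (c z)ᴴ * ρ k * c z) y =
      (c y).adjugate * ((ρ k).adjugate * (((c y)ᴴ).adjugate * pdMatrix α (fun z => (c z)ᴴ) y) *
        ρ k) * c y + (c y).adjugate * ((ρ k).adjugate * ρ k) * pdMatrix α c y := by
    intro k
    rw [pdMatrix_mul (hcd.conjTranspose.mul (matDiffAt_const _)) hcd,
      pdMatrix_mul hcd.conjTranspose (matDiffAt_const _), pdMatrix_const, Matrix.mul_zero, add_zero,
      Matrix.adjugate_mul_distrib, Matrix.adjugate_mul_distrib, Matrix.mul_add]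
    refine congrArg₂ (· + ·) ?_ ?_
    · simp only [Matrix.mul_assoc]
    · calc (c y).adjugate * ((ρ k).adjugate * ((c y)ᴴ).adjugate) * ((c y)ᴴ * ρ k * pdMatrix α c y)
          = (c y).adjugate * (ρ k).adjugate * (((c y)ᴴ).adjugate * (c y)ᴴ) * ρ k *
              pdMatrix α c y := by simp only [Matrix.mul_assoc]
        _ = _ := by rw [a1, Matrix.mul_one]; simp only [Matrix.mul_assoc]
  have h2 := hρ.sum_sandwich (((c y)ᴴ).adjugate * pdMatrix α (fun z => (c z)ᴴ) y)
  rw [trace_adjugate_mul_pdMatrix hU hdH hcd.conjTranspose hy, mul_zero, zero_smul] at h2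
  have h3 := hρ.sum_sandwich 1
  simp only [Matrix.mul_one, Matrix.trace_one, Fintype.card_fin] at h3
  have h4 : ∀ k, (eta k : ℂ) • (((c y)ᴴ * ρ k * c y).adjugate *
      pdMatrix α (fun z => (c z)ᴴ * ρ k * c z) y) =
      (c y).adjugate * ((eta k : ℂ) • ((ρ k).adjugate * (((c y)ᴴ).adjugate *
        pdMatrix α (fun z => (c z)ᴴ) y) * ρ k)) * c y +
      (c y).adjugate * ((eta k : ℂ) • ((ρ k).adjugate * ρ k)) * pdMatrix α c y := by
    intro k
    rw [h1, smul_add]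
    simp only [Matrix.smul_mul, Matrix.mul_smul]
  rw [Finset.sum_congr rfl fun k _ => h4 k, Finset.sum_add_distrib, ← Finset.sum_mul,
    ← Finset.mul_sum, ← Finset.sum_mul, ← Finset.mul_sum, h2, h3, Matrix.mul_zero, Matrix.zero_mul,
    zero_add, Matrix.mul_smul, Matrix.mul_one, Matrix.smul_mul]
  norm_num

open scoped Matrix in
/-- The spinor field `adj(c) κ` is parallel if `c` transforms the frame components of the Pauli
matrices to constant ones. -/
theorem IsPatch.parallel_adjugate (h : IsPatch U G T S) {ρ : Fin 4 → M2} (hρ : IsPauliBasis ρ)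
    {c : E4 → M2} (hc : ∀ z ∈ U, (c z).det = 1) (hcd : MatDiffAt c y)
    (hR : ∀ y ∈ U, ∀ α a b, S y α a b = ∑ j, (T y j α : ℂ) * ((c y)ᴴ * ρ j * c y) b a)
    (hy : y ∈ U) (κ : Fin 2 → ℂ) (α : Fin 4) (a : Fin 2) :
    spinorCovDeriv G S (weitzenbock T) (fun z a => ∑ b, (c z).adjugate a b * κ b) y α a = 0 := by
  rw [h.spinorCovDeriv_weitzenbock hR hy
    (fun j => (hcd.conjTranspose.mul (matDiffAt_const _)).mul hcd),
    hρ.sum_adjugate_mul_pdMatrix h.isOpen hc hy hcd]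
  have a1 : ∀ z ∈ U, (c z).adjugate * c z = 1 := fun z hz => by
    rw [Matrix.adjugate_mul, hc z hz, one_smul]
  have a2 : c y * (c y).adjugate = 1 := by rw [Matrix.mul_adjugate, hc y hy, one_smul]
  have h1 := pdMatrix_congr h.isOpen a1 hy α
  rw [pdMatrix_mul hcd.adjugate hcd, pdMatrix_const] at h1
  have h2 : pdMatrix α (fun z => (c z).adjugate) y =
      -((c y).adjugate * pdMatrix α c y * (c y).adjugate) := by
    have := congrArg (· * (c y).adjugate) h1
    simp only [Matrix.add_mul, Matrix.mul_assoc, a2, Matrix.mul_one, Matrix.zero_mul] at this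
    rw [eq_neg_of_add_eq_zero_left this, Matrix.mul_assoc]
  have h3 : pd α (fun z => ∑ b, (c z).adjugate a b * κ b) y =
      ∑ b, pdMatrix α (fun z => (c z).adjugate) y a b * κ b := by
    rw [pd_sum _ fun b _ => (hcd.adjugate a b).fun_mul (differentiableAt_const _)]
    refine Finset.sum_congr rfl fun b _ => ?_
    rw [pd_mul (hcd.adjugate a b) (differentiableAt_const _), pd_const, mul_zero, add_zero]
    rfl
  rw [h3, h2]
  simp only [Matrix.smul_apply, smul_eq_mul, mul_assoc, ← Finset.mul_sum]
  rw [sum_mul_sum_assoc (fun b => ((c y).adjugate * pdMatrix α c y) a b)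
    (fun b d => (c y).adjugate b d)]
  simp only [← Matrix.mul_apply, Matrix.neg_apply, neg_mul, Finset.sum_neg_distrib]
  simp only [Matrix.mul_assoc]
  ring

end

section

/-! ### Uniqueness of the associated spinor field -/

variable {U : Set E4} {G T : E4 → Matrix (Fin 4) (Fin 4) ℝ}
  {S : E4 → Fin 4 → Matrix (Fin 2) (Fin 2) ℂ} {y : E4}

/-- A diagonal entry with `x b ≠ 0` shows that the norms at `b`, and then the signs, agree; column
`b` makes the two vectors proportional. -/
theorem exists_phase {x x' : Fin 2 → ℂ} {s s' : ℝ} (hs : s = 1 ∨ s = -1) (hs' : s' = 1 ∨ s' = -1)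
    (hx : x ≠ 0) (h : ∀ a b, (s : ℂ) * (x a * star (x b)) = s' * (x' a * star (x' b))) :
    ∃ c : ℂ, ‖c‖ = 1 ∧ x' = c • x := by
  obtain ⟨b, hb⟩ := Function.ne_iff.1 hx
  have hb : x b ≠ 0 := hb
  have hn : ‖x b‖ = ‖x' b‖ := by
    have h1 := congrArg norm (h b b)
    have e : ∀ s : ℝ, s = 1 ∨ s = -1 → ‖(s : ℂ)‖ = 1 := by
      rintro s (rfl | rfl) <;> simp
    rw [norm_mul, norm_mul, norm_mul, norm_mul, norm_star, norm_star, e s hs, e s' hs', one_mul,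
      one_mul] at h1
    exact (mul_self_inj (norm_nonneg _) (norm_nonneg _)).1 h1
  have hb' : x' b ≠ 0 := by
    rw [← norm_ne_zero_iff, ← hn, norm_ne_zero_iff]
    exact hb
  have hsb' : star (x' b) ≠ 0 := star_ne_zero.2 hb'
  have hm : ∀ z : ℂ, z * star z = ((‖z‖ ^ 2 : ℝ) : ℂ) := fun z => by
    rw [Complex.star_def, Complex.mul_conj, Complex.normSq_eq_norm_sq]
  have hss : (s : ℂ) = s' := by
    have h1 := h b b
    rw [hm, hm, hn] at h1
    have h2 : ((‖x' b‖ ^ 2 : ℝ) : ℂ) ≠ 0 := by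
      rw [← hm]
      exact mul_ne_zero hb' hsb'
    exact mul_right_cancel₀ h2 h1
  have hs0 : (s' : ℂ) ≠ 0 := by rcases hs' with rfl | rfl <;> simp
  refine ⟨star (x b) / star (x' b), ?_, ?_⟩
  · rw [norm_div, norm_star, norm_star, hn, div_self (norm_ne_zero_iff.2 hb')]
  · funext a
    have h1 := h a b
    rw [hss] at h1
    have h2 := mul_left_cancel₀ hs0 h1
    rw [Pi.smul_apply, smul_eq_mul, div_mul_eq_mul_div, eq_div_iff hsb', ← h2, mul_comm]

/-- The Pauli matrices span all complex `2 × 2` matrices, so the current, multiplied by its sign,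
determines the matrix `s ξ ξ*`. -/
theorem IsPatch.exists_phase (h : IsPatch U G T S) (hy : y ∈ U) {l : Fin 4 → ℝ} {s s' : ℝ}
    (hs : s = 1 ∨ s = -1) (hs' : s' = 1 ∨ s' = -1) (hl0 : l ≠ 0) {X X' : E4 → Fin 2 → ℂ}
    (hcur : ∀ α, ∑ a, ∑ b, S y α a b * X y a * star (X y b) = ((s * ∑ j, l j * T y j α : ℝ) : ℂ))
    (hcur' : ∀ α, ∑ a, ∑ b, S y α a b * X' y a * star (X' y b) =
      ((s' * ∑ j, l j * T y j α : ℝ) : ℂ)) : ∃ c : ℂ, ‖c‖ = 1 ∧ X' y = c • X y := by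
  have hss : ∀ s : ℝ, s = 1 ∨ s = -1 → (s : ℂ) * s = 1 := by
    rintro s (rfl | rfl) <;> simp
  refine Teleparallel.exists_phase hs hs' (h.ne_zero hy hs hl0 hcur) ?_
  obtain ⟨E, hE⟩ := exists_isPauliFrame (h.isUnit_det hy) (h.hermitian y hy) (h.clifford y hy)
  set m : Fin 2 → Fin 2 → ℂ := fun a b =>
    (s : ℂ) * (X y a * star (X y b)) - s' * (X' y a * star (X' y b)) with hm
  have h1 : ∀ α, ∑ a, ∑ b, S y α a b * m a b = 0 := by
    intro α
    have e1 : ∀ a b, S y α a b * m a b = s * (S y α a b * X y a * star (X y b)) -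
        s' * (S y α a b * X' y a * star (X' y b)) := fun a b => by rw [hm]; ring
    simp only [e1, Finset.sum_sub_distrib, ← Finset.mul_sum, hcur, hcur']
    push_cast
    linear_combination (∑ j, (l j : ℂ) * T y j α) * (hss s hs - hss s' hs')
  have h2 : ∀ α, ∑ j, (E j α : ℂ) * ∑ a, ∑ b, pauli j a b * m a b = 0 := by
    intro α
    rw [← h1 α]
    simp only [hE.pauli, Finset.sum_mul, Finset.mul_sum]
    rw [Finset.sum_comm]
    refine Finset.sum_congr rfl fun a _ => ?_
    rw [Finset.sum_comm]
    exact Finset.sum_congr rfl fun b _ => Finset.sum_congr rfl fun j _ => by ring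
  have h3 : ∀ j, ∑ a, ∑ b, pauli j a b * m a b = 0 := by
    intro j
    have := sum_frame_mul_single (mul_inv_ofReal hE.unit)
      (fun j => ∑ a, ∑ b, pauli j a b * m a b) j
    rw [← this]
    refine Finset.sum_eq_zero fun α _ => ?_
    have h4 := h2 α
    simp only [Matrix.map_apply] at h4 ⊢
    rw [h4, zero_mul]
  intro a b
  exact sub_eq_zero.1 (pauli_eq_zero h3 a b)

theorem spinorCovDeriv_smul {Γ : E4 → Fin 4 → Fin 4 → Fin 4 → ℝ} {X X' : E4 → Fin 2 → ℂ} {c : ℂ}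
    (h : X' y = c • X y) (α : Fin 4) (a : Fin 2) :
    spinorCovDeriv G S Γ X' y α a - pd α (fun z => X' z a) y =
      c * (spinorCovDeriv G S Γ X y α a - pd α (fun z => X z a) y) := by
  simp only [spinorCovDeriv, add_sub_cancel_left, h, Pi.smul_apply, smul_eq_mul, Fin.sum_univ_two
    (M := ℂ)]
  ring

theorem fderiv_eq_zero_of_pd {f : E4 → ℂ} (h : ∀ α, pd α f y = 0) : fderiv ℝ f y = 0 := by
  have h1 : (fderiv ℝ f y : E4 →ₗ[ℝ] ℂ) = 0 := by
    refine Module.Basis.ext (EuclideanSpace.basisFun (Fin 4) ℝ).toBasis fun α => ?_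
    have := h α
    rw [pd] at this
    simpa using this
  ext v
  exact LinearMap.congr_fun h1 v

/-- The phase between two parallel spinor fields is locally constant. -/
theorem IsPatch.eventually_eq_smul (h : IsPatch U G T S) (hy : y ∈ U) {l : Fin 4 → ℝ} {s s' : ℝ}
    (hs : s = 1 ∨ s = -1) (hs' : s' = 1 ∨ s' = -1) (hl0 : l ≠ 0) {X X' : E4 → Fin 2 → ℂ}
    {Γ : E4 → Fin 4 → Fin 4 → Fin 4 → ℝ}
    (hX : ∀ a, ContDiffOn ℝ ∞ (fun z => X z a) U) (hX' : ∀ a, ContDiffOn ℝ ∞ (fun z => X' z a) U)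
    (hpar : ∀ y ∈ U, ∀ α a, spinorCovDeriv G S Γ X y α a = 0)
    (hpar' : ∀ y ∈ U, ∀ α a, spinorCovDeriv G S Γ X' y α a = 0)
    (hcur : ∀ y ∈ U, ∀ α,
      ∑ a, ∑ b, S y α a b * X y a * star (X y b) = ((s * ∑ j, l j * T y j α : ℝ) : ℂ))
    (hcur' : ∀ y ∈ U, ∀ α, ∑ a, ∑ b, S y α a b * X' y a * star (X' y b) =
      ((s' * ∑ j, l j * T y j α : ℝ) : ℂ)) {c : ℂ} (hc : X' y = c • X y) :
    ∀ᶠ z in nhds y, X' z = c • X z := by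
  obtain ⟨b, hb⟩ := Function.ne_iff.1 (h.ne_zero hy hs hl0 (hcur y hy))
  have hb : X y b ≠ 0 := hb
  have hev : ∀ᶠ z in nhds y, z ∈ U ∧ X z b ≠ 0 :=
    Filter.Eventually.and (h.isOpen.mem_nhds hy)
      (((hX b).continuousOn.continuousAt (h.isOpen.mem_nhds hy)).eventually_ne hb)
  obtain ⟨ε, hε, hball⟩ := Metric.eventually_nhds_iff_ball.1 hev
  -- The phase is the ratio of components that do not vanish near `y`, hence differentiable. The
  -- connection terms are linear, so the two parallel equations leave `(∂f) X = 0`.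
  set f : E4 → ℂ := fun z => X' z b / X z b with hf
  have hph : ∀ z ∈ Metric.ball y ε, X' z = f z • X z := by
    intro z hz
    obtain ⟨d, -, hd⟩ := h.exists_phase (hball z hz).1 hs hs' hl0 (hcur z (hball z hz).1)
      (hcur' z (hball z hz).1)
    have : f z = d := by
      rw [hf]
      simp only [hd, Pi.smul_apply, smul_eq_mul]
      rw [mul_div_cancel_right₀ _ (hball z hz).2]
    rw [this, hd]
  have hfdiff : ∀ z ∈ Metric.ball y ε, DifferentiableAt ℝ f z := by
    intro z hz
    simp only [hf, div_eq_mul_inv]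
    exact (ContDiffOn.differentiableAt_of_mem (hX' b) h.isOpen (hball z hz).1).fun_mul
      ((ContDiffOn.differentiableAt_of_mem (hX b) h.isOpen (hball z hz).1).fun_inv (hball z hz).2)
  have hfd : ∀ z ∈ Metric.ball y ε, fderiv ℝ f z = 0 := by
    intro z hz
    have d1 := ContDiffOn.differentiableAt_of_mem (hX b) h.isOpen (hball z hz).1
    refine fderiv_eq_zero_of_pd fun α => ?_
    have e1 := spinorCovDeriv_smul (G := G) (S := S) (Γ := Γ) (hph z hz) α b
    rw [hpar z (hball z hz).1, hpar' z (hball z hz).1, zero_sub, zero_sub, mul_neg, neg_inj] at e1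
    have e2 : pd α (fun w => f w * X w b) z = pd α (fun w => X' w b) z :=
      pd_congr Metric.isOpen_ball
        (fun w hw => div_mul_cancel₀ _ (hball w hw).2) hz α
    rw [pd_mul (hfdiff z hz) d1, e1] at e2
    have e3 : pd α f z * X z b = 0 := by linear_combination e2
    exact (mul_eq_zero.1 e3).resolve_right (hball z hz).2
  have hy' : y ∈ Metric.ball y ε := Metric.mem_ball_self hε
  have hfy : f y = c := by
    rw [hf]
    simp only [hc, Pi.smul_apply, smul_eq_mul]
    rw [mul_div_cancel_right₀ _ hb]
  filter_upwards [Metric.ball_mem_nhds y hε] with z hz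
  rw [hph z hz, ← hfy]
  congr 1
  exact Metric.isOpen_ball.is_const_of_fderiv_eq_zero (convex_ball y ε).isPreconnected
    (fun z hz => (hfdiff z hz).differentiableWithinAt) hfd
    hz hy'

end

section

/-! ### From the manifold to coordinate patches -/

section Frame
variable {M : Type*} [TopologicalSpace M] [ChartedSpace E4 M]

theorem sum_coordVec [IsManifold (𝓡 4) ∞ M] {e : OpenPartialHomeomorph M E4} (he : e ∈ atlas E4 M)
    {y : E4} (hy : y ∈ e.target) (w : TangentSpace (𝓡 4) (e.symm y)) :
    ∃ u : Fin 4 → ℝ, ∑ α, u α • coordVec e y α = w := by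
  have : IsManifold (𝓡 4) 1 M := IsManifold.of_le (n := ∞) (by simp)
  obtain ⟨u, rfl⟩ := (mdifferentiable_of_mem_atlas (I := 𝓡 4) he).symm.mfderiv_surjective hy w
  change E4 at u
  refine ⟨u, ?_⟩
  have h1 : ∑ α, u α • (EuclideanSpace.single α (1 : ℝ) : E4) = u := by
    ext β
    simp [Finset.sum_apply, Pi.single_apply]
  conv_rhs => rw [← h1]
  simp only [coordVec]
  exact (map_sum (mfderiv (𝓡 4) (𝓡 4) e.symm y).toLinearMap _ _ |>.trans
    (Finset.sum_congr rfl fun α _ => map_smul _ _ _)).symm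

variable {g : BilinField M} {ϑ : Fin 4 → CovectorField M}

/-- The frame of vectors dual to a coframe. -/
theorem IsCoframe.exists_frame (hϑ : IsCoframe g ϑ) (hg : IsLorentzMetric g) :
    ∃ v : (x : M) → Fin 4 → TangentSpace (𝓡 4) x,
      (∀ x k j, ϑ k x (v x j) = if k = j then 1 else 0) ∧
        ∀ x w, w = ∑ j, ϑ j x w • v x j := by
  have key : ∀ x, ∃ v : Fin 4 → TangentSpace (𝓡 4) x,
      (∀ k j, ϑ k x (v j) = if k = j then 1 else 0) ∧ ∀ w, w = ∑ j, ϑ j x w • v j := by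
    intro x
    obtain ⟨b, hb⟩ := hg.signature x
    have hinj : ∀ w, (∀ j, ϑ j x w = 0) → w = 0 := by
      intro w hw
      have h1 : ∀ i, g x w (b i) = 0 := fun i => by
        rw [hϑ.metric_eq]
        simp [hw]
      have h2 : ∀ i, b.repr w i * eta i = 0 := by
        intro i
        rw [← h1 i]
        conv_rhs => rw [← b.sum_repr w]
        simp only [map_sum, map_smul, LinearMap.sum_apply, LinearMap.smul_apply, hb, mink_apply,
          smul_eq_mul]
        simp
      have h3 : ∀ i, b.repr w i = 0 := fun i => by
        have := eta_mul_eta i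
        linear_combination (eta i) * h2 i - b.repr w i * this
      rw [← b.sum_repr w]
      simp [h3]
    set Φ : TangentSpace (𝓡 4) x →ₗ[ℝ] (Fin 4 → ℝ) := LinearMap.pi fun j => ϑ j x
    have hΦ : Function.Injective Φ := by
      rw [injective_iff_map_eq_zero]
      exact fun w hw => hinj w fun j => congrFun hw j
    have : FiniteDimensional ℝ (TangentSpace (𝓡 4) x) := Module.Finite.of_basis b
    have hdim : Module.finrank ℝ (TangentSpace (𝓡 4) x) = Module.finrank ℝ (Fin 4 → ℝ) := by
      rw [Module.finrank_eq_card_basis b, Module.finrank_fin_fun, Fintype.card_fin]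
    have hsurj := (LinearMap.injective_iff_surjective_of_finrank_eq_finrank hdim).1 hΦ
    choose v hv using fun j => hsurj (Pi.single j 1)
    have hvk : ∀ k j, ϑ k x (v j) = if k = j then 1 else 0 := fun k j => by
      have := congrFun (hv j) k
      rw [Pi.single_apply] at this
      exact this
    refine ⟨v, hvk, fun w => hΦ ?_⟩
    funext k
    show ϑ k x w = ϑ k x (∑ j, ϑ j x w • v j)
    simp [map_sum, hvk]
  choose v h1 h2 using key
  exact ⟨v, h1, h2⟩

end Frame

section Patch
variable {M : Type*} [TopologicalSpace M] [ChartedSpace E4 M] [IsManifold (𝓡 4) ∞ M]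
  {g : BilinField M} {ϑ : Fin 4 → CovectorField M} {σ : MatrixCovectorField M}

theorem IsCoframe.isUnit_det (hϑ : IsCoframe g ϑ) (hg : IsLorentzMetric g)
    {e : OpenPartialHomeomorph M E4} (he : e ∈ atlas E4 M) {y : E4} (hy : y ∈ e.target) :
    IsUnit (coframeIn e ϑ y).det := by
  obtain ⟨v, hv, -⟩ := hϑ.exists_frame hg
  choose u hu using fun j => sum_coordVec he hy (v (e.symm y) j)
  refine Matrix.isUnit_det_of_right_inverse (B := Matrix.of fun α j => u j α) ?_
  ext k j
  rw [Matrix.one_apply, ← hv (e.symm y) k j, ← hu j, Matrix.mul_apply, map_sum]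
  refine Finset.sum_congr rfl fun α _ => ?_
  rw [map_smul, smul_eq_mul, mul_comm]
  rfl

theorem IsCoframe.isPatch (hϑ : IsCoframe g ϑ) (hg : IsLorentzMetric g) (hσ : IsPauli g σ)
    {e : OpenPartialHomeomorph M E4} (he : e ∈ atlas E4 M) {V : Set M} (hV : IsOpen V) :
    IsPatch (domIn e V) (metricIn e g) (coframeIn e ϑ) (pauliIn e σ) where
  isOpen := e.isOpen_inter_preimage_symm hV
  metric y _ α β := by
    rw [metricIn, Matrix.of_apply, hϑ.metric_eq]
    simp only [mul_assoc]
    rw [sum_mink fun j k => ϑ j (e.symm y) (coordVec e y α) * ϑ k (e.symm y) (coordVec e y β)]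
    rfl
  unit y hy := hϑ.isUnit_det hg he hy.1
  smooth j α := (hϑ.smooth e he j α).mono Set.inter_subset_left
  smoothPauli α a b := (hσ.smooth e he α a b).mono Set.inter_subset_left
  hermitian y _ α := hσ.hermitian _ _
  clifford y _ α β := hσ.clifford _ _ _
  polarized y hy := hσ.polarized e he y hy.1

/-- The frame components of the Pauli matrices. -/
theorem IsPauli.exists_components (hσ : IsPauli g σ) (hg : IsLorentzMetric g)
    (hϑ : IsCoframe g ϑ) : ∃ R : M → Fin 4 → M2, (∀ x, IsPauliBasis (R x)) ∧
      (∀ x w a b, σ x w a b = ∑ j, (ϑ j x w : ℂ) * R x j b a) ∧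
      ∀ e ∈ atlas E4 M, ∀ j a b, ContDiffOn ℝ ∞ (fun y => R (e.symm y) j a b) e.target := by
  obtain ⟨v, hv, hvw⟩ := hϑ.exists_frame hg
  have hgv : ∀ x j k, g x (v x j) (v x k) = mink j k := by
    intro x j k
    rw [hϑ.metric_eq]
    simp [hv]
  have hcomp : ∀ x w a b, σ x w a b = ∑ j, (ϑ j x w : ℂ) * (σ x (v x j)).transpose b a := by
    intro x w a b
    conv_lhs => rw [hvw x w, map_sum, Matrix.sum_apply]
    refine Finset.sum_congr rfl fun j _ => ?_
    rw [map_smul, Matrix.smul_apply, Complex.real_smul]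
    rfl
  -- The transpose turns the raised spinor indices into adjugates, so that the Clifford relation
  -- takes the form `adj(R_j) R_k + adj(R_k) R_j`.
  refine ⟨fun x j => (σ x (v x j)).transpose, fun x => ⟨fun j => ?_, fun j k => ?_⟩, hcomp, ?_⟩
  · exact (hσ.hermitian x _).transpose
  · have h1 := congrArg Matrix.transpose (hσ.clifford x (v x j) (v x k))
    rw [spinorRaise_eq_adjugate, spinorRaise_eq_adjugate, Matrix.transpose_transpose,
      Matrix.transpose_transpose, Matrix.transpose_add, Matrix.transpose_mul, Matrix.transpose_mul,
      Matrix.transpose_smul, Matrix.transpose_one, hgv] at h1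
    rw [← h1, Matrix.adjugate_transpose, Matrix.adjugate_transpose, add_comm]
  · intro e he j a b
    have hP := hϑ.isPatch hg hσ he isOpen_univ
    have hsub : e.target = domIn e Set.univ := by simp [domIn]
    rw [hsub]
    -- The dual frame `v` was chosen point by point; the inverse coframe matrix expresses the
    -- components by smooth functions.
    have h1 : ∀ y ∈ domIn e Set.univ, (σ (e.symm y) (v (e.symm y) j)).transpose a b =
        ∑ α, (((coframeIn e ϑ y)⁻¹ α j : ℝ) : ℂ) * pauliIn e σ y α b a := by
      intro y hy
      have h2 := sum_frame_mul_single (mul_inv_ofReal (hP.unit y hy))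
        (fun j => (σ (e.symm y) (v (e.symm y) j)).transpose a b) j
      rw [← h2]
      refine Finset.sum_congr rfl fun α _ => ?_
      rw [mul_comm, pauliIn, hcomp]
      rfl
    refine ContDiffOn.congr (ContDiffOn.sum fun α _ => ?_) h1
    exact (contDiffOn_inv hP.smooth hP.unit α j).complex_ofReal.mul (hP.smoothPauli α b a)

end Patch

end

section

/-! ### Existence of the associated spinor field -/

/-- Entrywise smoothness. -/
def MatSmoothOn (A : E4 → M2) (U : Set E4) : Prop :=
  ∀ a b, ContDiffOn ℝ ∞ (fun y => A y a b) U

section MatSmoothOn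
variable {A B : E4 → M2} {U : Set E4}

theorem matSmoothOn_const (A : M2) : MatSmoothOn (fun _ => A) U := fun _ _ => contDiffOn_const

theorem MatSmoothOn.mul (hA : MatSmoothOn A U) (hB : MatSmoothOn B U) :
    MatSmoothOn (fun y => A y * B y) U := by
  intro a b
  simp only [Matrix.mul_apply]
  exact ContDiffOn.sum fun c _ => (hA a c).mul (hB c b)

theorem MatSmoothOn.add (hA : MatSmoothOn A U) (hB : MatSmoothOn B U) :
    MatSmoothOn (fun y => A y + B y) U :=
  fun a b => (hA a b).add (hB a b)

theorem MatSmoothOn.smul {f : E4 → ℂ} (hf : ContDiffOn ℝ ∞ f U) (hA : MatSmoothOn A U) :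
    MatSmoothOn (fun y => f y • A y) U :=
  fun a b => hf.mul (hA a b)

open scoped Matrix in
theorem MatSmoothOn.conjTranspose (hA : MatSmoothOn A U) : MatSmoothOn (fun y => (A y)ᴴ) U :=
  fun a b => Complex.conjCLE.contDiff.comp_contDiffOn (hA b a)

theorem MatSmoothOn.adjugate (hA : MatSmoothOn A U) : MatSmoothOn (fun y => (A y).adjugate) U := by
  intro a b
  simp only [Matrix.adjugate_fin_two]
  fin_cases a <;> fin_cases b
  · exact hA 1 1
  · exact (hA 0 1).neg
  · exact (hA 1 0).neg
  · exact hA 0 0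

theorem MatSmoothOn.det (hA : MatSmoothOn A U) : ContDiffOn ℝ ∞ (fun y => (A y).det) U := by
  simp only [Matrix.det_fin_two]
  exact ((hA 0 0).mul (hA 1 1)).sub ((hA 0 1).mul (hA 1 0))

theorem MatSmoothOn.trace (hA : MatSmoothOn A U) : ContDiffOn ℝ ∞ (fun y => (A y).trace) U := by
  simp only [Matrix.trace_fin_two]
  exact (hA 0 0).add (hA 1 1)

theorem MatSmoothOn.mono {U' : Set E4} (hA : MatSmoothOn A U) (h : U' ⊆ U) : MatSmoothOn A U' :=
  fun a b => (hA a b).mono h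

theorem MatSmoothOn.matDiffAt {y : E4} (hA : MatSmoothOn A U) (hU : IsOpen U) (hy : y ∈ U) :
    MatDiffAt A y :=
  fun a b => ContDiffOn.differentiableAt_of_mem (hA a b) hU hy

theorem matSmoothOn_evenGen {R : E4 → Fin 4 → M2} (h : ∀ j, MatSmoothOn (fun y => R y j) U)
    (k : Fin 4) : MatSmoothOn (fun y => evenGen (R y) k) U :=
  (h 0).adjugate.mul (h k)

theorem contDiffOn_orientation {R : E4 → Fin 4 → M2} (h : ∀ j, MatSmoothOn (fun y => R y j) U) :
    ContDiffOn ℝ ∞ (fun y => orientation (R y)) U :=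
  ((matSmoothOn_evenGen h 1).mul (matSmoothOn_evenGen h 2)).mul (matSmoothOn_evenGen h 3) 0 0

theorem matSmoothOn_intertwiner {R : E4 → Fin 4 → M2} (h : ∀ j, MatSmoothOn (fun y => R y j) U)
    (ρ : Fin 4 → M2) : MatSmoothOn (fun y => intertwiner ρ (R y)) U :=
  (((matSmoothOn_const 1).add ((matSmoothOn_const _).mul (matSmoothOn_evenGen h 1))).add
    ((matSmoothOn_const _).mul (matSmoothOn_evenGen h 2))).add
    ((matSmoothOn_const _).mul (matSmoothOn_evenGen h 3))

end MatSmoothOn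

/-! ### The normalized intertwiner near a point. -/

/-- A complex number whose square times `d` is `1`. -/
def invSqrt (d : ℂ) : ℂ := Complex.exp (-(Complex.log d / 2))

theorem invSqrt_mul_self {d : ℂ} (hd : d ∈ Complex.slitPlane) :
    invSqrt d * invSqrt d * d = 1 := by
  rw [invSqrt, ← Complex.exp_add]
  nth_rewrite 3 [← Complex.exp_log (Complex.slitPlane_ne_zero hd)]
  rw [← Complex.exp_add, ← Complex.exp_zero]
  congr 1
  ring

theorem contDiffOn_invSqrt {f : E4 → ℂ} {U : Set E4} (hf : ContDiffOn ℝ ∞ f U)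
    (h : ∀ y ∈ U, f y ∈ Complex.slitPlane) : ContDiffOn ℝ ∞ (fun y => invSqrt (f y)) U := by
  have h1 : ContDiffOn ℝ ∞ (fun y => Complex.log (f y)) U := fun y hy =>
    ((Complex.contDiffAt_log (h y hy)).restrict_scalars ℝ).comp_contDiffWithinAt y (hf y hy)
  exact (h1.div_const 2).neg.cexp

/-- The intertwiner, normalized to have determinant `1`. -/
def spinFrame (ρ R : Fin 4 → M2) : M2 := invSqrt (intertwiner ρ R).det • intertwiner ρ R

theorem matSmoothOn_spinFrame {R : E4 → Fin 4 → M2} {U : Set E4}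
    (h : ∀ j, MatSmoothOn (fun y => R y j) U) (ρ : Fin 4 → M2)
    (hs : ∀ y ∈ U, (intertwiner ρ (R y)).det ∈ Complex.slitPlane) :
    MatSmoothOn (fun y => spinFrame ρ (R y)) U :=
  MatSmoothOn.smul (contDiffOn_invSqrt (matSmoothOn_intertwiner h ρ).det hs)
    (matSmoothOn_intertwiner h ρ)

theorem spinFrame_det {ρ R : Fin 4 → M2} (hs : (intertwiner ρ R).det ∈ Complex.slitPlane) :
    (spinFrame ρ R).det = 1 := by
  rw [spinFrame, Matrix.det_smul, Fintype.card_fin, pow_two, invSqrt_mul_self hs]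

theorem IsPauliBasis.det_intertwiner_self {ρ : Fin 4 → M2} (hρ : IsPauliBasis ρ) :
    (intertwiner ρ ρ).det = 16 := by
  rw [hρ.intertwiner_self, Matrix.det_smul, Fintype.card_fin, Matrix.det_one]
  norm_num

theorem IsPauliBasis.spinFrame_self {ρ : Fin 4 → M2} (hρ : IsPauliBasis ρ) :
    ∃ w : ℂ, star w * w = 1 ∧ spinFrame ρ ρ = w • (1 : M2) := by
  have h16 : (16 : ℂ) ∈ Complex.slitPlane := Or.inl (by norm_num)
  refine ⟨invSqrt 16 * 4, ?_, ?_⟩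
  · have h1 := invSqrt_mul_self h16
    have h2 : star (invSqrt 16) = invSqrt 16 := by
      have e : Complex.log 16 = ((Real.log 16 : ℝ) : ℂ) := by
        rw [Complex.ofReal_log (by norm_num)]
        norm_num
      rw [invSqrt, e, Complex.star_def, ← Complex.exp_conj, map_neg, map_div₀, Complex.conj_ofReal,
        map_ofNat]
    have h4 : star (4 : ℂ) = 4 := by simp
    rw [star_mul', h2, h4]
    linear_combination h1
  · rw [spinFrame, hρ.det_intertwiner_self, hρ.intertwiner_self, smul_smul]

open scoped Matrix in
/-- The open conditions under which the normalized intertwiner relates two Pauli bases. -/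
structure IsNear (ρ R : Fin 4 → M2) : Prop where
  slit : (intertwiner ρ R).det ∈ Complex.slitPlane
  orientation : 0 < (-(orientation R * orientation ρ)).re
  trace : 0 < ((ρ 0).adjugate * R 0).trace.re
  traceConj : 0 < ((ρ 0).adjugate * ((spinFrame ρ R)ᴴ * ρ 0 * spinFrame ρ R)).trace.re

open scoped Matrix in
-- Orientations are square roots of `-1`; the positivity condition on their product excludes that
-- they are opposite.
theorem IsNear.conj_eq {ρ R : Fin 4 → M2} (h : IsNear ρ R) (hρ : IsPauliBasis ρ)
    (hR : IsPauliBasis R) (k : Fin 4) : (spinFrame ρ R)ᴴ * ρ k * spinFrame ρ R = R k := by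
  refine hR.conj_eq hρ ?_ (invSqrt_mul_self h.slit) h.trace h.traceConj k
  have h1 := hρ.orientation_mul_self
  have h2 := hR.orientation_mul_self
  rcases mul_self_eq_mul_self_iff.1 (h1.trans h2.symm) with h3 | h3
  · exact h3
  · have h4 := h.orientation
    rw [h3, mul_neg, neg_neg, h2] at h4
    norm_num at h4

open scoped Matrix in
theorem IsPauliBasis.isNear_self {ρ : Fin 4 → M2} (hρ : IsPauliBasis ρ) : IsNear ρ ρ := by
  have h0 : 0 < ((ρ 0).adjugate * ρ 0).trace.re := by
    rw [hρ.trace_adjugate_mul]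
    simp [mink]
  refine ⟨?_, ?_, h0, ?_⟩
  · rw [hρ.det_intertwiner_self]
    exact Or.inl (by norm_num)
  · rw [hρ.orientation_mul_self]
    norm_num
  · obtain ⟨w, hw, hs⟩ := hρ.spinFrame_self
    rw [hs, Matrix.conjTranspose_smul, Matrix.conjTranspose_one, Matrix.smul_mul, Matrix.one_mul,
      Matrix.smul_mul, Matrix.mul_smul, Matrix.mul_smul, Matrix.mul_one, Matrix.mul_smul, smul_smul,
      hw, one_smul]
    exact h0

theorem eventually_isNear {R : E4 → Fin 4 → M2} {U : Set E4} (hU : IsOpen U)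
    (h : ∀ j, MatSmoothOn (fun y => R y j) U) (hR : ∀ y, IsPauliBasis (R y)) {y₀ : E4}
    (hy : y₀ ∈ U) : ∀ᶠ y in nhds y₀, y ∈ U ∧ IsNear (R y₀) (R y) := by
  have hself := (hR y₀).isNear_self
  -- The normalized intertwiner is smooth only where the logarithm of the determinant is, so the
  -- domain is shrunk first; at `y₀` the determinant is `16`.
  set U' := U ∩ (fun y => (intertwiner (R y₀) (R y)).det) ⁻¹' Complex.slitPlane with hU'
  have hU'o : IsOpen U' := (matSmoothOn_intertwiner h (R y₀)).det.continuousOn.isOpen_inter_preimage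
    hU Complex.isOpen_slitPlane
  have hyU' : y₀ ∈ U' := ⟨hy, hself.slit⟩
  have h' : ∀ j, MatSmoothOn (fun y => R y j) U' := fun j => (h j).mono Set.inter_subset_left
  have hc := matSmoothOn_spinFrame h' (R y₀) fun y hy => hy.2
  have key : ∀ f : E4 → ℂ, ContDiffOn ℝ ∞ f U' → 0 < (f y₀).re → ∀ᶠ y in nhds y₀, 0 < (f y).re := by
    intro f hf h0
    have h1 : ContinuousAt (fun y => (f y).re) y₀ :=
      Complex.continuous_re.continuousAt.comp (hf.continuousOn.continuousAt (hU'o.mem_nhds hyU'))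
    exact h1.eventually (lt_mem_nhds h0)
  filter_upwards [hU'o.mem_nhds hyU',
    key _ ((contDiffOn_orientation h').mul contDiffOn_const).neg hself.orientation,
    key _ ((matSmoothOn_const (R y₀ 0).adjugate).mul (h' 0)).trace hself.trace,
    key _ ((matSmoothOn_const (R y₀ 0).adjugate).mul
      ((hc.conjTranspose.mul (matSmoothOn_const (R y₀ 0))).mul hc)).trace hself.traceConj]
    with y h1 h2 h3 h4
  exact ⟨h1.1, h1.2, h2, h3, h4⟩

open scoped Matrix in
theorem sum_conj_mul (c ρ : M2) (x : Fin 2 → ℂ) :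
    ∑ a, ∑ b, (cᴴ * ρ * c) b a * x a * star (x b) =
      ∑ a, ∑ b, ρ b a * (c.mulVec x) a * star ((c.mulVec x) b) := by
  have key : ∀ (A : M2) (z : Fin 2 → ℂ),
      ∑ a, ∑ b, A b a * z a * star (z b) = star z ⬝ᵥ A.mulVec z := by
    intro A z
    rw [Finset.sum_comm, dotProduct]
    refine Finset.sum_congr rfl fun b _ => ?_
    rw [Matrix.mulVec, dotProduct, Finset.mul_sum]
    exact Finset.sum_congr rfl fun a _ => by rw [mul_comm, Pi.star_apply]
  rw [key, key, Matrix.star_mulVec, ← Matrix.dotProduct_mulVec, Matrix.mulVec_mulVec,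
    Matrix.mulVec_mulVec, Matrix.mul_assoc]

variable {M : Type*} [TopologicalSpace M] [ChartedSpace E4 M] [IsManifold (𝓡 4) ∞ M]
  {g : BilinField M} {ϑ : Fin 4 → CovectorField M} {σ : MatrixCovectorField M}

theorem exists_isAssociated (hg : IsLorentzMetric g) (hσ : IsPauli g σ) (hϑ : IsCoframe g ϑ)
    {l : Fin 4 → ℝ} (hl : ∑ j, ∑ k, mink j k * l j * l k = 0) (p : M) :
    ∃ V : Set M, IsOpen V ∧ IsConnected V ∧ p ∈ V ∧
      ∃ (s : ℝ) (ξ : M → Fin 2 → ℂ), IsAssociated g σ ϑ l V s ξ := by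
  obtain ⟨R, hR, hσR, hRs⟩ := hσ.exists_components hg hϑ
  set e₀ := chartAt E4 p with he₀
  have hp : p ∈ e₀.source := mem_chart_source E4 p
  have hev := eventually_isNear e₀.open_target (fun j => hRs e₀ (chart_mem_atlas E4 p) j)
    (fun y => hR _) (e₀.map_source hp)
  rw [e₀.left_inv hp] at hev
  obtain ⟨ε, hε, hball⟩ := Metric.eventually_nhds_iff_ball.1 hev
  set V := e₀.symm '' Metric.ball (e₀ p) ε with hV
  have hsub : Metric.ball (e₀ p) ε ⊆ e₀.target := fun y hy => (hball y hy).1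
  have hVo : IsOpen V := e₀.isOpen_image_symm_of_subset_target Metric.isOpen_ball hsub
  have hVnear : ∀ x ∈ V, IsNear (R p) (R x) := by
    rintro x ⟨y, hy, rfl⟩
    exact (hball y hy).2
  have hpV : p ∈ V := ⟨e₀ p, Metric.mem_ball_self hε, e₀.left_inv hp⟩
  obtain ⟨s, κ, hs, hκ⟩ := (hR p).exists_spinor hl
  have hcs : ∀ e ∈ atlas E4 M, MatSmoothOn (fun y => spinFrame (R p) (R (e.symm y))) (domIn e V) :=
    fun e he => matSmoothOn_spinFrame
      (fun j => MatSmoothOn.mono (hRs e he j) Set.inter_subset_left) (R p)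
      fun y hy => (hVnear _ hy.2).slit
  -- With `c = spinFrame (R p) (R x)`, the spinor `adj(c) κ` is parallel; as `R x = c* R(p) c` and
  -- `c adj(c) = 1`, its current in the frame at `x` is that of `κ` at `p`, namely `s l`.
  refine ⟨V, hVo, ?_, hpV, s, fun x => (spinFrame (R p) (R x)).adjugate.mulVec κ, hs, ?_, ?_, ?_⟩
  · exact (Metric.isConnected_ball hε).image _ (e₀.continuousOn_symm.mono hsub)
  · intro e he a
    exact ContDiffOn.sum (s := Finset.univ) fun b _ =>
      ((hcs e he).adjugate a b).mul (contDiffOn_const (c := κ b))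
  · intro e he y hy α a
    have hP := hϑ.isPatch hg hσ he hVo
    refine hP.parallel_adjugate (hR p) (c := fun y => spinFrame (R p) (R (e.symm y)))
      (fun z hz => spinFrame_det (hVnear _ hz.2).slit) ((hcs e he).matDiffAt hP.isOpen hy) ?_ hy
      κ α a
    intro y hy α a b
    rw [pauliIn, hσR]
    refine Finset.sum_congr rfl fun j _ => ?_
    rw [(hVnear _ hy.2).conj_eq (hR p) (hR _)]
    rfl
  · intro x hx v
    have h1 : ∀ j, ∑ a, ∑ b, R x j b a * ((spinFrame (R p) (R x)).adjugate.mulVec κ) a *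
        star (((spinFrame (R p) (R x)).adjugate.mulVec κ) b) = ((s * l j : ℝ) : ℂ) := by
      intro j
      rw [← (hVnear x hx).conj_eq (hR p) (hR x) j, sum_conj_mul, Matrix.mulVec_mulVec,
        Matrix.mul_adjugate, spinFrame_det (hVnear x hx).slit, one_smul, Matrix.one_mulVec, hκ]
    have h2 : ((s * ∑ j, l j * ϑ j x v : ℝ) : ℂ) = ∑ j, (ϑ j x v : ℂ) * ((s * l j : ℝ) : ℂ) := by
      push_cast
      rw [Finset.mul_sum]
      exact Finset.sum_congr rfl fun j _ => by ring
    rw [h2]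
    simp only [← h1, hσR, Finset.sum_mul, Finset.mul_sum]
    conv_rhs => rw [Finset.sum_comm]
    refine Finset.sum_congr rfl fun a _ => ?_
    conv_rhs => rw [Finset.sum_comm]
    exact Finset.sum_congr rfl fun b _ => Finset.sum_congr rfl fun j _ => by ring

end

section

/-! ### The associated spinor field on the manifold -/

section Assoc
variable {M : Type*} [TopologicalSpace M] [ChartedSpace E4 M]
  {g : BilinField M} {ϑ : Fin 4 → CovectorField M} {σ : MatrixCovectorField M}
  {l : Fin 4 → ℝ} {V : Set M} {s s' : ℝ} {ξ ξ' : M → Fin 2 → ℂ}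

theorem IsAssociated.current_in (h : IsAssociated g σ ϑ l V s ξ)
    {e : OpenPartialHomeomorph M E4} {y : E4} (hy : y ∈ domIn e V) (α : Fin 4) :
    ∑ a, ∑ b, pauliIn e σ y α a b * spinorIn e ξ y a * star (spinorIn e ξ y b) =
      ((s * ∑ j, l j * coframeIn e ϑ y j α : ℝ) : ℂ) :=
  h.current _ hy.2 _

theorem mem_domIn_chartAt {x : M} (hx : x ∈ V) : chartAt E4 x x ∈ domIn (chartAt E4 x) V :=
  ⟨mem_chart_target E4 x, by
    rw [Set.mem_preimage, (chartAt E4 x).left_inv (mem_chart_source E4 x)]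
    exact hx⟩

theorem spinorIn_chartAt (ξ : M → Fin 2 → ℂ) (x : M) :
    spinorIn (chartAt E4 x) ξ (chartAt E4 x x) = ξ x := by
  rw [spinorIn, (chartAt E4 x).left_inv (mem_chart_source E4 x)]

variable [IsManifold (𝓡 4) ∞ M]

theorem IsAssociated.ne_zero (hg : IsLorentzMetric g) (hσ : IsPauli g σ) (hϑ : IsCoframe g ϑ)
    (hl0 : l ≠ 0) (hV : IsOpen V) (h : IsAssociated g σ ϑ l V s ξ) {x : M} (hx : x ∈ V) :
    ξ x ≠ 0 := by
  rw [← spinorIn_chartAt ξ x]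
  exact (hϑ.isPatch hg hσ (chart_mem_atlas E4 x) hV).ne_zero (mem_domIn_chartAt hx) h.sign hl0
    (h.current_in (mem_domIn_chartAt hx))

theorem IsAssociated.exists_phase (hg : IsLorentzMetric g) (hσ : IsPauli g σ) (hϑ : IsCoframe g ϑ)
    (hl0 : l ≠ 0) (hV : IsOpen V) (h : IsAssociated g σ ϑ l V s ξ)
    (h' : IsAssociated g σ ϑ l V s' ξ') {x : M} (hx : x ∈ V) :
    ∃ c : ℂ, ‖c‖ = 1 ∧ ξ' x = c • ξ x := by
  rw [← spinorIn_chartAt ξ x, ← spinorIn_chartAt ξ' x]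
  exact (hϑ.isPatch hg hσ (chart_mem_atlas E4 x) hV).exists_phase (mem_domIn_chartAt hx) h.sign
    h'.sign hl0 (h.current_in (mem_domIn_chartAt hx)) (h'.current_in (mem_domIn_chartAt hx))

theorem IsAssociated.eventually_eq_smul (hg : IsLorentzMetric g) (hσ : IsPauli g σ)
    (hϑ : IsCoframe g ϑ) (hl0 : l ≠ 0) (hV : IsOpen V) (h : IsAssociated g σ ϑ l V s ξ)
    (h' : IsAssociated g σ ϑ l V s' ξ') {x : M} (hx : x ∈ V) {c : ℂ} (hc : ξ' x = c • ξ x) :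
    ∀ᶠ z in nhds x, ξ' z = c • ξ z := by
  have he := chart_mem_atlas E4 x
  rw [← spinorIn_chartAt ξ x, ← spinorIn_chartAt ξ' x] at hc
  have h1 := (hϑ.isPatch hg hσ he hV).eventually_eq_smul (mem_domIn_chartAt hx) h.sign h'.sign hl0
    (h.smooth _ he) (h'.smooth _ he) (h.parallel _ he) (h'.parallel _ he)
    (fun y hy => h.current_in hy) (fun y hy => h'.current_in hy) hc
  have hcont := (chartAt E4 x).continuousAt (mem_chart_source E4 x)
  filter_upwards [hcont.eventually h1,
    (chartAt E4 x).open_source.mem_nhds (mem_chart_source E4 x)] with z hz hzs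
  simpa only [spinorIn, (chartAt E4 x).left_inv hzs] using hz

theorem IsAssociated.eq_smul (hg : IsLorentzMetric g) (hσ : IsPauli g σ)
    (hϑ : IsCoframe g ϑ) (hl0 : l ≠ 0) (hV : IsOpen V) (hVc : IsPreconnected V)
    (h : IsAssociated g σ ϑ l V s ξ) (h' : IsAssociated g σ ϑ l V s' ξ') :
    ∃ c : ℂ, ‖c‖ = 1 ∧ ∀ x ∈ V, ξ' x = c • ξ x := by
  rcases V.eq_empty_or_nonempty with rfl | ⟨x₀, hx₀⟩
  · exact ⟨1, norm_one, fun x hx => hx.elim⟩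
  obtain ⟨c, hc1, hc⟩ := h.exists_phase hg hσ hϑ hl0 hV h' hx₀
  refine ⟨c, hc1, ?_⟩
  set A : Set M := {x | x ∈ V ∧ ξ' x = c • ξ x}
  set B : Set M := {x | x ∈ V ∧ ξ' x ≠ c • ξ x}
  have hA : IsOpen A := isOpen_iff_mem_nhds.2 fun x hx =>
    Filter.Eventually.and (hV.mem_nhds hx.1) (h.eventually_eq_smul hg hσ hϑ hl0 hV h' hx.1 hx.2)
  -- Where the phase is some `d ≠ c`, it stays equal to `d` nearby; as `ξ` has no zeros, equality
  -- with `c • ξ` stays excluded.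
  have hB : IsOpen B := by
    refine isOpen_iff_mem_nhds.2 fun x hx => ?_
    obtain ⟨d, -, hd⟩ := h.exists_phase hg hσ hϑ hl0 hV h' hx.1
    have hdc : d ≠ c := by
      rintro rfl
      exact hx.2 hd
    filter_upwards [hV.mem_nhds hx.1, h.eventually_eq_smul hg hσ hϑ hl0 hV h' hx.1 hd] with z hz hz'
    refine ⟨hz, fun h0 => hdc ?_⟩
    exact smul_left_injective ℂ (h.ne_zero hg hσ hϑ hl0 hV hz) (hz'.symm.trans h0)
  have hAB : V ⊆ A ∪ B := fun x hx => (em (ξ' x = c • ξ x)).imp (fun h => ⟨hx, h⟩) fun h => ⟨hx, h⟩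
  have hdisj : Disjoint A B := Set.disjoint_left.2 fun x hxA hxB => hxB.2 hxA.2
  have := hVc.subset_left_of_subset_union hA hB hdisj hAB ⟨x₀, hx₀, hx₀, hc⟩
  exact fun x hx => (this hx).2

theorem IsAssociated.lagrangiansAgree (hg : IsLorentzMetric g) (hσ : IsPauli g σ)
    (hϑ : IsCoframe g ϑ) (hV : IsOpen V) (h : IsAssociated g σ ϑ l V s ξ) :
    LagrangiansAgree g σ ϑ l V s ξ := fun e he y hy =>
  (hϑ.isPatch hg hσ he hV).lagrangian_eq hy h.sign (h.parallel e he y hy) (h.current_in hy)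

theorem IsAssociated.fieldEquation_iff (hg : IsLorentzMetric g) (hσ : IsPauli g σ)
    (hϑ : IsCoframe g ϑ) (hl0 : l ≠ 0) (hV : IsOpen V) (h : IsAssociated g σ ϑ l V s ξ) :
    FieldEquation g ϑ l V ↔ WeylEquation g σ V ξ :=
  forall₂_congr fun e he => (hϑ.isPatch hg hσ he hV).isStationary_iff_weyl h.sign hl0
    (h.parallel e he) fun _ hy => h.current_in hy

end Assoc

end

end Teleparallel

end

/-! ### The theorem. -/

theorem theorem1 {M : Type*} [TopologicalSpace M] [ChartedSpace (EuclideanSpace ℝ (Fin 4)) M]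
    [IsManifold (𝓡 4) ∞ M] (hM : Teleparallel.IsOrientedAtlas M)
    (g : Teleparallel.BilinField M) (hg : Teleparallel.IsLorentzMetric g)
    (σ : Teleparallel.MatrixCovectorField M) (hσ : Teleparallel.IsPauli g σ)
    (ϑ : Fin 4 → Teleparallel.CovectorField M) (hϑ : Teleparallel.IsCoframe g ϑ)
    (l : Fin 4 → ℝ) (hl0 : l ≠ 0) (hl : ∑ j, ∑ k, Teleparallel.mink j k * l j * l k = 0) :
    (∀ p : M, ∃ V : Set M, IsOpen V ∧ IsConnected V ∧ p ∈ V ∧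
      ∃ (s : ℝ) (ξ : M → Fin 2 → ℂ), Teleparallel.IsAssociated g σ ϑ l V s ξ) ∧
    ∀ (V : Set M), IsOpen V → ∀ (s : ℝ) (ξ : M → Fin 2 → ℂ),
      Teleparallel.IsAssociated g σ ϑ l V s ξ →
        (IsPreconnected V → ∀ (s' : ℝ) (ξ' : M → Fin 2 → ℂ),
          Teleparallel.IsAssociated g σ ϑ l V s' ξ' →
            ∃ c : ℂ, ‖c‖ = 1 ∧ ∀ x ∈ V, ξ' x = c • ξ x) ∧
        Teleparallel.LagrangiansAgree g σ ϑ l V s ξ ∧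
        (Teleparallel.FieldEquation g ϑ l V ↔ Teleparallel.WeylEquation g σ V ξ) := by
  refine ⟨fun p => Teleparallel.exists_isAssociated hg hσ hϑ hl p, fun V hV s ξ h => ⟨?_, ?_, ?_⟩⟩
  · exact fun hVc s' ξ' h' => h.eq_smul hg hσ hϑ hl0 hV hVc h'
  · exact h.lagrangiansAgree hg hσ hϑ hV
  · exact h.fieldEquation_iff hg hσ hϑ hl0 hV
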